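/- Let $k$ be a field and let $C$ be a coalgebra over $k$ with comultiplication $\Delta$ and counit $\epsilon$. Let $G(C)$ be the set of grouplike elements of $C$, and suppose that $C$ is pointed, that is, its coradical (the sum of all simple subcoalgebras) equals the linear span $kG(C)$. For $g,h\in G(C)$ and $n\ge 0$ let $$\partial^n_{g,h}=g\otimes \mathrm{Id}^{\otimes n}+\sum_{i=0}^{n-1}(-1)^{i+1}\,\mathrm{Id}^{\otimes i}\otimes\Delta\otimes \mathrm{Id}^{\otimes(n-i-1)}+(-1)^{n+1}\,\mathrm{Id}^{\otimes n}\otimes h\;:\;C^{\otimes n}\to C^{\otimes (n+1)},$$ let $\mathfrak P^n_{g,h}(C)=\ker\partial^n_{g,h}/\operatorname{im}\partial^{n-1}_{g,h}$ (with $\operatorname{im}\partial^{-1}_{g,h}=0$), and let $\operatorname{PCdim} C\in\{-\infty\}\cup\mathbb N\cup\{\infty\}$ be the supremum of all $n$ such that $\mathfrak P^n_{g,h}(C)\ne 0$ for some $g,h\in G(C)$ (so $-\infty$ if $G(C)=\emptyset$). 1. Let $d\ge 0$ and let $C=\bigoplus_{a\in\mathbb N^d}C_a$ be a grading of $C$ as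 a coalgebra (that is, $\Delta(C_a)\subseteq\sum_{b+c=a}C_b\otimes C_c$ for all $a$, and $\epsilon(C_a)=0$ for $a\neq 0$) which is locally finite, i.e. $\dim_k C_a<\infty$ for every $a$. Let $C^\circ=\bigoplus_{a}(C_a)^*$ be the graded dual algebra, with the convolution product. Then $\operatorname{PCdim} C$ equals both the left and the right global dimension of the ring $C^\circ$ (the supremum of the projective dimensions of all left, respectively right, modules, where the zero module has projective dimension $-\infty$). 2. For every natural number $n\le\operatorname{PCdim} C$ there are $g,h\in G(C)$ such that $\mathfrak P^n_{g,h}(C)\neq 0$. -/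

import Mathlib

open scoped TensorProduct

noncomputable section

namespace PrimitiveCohomology

/-! ### Subcoalgebras, the coradical, pointed coalgebras -/

section Pointed

variable (k : Type*) {C : Type*} [Field k] [AddCommGroup C] [Module k C] [Coalgebra k C]

/-- A subspace `D` of `C` is a subcoalgebra if `Δ(D) ⊆ D ⊗ D` (inside `C ⊗ C`). -/
def IsSubcoalgebra (D : Submodule k C) : Prop :=
  ∀ c ∈ D, Coalgebra.comul (R := k) c ∈ LinearMap.range (TensorProduct.mapIncl D D)

/-- A simple subcoalgebra: nonzero, and without subcoalgebras other than `0` and itself. -/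
def IsSimpleSubcoalgebra (D : Submodule k C) : Prop :=
  IsSubcoalgebra k D ∧ D ≠ ⊥ ∧
    ∀ E : Submodule k C, IsSubcoalgebra k E → E ≤ D → E = ⊥ ∨ E = D

variable (C) in
/-- The coradical `C₀`: the sum of all simple subcoalgebras of `C`. -/
def coradical : Submodule k C :=
  sSup {D : Submodule k C | IsSimpleSubcoalgebra k D}

variable (C) in
/-- `C` is pointed if its coradical is the linear span of the grouplike elements. -/
def IsPointed : Prop :=
  coradical k C = Submodule.span k {g : C | IsGroupLikeElem k g}

end Pointed

/-! ### The complex `T_{g,h} C` and primitive cohomology -/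

section Cohomology

variable (k : Type*) (C : Type*) [Field k] [AddCommGroup C] [Module k C]

/-- The canonical isomorphism `C ⊗ C^{⊗ n} ≃ C^{⊗ (n+1)}`. -/
def consEquiv (n : ℕ) : C ⊗[k] (⨂[k]^n C) ≃ₗ[k] ⨂[k]^(n + 1) C :=
  (TensorProduct.congr
      (PiTensorProduct.subsingletonEquiv (R := k) (s := fun _ : Fin 1 => C) 0).symm
      (LinearEquiv.refl k (⨂[k]^n C))).trans
    ((TensorPower.mulEquiv (R := k) (M := C) (n := 1) (m := n)).trans
      (TensorPower.cast k C (Nat.add_comm 1 n)))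

theorem consEquiv_tmul_tprod (n : ℕ) (c : C) (a : Fin n → C) :
    consEquiv k C n (c ⊗ₜ[k] PiTensorProduct.tprod k a)
      = PiTensorProduct.tprod k (Fin.cons c a : Fin (n + 1) → C) := by
  have h := TensorPower.tprod_mul_tprod k (fun _ : Fin 1 => c) a
  rw [TensorPower.gMul_def] at h
  simp only [consEquiv, LinearEquiv.trans_apply, TensorProduct.congr_tmul,
    LinearEquiv.refl_apply, PiTensorProduct.subsingletonEquiv_symm_apply', h,
    TensorPower.cast_tprod]
  congr 1
  funext i
  refine Fin.cases ?_ (fun j => ?_) i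
  · have : Fin.cast (Nat.add_comm 1 n).symm 0 = Fin.castAdd n (0 : Fin 1) := by ext; simp
    simp [this]
  · have : Fin.cast (Nat.add_comm 1 n).symm j.succ = Fin.natAdd 1 j := by
      ext; simp [Nat.add_comm]
    simp [this]

variable {C} in
/-- The map `w ↦ g ⊗ w`, that is `g ⊗ Id^{⊗ n}`. -/
def leftTensor (g : C) (n : ℕ) : ⨂[k]^n C →ₗ[k] ⨂[k]^(n + 1) C :=
  (consEquiv k C n).toLinearMap ∘ₗ TensorProduct.mk k C (⨂[k]^n C) g

variable {C} in
/-- The map `w ↦ w ⊗ h`, that is `Id^{⊗ n} ⊗ h`. -/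
def rightTensor (h : C) (n : ℕ) : ⨂[k]^n C →ₗ[k] ⨂[k]^(n + 1) C :=
  (TensorPower.mulEquiv (R := k) (M := C) (n := n) (m := 1)).toLinearMap ∘ₗ
    (TensorProduct.mk k (⨂[k]^n C) (⨂[k]^1 C)).flip
      (PiTensorProduct.tprod k (fun _ : Fin 1 => h))

variable [Coalgebra k C]

/-- `comulAt n i` is `Id^{⊗ i} ⊗ Δ ⊗ Id^{⊗ (n-i-1)} : C^{⊗ n} → C^{⊗ (n+1)}`, where
`i = 0, …, n - 1`. -/
def comulAt : (n : ℕ) → Fin n → (⨂[k]^n C →ₗ[k] ⨂[k]^(n + 1) C)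
  | 0, i => i.elim0
  | n + 1, i =>
    Fin.cases
      ((consEquiv k C (n + 1)).toLinearMap ∘ₗ
        (consEquiv k C n).toLinearMap.lTensor C ∘ₗ
        (TensorProduct.assoc k C C (⨂[k]^n C)).toLinearMap ∘ₗ
        (Coalgebra.comul (R := k) (A := C)).rTensor (⨂[k]^n C) ∘ₗ
        (consEquiv k C n).symm.toLinearMap)
      (fun j =>
        (consEquiv k C (n + 1)).toLinearMap ∘ₗ
        (comulAt n j).lTensor C ∘ₗ
        (consEquiv k C n).symm.toLinearMap)
      i

variable {C}

/-- The differential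
`∂ⁿ_{g,h} = g ⊗ Id^{⊗ n} + ∑_{i<n} (-1)^{i+1} Id^{⊗ i} ⊗ Δ ⊗ Id^{⊗ (n-i-1)}
  + (-1)^{n+1} Id^{⊗ n} ⊗ h`. -/
def differential (g h : C) (n : ℕ) : ⨂[k]^n C →ₗ[k] ⨂[k]^(n + 1) C :=
  leftTensor k g n + ∑ i : Fin n, (-1 : k) ^ ((i : ℕ) + 1) • comulAt k C n i
    + (-1 : k) ^ (n + 1) • rightTensor k h n

/-- `Bⁿ_{g,h}`, the image of `∂ⁿ⁻¹_{g,h}` (zero for `n = 0`). -/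
def coboundaries (g h : C) : (n : ℕ) → Submodule k (⨂[k]^n C)
  | 0 => ⊥
  | n + 1 => LinearMap.range (differential k g h n)

/-- The `n`th primitive cohomology `𝔓ⁿ_{g,h}(C) = ker ∂ⁿ_{g,h} / im ∂ⁿ⁻¹_{g,h}`. -/
abbrev PrimCohomology (g h : C) (n : ℕ) : Type _ :=
  LinearMap.ker (differential k g h n) ⧸
    (coboundaries k g h n).submoduleOf (LinearMap.ker (differential k g h n))

variable (C) in
/-- The primitive cohomological dimension: the supremum in `{-∞} ∪ ℕ ∪ {∞}` of all `n` such that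
`𝔓ⁿ_{g,h}(C) ≠ 0` for some grouplike elements `g, h`. It is `-∞` (that is, `⊥`) if there is
no such `n`. -/
def PCdim : WithBot ℕ∞ :=
  sSup {x : WithBot ℕ∞ | ∃ n : ℕ, x = (n : WithBot ℕ∞) ∧
    ∃ g h : C, IsGroupLikeElem k g ∧ IsGroupLikeElem k h ∧ Nontrivial (PrimCohomology k g h n)}

end Cohomology

/-! ### Graded coalgebras and their graded duals -/

section Graded

variable (k : Type*) {C : Type*} [Field k] [AddCommGroup C] [Module k C] [Coalgebra k C]
variable {ι : Type*} [DecidableEq ι] [AddMonoid ι]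

/-- The subspaces `𝒜 n` make `C` a graded coalgebra: `C = ⨁ₙ 𝒜 n`,
`Δ(𝒜 n) ⊆ ∑_{i+j=n} 𝒜 i ⊗ 𝒜 j`, and `ε` vanishes on `𝒜 n` for `n ≠ 0`. -/
structure IsGradedCoalgebra (𝒜 : ι → Submodule k C) : Prop where
  isInternal : DirectSum.IsInternal 𝒜
  comul_mem : ∀ n, ∀ c ∈ 𝒜 n, Coalgebra.comul (R := k) c ∈
    ⨆ p : {p : ι × ι // p.1 + p.2 = n},
      LinearMap.range (TensorProduct.mapIncl (𝒜 p.1.1) (𝒜 p.1.2))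
  counit_eq_zero : ∀ n, n ≠ 0 → ∀ c ∈ 𝒜 n, Coalgebra.counit (R := k) c = 0

/-- The graded dual algebra `C° = ⨁ₙ (𝒜 n)^*` of a graded coalgebra: the linear forms on `C` that
vanish on all but finitely many of the `𝒜 n`, as a subalgebra of the full dual of `C` with the
convolution product `(f * g)(c) = ∑ f(c₁) g(c₂)` and unit `ε`. -/
def gradedDual {𝒜 : ι → Submodule k C} (h𝒜 : IsGradedCoalgebra k 𝒜) :
    Subalgebra k (WithConv (C →ₗ[k] k)) where
  carrier := {f | {n | ∃ c ∈ 𝒜 n, f c ≠ 0}.Finite}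
  mul_mem' := by
    intro f g hf hg
    refine (hf.add hg).subset ?_
    rintro n ⟨c, hc, hne⟩
    by_contra hn
    apply hne
    have key : (⨆ p : {p : ι × ι // p.1 + p.2 = n},
        LinearMap.range (TensorProduct.mapIncl (𝒜 p.1.1) (𝒜 p.1.2))) ≤
        LinearMap.ker (LinearMap.mul' k k ∘ₗ TensorProduct.map f.ofConv g.ofConv) := by
      refine iSup_le ?_
      rintro ⟨⟨i, j⟩, hij⟩
      rw [LinearMap.range_le_ker_iff]
      ext ⟨x, hx⟩ ⟨y, hy⟩
      by_cases h1 : f x = 0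
      · have h1' : f.ofConv x = 0 := h1
        simp [TensorProduct.mapIncl, h1']
      by_cases h2 : g y = 0
      · have h2' : g.ofConv y = 0 := h2
        simp [TensorProduct.mapIncl, h2']
      refine absurd ?_ hn
      rw [← hij]
      exact Set.add_mem_add ⟨x, hx, h1⟩ ⟨y, hy, h2⟩
    exact key (h𝒜.comul_mem n c hc)
  add_mem' := by
    intro f g hf hg
    refine (hf.union hg).subset ?_
    rintro n ⟨c, hc, hne⟩
    by_cases h1 : f c = 0
    · refine Or.inr ⟨c, hc, fun h2 => hne ?_⟩
      simp [h1, h2]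
    · exact Or.inl ⟨c, hc, h1⟩
  algebraMap_mem' := by
    intro r
    refine (Set.finite_singleton (0 : ι)).subset ?_
    rintro n ⟨c, hc, hne⟩
    by_contra hn
    apply hne
    simp [h𝒜.counit_eq_zero n hn c hc]

end Graded

/-- The (left) global dimension of a ring: the supremum of the projective dimensions of all left
modules. The right global dimension of `A` is `globalDim Aᵐᵒᵖ`. -/
def globalDim.{w} (A : Type w) [Ring A] : WithBot ℕ∞ :=
  ⨆ M : ModuleCat.{w} A, CategoryTheory.projectiveDimension M

end PrimitiveCohomology

end

/-! The object behind both claims is the cobar resolution of `C` by the bicomodules `C^{⊗ (m+2)}`,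
with differential `cobar`. Each term is cofree: a bicolinear map from `C^{⊗ (m+2)}` to `C^{⊗ (j+2)}`
is `hat s` for a unique linear `s` with values in `C^{⊗ j}`, and composing with `cobar` replaces `s`
by `hoch s` (`cobar_hat`, `counit_hat`). For grouplike `g`, `h` the map `w ↦ g ⊗ w ⊗ h` embeds the
complex `T_{g,h} C` into this resolution (`cobar_insertEnds`). In the other direction, a map that
vanishes on a subbicomodule `E`, evaluated at a vector spanning a one-dimensional subbicomodule of
the quotient by `E`, satisfies a `hoch` formula that reduces to `∂_{g,h}`
(`hoch_apply_of_quotient`).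

Because `C` is pointed, every nonzero bicomodule contains a one-dimensional subbicomodule
(`exists_eq_tmul_of_bicomodule`). Hence, if `𝔓ⁿ⁺¹_{g,h}(C) = 0` for all `g`, `h`, a Zorn argument
that adds one vector at a time gives a bicolinear `σ = hat s` on `C^{⊗ (n+2)}` that vanishes on the
image of the incoming differential and satisfies `cobar ∘ σ = cobar` (`exists_splitting`). So the
resolution splits at this place. The splitting yields bicolinear homotopies in all higher degrees,
and evaluating them at `g ⊗ z ⊗ h` kills all higher primitive cohomology
(`CohomologyVanishes.of_le`). Together with `𝔓⁰_{g,g} = k` this proves the second claim.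

For the first claim, the degree-preserving part of `σ` has the same properties, and by local
finiteness it has a transpose `S` on the tensor power `A^{⊗ (n+2)}` of `A = C°`. This `S` is a
bimodule endomorphism; applying `- ⊗_A M` splits the bar resolution of every module `M` in degree
`n`, so all projective dimensions are at most `n` (`IsGradedDuality.hasProjectiveDimensionLT`).
Conversely, grouplike elements are characters of `A`. A cocycle of `T_{g,h} C` defines, by pairing,
a bar cocycle for `Ext` from the character of `h` to that of `g`; if this is a coboundary, finitely
many degrees of the bounding cochain define an element of `C^{⊗ m}` bounding the given cocycle
(`IsGradedDuality.cohomologyVanishes`).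

The right global dimension follows by applying the left statement to the opposite coalgebra, because
reversing tensor factors identifies the primitive cohomologies. -/

noncomputable section

namespace PrimitiveCohomology

/-! ### Whiskering of linear maps between tensor powers -/

section TensorCalculus

variable (k : Type*) (V : Type*) [Field k] [AddCommGroup V] [Module k V]

/-- The canonical isomorphism `V^{⊗ n} ⊗ V ≃ V^{⊗ (n+1)}`. -/
def snocEquiv (n : ℕ) : (⨂[k]^n V) ⊗[k] V ≃ₗ[k] ⨂[k]^(n + 1) V :=
  (TensorProduct.congr (LinearEquiv.refl k (⨂[k]^n V))
      (PiTensorProduct.subsingletonEquiv (R := k) (s := fun _ : Fin 1 => V) 0).symm).trans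
    (TensorPower.mulEquiv (R := k) (M := V) (n := n) (m := 1))

theorem snocEquiv_tmul_tprod (n : ℕ) (c : V) (a : Fin n → V) :
    snocEquiv k V n (PiTensorProduct.tprod k a ⊗ₜ[k] c)
      = PiTensorProduct.tprod k (Fin.snoc a c : Fin (n + 1) → V) := by
  have h := TensorPower.tprod_mul_tprod k a (fun _ : Fin 1 => c)
  rw [TensorPower.gMul_def] at h
  simp only [snocEquiv, LinearEquiv.trans_apply, TensorProduct.congr_tmul,
    LinearEquiv.refl_apply, PiTensorProduct.subsingletonEquiv_symm_apply', h]
  congr 1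
  exact Fin.append_right_eq_snoc a (fun _ => c)

variable {k V}

theorem rightTensor_apply (h : V) (n : ℕ) (w : ⨂[k]^n V) :
    rightTensor k h n w = snocEquiv k V n (w ⊗ₜ h) := by
  simp [rightTensor, snocEquiv, PiTensorProduct.subsingletonEquiv_symm_apply']

theorem leftTensor_apply (g : V) (n : ℕ) (w : ⨂[k]^n V) :
    leftTensor k g n w = consEquiv k V n (g ⊗ₜ w) := rfl

variable {W : Type*} [AddCommGroup W] [Module k W]

theorem ext_cons {n : ℕ} {f g : ⨂[k]^(n + 1) V →ₗ[k] W}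
    (h : ∀ c w, f (consEquiv k V n (c ⊗ₜ w)) = g (consEquiv k V n (c ⊗ₜ w))) : f = g := by
  have : f ∘ₗ (consEquiv k V n).toLinearMap = g ∘ₗ (consEquiv k V n).toLinearMap :=
    TensorProduct.ext' h
  ext1
  ext a
  have := LinearMap.congr_fun this ((consEquiv k V n).symm (PiTensorProduct.tprod k a))
  simpa using this

theorem ext_snoc {n : ℕ} {f g : ⨂[k]^(n + 1) V →ₗ[k] W}
    (h : ∀ w c, f (snocEquiv k V n (w ⊗ₜ c)) = g (snocEquiv k V n (w ⊗ₜ c))) : f = g := by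
  have : f ∘ₗ (snocEquiv k V n).toLinearMap = g ∘ₗ (snocEquiv k V n).toLinearMap :=
    TensorProduct.ext' h
  ext1
  ext a
  have := LinearMap.congr_fun this ((snocEquiv k V n).symm (PiTensorProduct.tprod k a))
  simpa using this

theorem snoc_cons (n : ℕ) (c x : V) (w : ⨂[k]^n V) :
    snocEquiv k V (n + 1) (consEquiv k V n (c ⊗ₜ w) ⊗ₜ x) =
      consEquiv k V (n + 1) (c ⊗ₜ snocEquiv k V n (w ⊗ₜ x)) := by
  induction w using PiTensorProduct.induction_on with
  | smul_tprod r a =>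
    simp only [TensorProduct.tmul_smul, ← TensorProduct.smul_tmul', map_smul,
      consEquiv_tmul_tprod, snocEquiv_tmul_tprod, Fin.cons_snoc_eq_snoc_cons]
  | add y z hy hz =>
    simp only [TensorProduct.tmul_add, TensorProduct.add_tmul, map_add, hy, hz]

/-- In a single tensor factor the first and the last position coincide. This starts the inductions
that compare constructions made from the left end with those made from the right end. -/
theorem cons_zero_eq_snoc (c : V) (w : ⨂[k]^0 V) :
    consEquiv k V 0 (c ⊗ₜ w) = snocEquiv k V 0 (w ⊗ₜ c) := by
  induction w using PiTensorProduct.induction_on with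
  | smul_tprod r a =>
    simp only [TensorProduct.tmul_smul, ← TensorProduct.smul_tmul', map_smul,
      consEquiv_tmul_tprod, snocEquiv_tmul_tprod]
    congr 2
    funext i
    fin_cases i
    simp [Fin.snoc]
  | add y z hy hz =>
    simp only [TensorProduct.tmul_add, TensorProduct.add_tmul, map_add, hy, hz]

/-- `Id ⊗ f`. -/
def lWh {m l : ℕ} (f : ⨂[k]^m V →ₗ[k] ⨂[k]^l V) : ⨂[k]^(m + 1) V →ₗ[k] ⨂[k]^(l + 1) V :=
  (consEquiv k V l).toLinearMap ∘ₗ f.lTensor V ∘ₗ (consEquiv k V m).symm.toLinearMap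

/-- `f ⊗ Id`. -/
def rWh {m l : ℕ} (f : ⨂[k]^m V →ₗ[k] ⨂[k]^l V) : ⨂[k]^(m + 1) V →ₗ[k] ⨂[k]^(l + 1) V :=
  (snocEquiv k V l).toLinearMap ∘ₗ f.rTensor V ∘ₗ (snocEquiv k V m).symm.toLinearMap

@[simp]
theorem lWh_cons {m l : ℕ} (f : ⨂[k]^m V →ₗ[k] ⨂[k]^l V) (c : V) (w : ⨂[k]^m V) :
    lWh f (consEquiv k V m (c ⊗ₜ w)) = consEquiv k V l (c ⊗ₜ f w) := by
  simp [lWh]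

@[simp]
theorem rWh_snoc {m l : ℕ} (f : ⨂[k]^m V →ₗ[k] ⨂[k]^l V) (c : V) (w : ⨂[k]^m V) :
    rWh f (snocEquiv k V m (w ⊗ₜ c)) = snocEquiv k V l (f w ⊗ₜ c) := by
  simp [rWh]

theorem lWh_comp {m l p : ℕ} (f : ⨂[k]^l V →ₗ[k] ⨂[k]^p V) (g : ⨂[k]^m V →ₗ[k] ⨂[k]^l V) :
    lWh (f ∘ₗ g) = lWh f ∘ₗ lWh g := ext_cons fun c w => by simp

theorem rWh_comp {m l p : ℕ} (f : ⨂[k]^l V →ₗ[k] ⨂[k]^p V) (g : ⨂[k]^m V →ₗ[k] ⨂[k]^l V) :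
    rWh (f ∘ₗ g) = rWh f ∘ₗ rWh g := ext_snoc fun c w => by simp

variable (k V) in
/-- `lWh` as a linear map. -/
def lWhHom (m l : ℕ) : (⨂[k]^m V →ₗ[k] ⨂[k]^l V) →ₗ[k] (⨂[k]^(m + 1) V →ₗ[k] ⨂[k]^(l + 1) V) where
  toFun := lWh
  map_add' f g := ext_cons fun c w => by simp [TensorProduct.tmul_add]
  map_smul' r f := ext_cons fun c w => by simp [TensorProduct.tmul_smul]

variable (k V) in
/-- `rWh` as a linear map. -/
def rWhHom (m l : ℕ) : (⨂[k]^m V →ₗ[k] ⨂[k]^l V) →ₗ[k] (⨂[k]^(m + 1) V →ₗ[k] ⨂[k]^(l + 1) V) where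
  toFun := rWh
  map_add' f g := ext_snoc fun c w => by simp [TensorProduct.add_tmul]
  map_smul' r f := ext_snoc fun c w => by simp [← TensorProduct.smul_tmul']

section linear

variable {m l : ℕ} (f g : ⨂[k]^m V →ₗ[k] ⨂[k]^l V) (r : k)

theorem lWh_add : lWh (f + g) = lWh f + lWh g := (lWhHom k V m l).map_add f g

theorem lWh_sub : lWh (f - g) = lWh f - lWh g := (lWhHom k V m l).map_sub f g

theorem lWh_smul : lWh (r • f) = r • lWh f := (lWhHom k V m l).map_smul r f

variable (k V m l) in
theorem lWh_zero : lWh (0 : ⨂[k]^m V →ₗ[k] ⨂[k]^l V) = 0 := (lWhHom k V m l).map_zero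

theorem rWh_add : rWh (f + g) = rWh f + rWh g := (rWhHom k V m l).map_add f g

theorem rWh_sub : rWh (f - g) = rWh f - rWh g := (rWhHom k V m l).map_sub f g

theorem rWh_smul : rWh (r • f) = r • rWh f := (rWhHom k V m l).map_smul r f

variable (k V m l) in
theorem rWh_zero : rWh (0 : ⨂[k]^m V →ₗ[k] ⨂[k]^l V) = 0 := (rWhHom k V m l).map_zero

end linear

theorem neg_smul_hom {m l : ℕ} (r : k) (f : ⨂[k]^m V →ₗ[k] ⨂[k]^l V) : (-r) • f = -(r • f) := by
  refine eq_neg_of_add_eq_zero_left ?_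
  rw [← add_smul, neg_add_cancel, zero_smul]

variable (k V) in
theorem lWh_id (m : ℕ) : lWh (LinearMap.id : ⨂[k]^m V →ₗ[k] ⨂[k]^m V) = LinearMap.id :=
  ext_cons fun c w => by simp

theorem lWh_rWh {m l : ℕ} (f : ⨂[k]^m V →ₗ[k] ⨂[k]^l V) : lWh (rWh f) = rWh (lWh f) := by
  refine ext_cons fun c w => ?_
  obtain ⟨t, rfl⟩ := (snocEquiv k V m).surjective w
  induction t with
  | zero => simp
  | add x y hx hy => simp only [map_add, TensorProduct.tmul_add, hx, hy]
  | tmul w x => rw [lWh_cons, rWh_snoc, ← snoc_cons, ← snoc_cons, rWh_snoc, lWh_cons]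

end TensorCalculus

/-! ### The cobar differential on tensor powers -/

section Cobar

variable (k : Type*) (C : Type*) [Field k] [AddCommGroup C] [Module k C]

/-- `c ⊗ d ⊗ w`, linear in `c ⊗ d`. -/
def consTwo (n : ℕ) : (C ⊗[k] C) ⊗[k] (⨂[k]^n C) →ₗ[k] ⨂[k]^(n + 2) C :=
  (consEquiv k C (n + 1)).toLinearMap ∘ₗ (consEquiv k C n).toLinearMap.lTensor C ∘ₗ
    (TensorProduct.assoc k C C (⨂[k]^n C)).toLinearMap

/-- `w ⊗ c ⊗ d`, linear in `c ⊗ d`. -/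
def snocTwo (n : ℕ) : (⨂[k]^n C) ⊗[k] (C ⊗[k] C) →ₗ[k] ⨂[k]^(n + 2) C :=
  (snocEquiv k C (n + 1)).toLinearMap ∘ₗ (snocEquiv k C n).toLinearMap.rTensor C ∘ₗ
    (TensorProduct.assoc k (⨂[k]^n C) C C).symm.toLinearMap

variable {k C}

@[simp]
theorem consTwo_tmul (n : ℕ) (c d : C) (w : ⨂[k]^n C) :
    consTwo k C n ((c ⊗ₜ d) ⊗ₜ w) = consEquiv k C (n + 1) (c ⊗ₜ consEquiv k C n (d ⊗ₜ w)) := by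
  simp [consTwo]

@[simp]
theorem snocTwo_tmul (n : ℕ) (c d : C) (w : ⨂[k]^n C) :
    snocTwo k C n (w ⊗ₜ (c ⊗ₜ d)) = snocEquiv k C (n + 1) (snocEquiv k C n (w ⊗ₜ c) ⊗ₜ d) := by
  simp [snocTwo]

theorem lWh_snocTwo (n : ℕ) (c : C) (w : ⨂[k]^n C) (t : C ⊗[k] C) :
    consEquiv k C (n + 2) (c ⊗ₜ snocTwo k C n (w ⊗ₜ t)) =
      snocTwo k C (n + 1) (consEquiv k C n (c ⊗ₜ w) ⊗ₜ t) := by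
  induction t with
  | zero => simp
  | add x y hx hy => simp only [map_add, TensorProduct.tmul_add, hx, hy]
  | tmul a b => simp [snoc_cons]

theorem rWh_consTwo (n : ℕ) (c : C) (w : ⨂[k]^n C) (t : C ⊗[k] C) :
    snocEquiv k C (n + 2) (consTwo k C n (t ⊗ₜ w) ⊗ₜ c) =
      consTwo k C (n + 1) (t ⊗ₜ snocEquiv k C n (w ⊗ₜ c)) := by
  induction t with
  | zero => simp
  | add x y hx hy => simp only [map_add, TensorProduct.add_tmul, hx, hy]
  | tmul a b => simp [snoc_cons]

theorem consTwo_eq_snocTwo (w : ⨂[k]^0 C) (t : C ⊗[k] C) :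
    consTwo k C 0 (t ⊗ₜ w) = snocTwo k C 0 (w ⊗ₜ t) := by
  induction t with
  | zero => simp
  | add x y hx hy => simp only [map_add, TensorProduct.add_tmul, TensorProduct.tmul_add, hx, hy]
  | tmul a b => simp [cons_zero_eq_snoc, ← snoc_cons]

theorem lWh_lWh_consTwo {m l : ℕ} (f : ⨂[k]^m C →ₗ[k] ⨂[k]^l C) (t : C ⊗[k] C) (w : ⨂[k]^m C) :
    lWh (lWh f) (consTwo k C m (t ⊗ₜ w)) = consTwo k C l (t ⊗ₜ f w) := by
  induction t with
  | zero => simp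
  | add x y hx hy => simp only [map_add, TensorProduct.add_tmul, hx, hy]
  | tmul a b => simp

theorem rWh_rWh_snocTwo {m l : ℕ} (f : ⨂[k]^m C →ₗ[k] ⨂[k]^l C) (t : C ⊗[k] C) (w : ⨂[k]^m C) :
    rWh (rWh f) (snocTwo k C m (w ⊗ₜ t)) = snocTwo k C l (f w ⊗ₜ t) := by
  induction t with
  | zero => simp
  | add x y hx hy => simp only [map_add, TensorProduct.tmul_add, hx, hy]
  | tmul a b => simp

variable [Coalgebra k C]

variable (k C) in
/-- `Δ` on the first factor. -/
def comulFirst (n : ℕ) : ⨂[k]^(n + 1) C →ₗ[k] ⨂[k]^(n + 2) C := comulAt k C (n + 1) 0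

variable (k C) in
/-- `Δ` on the last factor. -/
def comulLast (n : ℕ) : ⨂[k]^(n + 1) C →ₗ[k] ⨂[k]^(n + 2) C :=
  snocTwo k C n ∘ₗ (Coalgebra.comul (R := k) (A := C)).lTensor _ ∘ₗ
    (snocEquiv k C n).symm.toLinearMap

theorem comulFirst_cons (n : ℕ) (c : C) (w : ⨂[k]^n C) :
    comulFirst k C n (consEquiv k C n (c ⊗ₜ w)) =
      consTwo k C n (Coalgebra.comul (R := k) c ⊗ₜ w) := by
  simp [comulFirst, comulAt, consTwo]

theorem comulLast_snoc (n : ℕ) (c : C) (w : ⨂[k]^n C) :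
    comulLast k C n (snocEquiv k C n (w ⊗ₜ c)) =
      snocTwo k C n (w ⊗ₜ Coalgebra.comul (R := k) c) := by
  simp [comulLast]

theorem comulAt_succ (n : ℕ) (i : Fin n) : comulAt k C (n + 1) i.succ = lWh (comulAt k C n i) := rfl

variable (k C) in
theorem comulFirst_zero : comulFirst k C 0 = comulLast k C 0 := by
  refine ext_cons fun c w => ?_
  rw [comulFirst_cons, cons_zero_eq_snoc, comulLast_snoc, consTwo_eq_snocTwo]

variable (k C) in
theorem rWh_comulFirst (n : ℕ) : rWh (comulFirst k C n) = comulFirst k C (n + 1) := by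
  refine ext_snoc fun w x => ?_
  obtain ⟨t, rfl⟩ := (consEquiv k C n).surjective w
  induction t with
  | zero => simp
  | add x y hx hy => simp only [map_add, TensorProduct.add_tmul, hx, hy]
  | tmul c w => rw [rWh_snoc, comulFirst_cons, snoc_cons, comulFirst_cons, rWh_consTwo]

variable (k C) in
theorem lWh_comulLast (n : ℕ) : lWh (comulLast k C n) = comulLast k C (n + 1) := by
  refine ext_cons fun x w => ?_
  obtain ⟨t, rfl⟩ := (snocEquiv k C n).surjective w
  induction t with
  | zero => simp
  | add x y hx hy => simp only [map_add, TensorProduct.tmul_add, hx, hy]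
  | tmul w c => rw [lWh_cons, comulLast_snoc, ← snoc_cons, comulLast_snoc, lWh_snocTwo]

theorem comulFirst_lWh {m l : ℕ} (f : ⨂[k]^m C →ₗ[k] ⨂[k]^l C) :
    comulFirst k C l ∘ₗ lWh f = lWh (lWh f) ∘ₗ comulFirst k C m := by
  refine ext_cons fun x w => ?_
  simp [comulFirst_cons, lWh_lWh_consTwo]

theorem comulLast_rWh {m l : ℕ} (f : ⨂[k]^m C →ₗ[k] ⨂[k]^l C) :
    comulLast k C l ∘ₗ rWh f = rWh (rWh f) ∘ₗ comulLast k C m := by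
  refine ext_snoc fun x w => ?_
  simp [comulLast_snoc, rWh_rWh_snocTwo]

variable (k C) in
theorem comulFirst_comulFirst (n : ℕ) :
    comulFirst k C (n + 1) ∘ₗ comulFirst k C n = lWh (comulFirst k C n) ∘ₗ comulFirst k C n := by
  refine ext_cons fun c w => ?_
  -- `Φ` sends `a ⊗ (b ⊗ c)` to `a ⊗ b ⊗ c ⊗ w`; both sides of the claim are `Φ` applied to the two
  -- sides of coassociativity for `c`.
  let Φ : C ⊗[k] (C ⊗[k] C) →ₗ[k] ⨂[k]^(n + 3) C :=
    (consEquiv k C (n + 2)).toLinearMap ∘ₗ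
      ((consTwo k C n) ∘ₗ (TensorProduct.mk k _ _).flip w).lTensor C
  have h1 : ∀ t : C ⊗[k] C, comulFirst k C (n + 1) (consTwo k C n (t ⊗ₜ w)) =
      Φ (TensorProduct.assoc k C C C ((Coalgebra.comul (R := k)).rTensor C t)) := by
    intro t
    induction t with
    | zero => simp
    | add x y hx hy => simp only [map_add, TensorProduct.add_tmul, hx, hy]
    | tmul a b =>
      rw [consTwo_tmul, comulFirst_cons, LinearMap.rTensor_tmul]
      generalize Coalgebra.comul (R := k) a = s
      induction s with
      | zero => simp
      | add x y hx hy => simp only [map_add, TensorProduct.add_tmul, hx, hy]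
      | tmul p q => simp [Φ]
  have h2 : ∀ t : C ⊗[k] C, lWh (comulFirst k C n) (consTwo k C n (t ⊗ₜ w)) =
      Φ ((Coalgebra.comul (R := k)).lTensor C t) := by
    intro t
    induction t with
    | zero => simp
    | add x y hx hy => simp only [map_add, TensorProduct.add_tmul, hx, hy]
    | tmul a b => simp [Φ, comulFirst_cons]
  rw [LinearMap.comp_apply, LinearMap.comp_apply, comulFirst_cons, h1, h2,
    Coalgebra.coassoc_apply]

variable (k C) in
theorem comulLast_comulLast (n : ℕ) :
    comulLast k C (n + 1) ∘ₗ comulLast k C n = rWh (comulLast k C n) ∘ₗ comulLast k C n := by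
  refine ext_snoc fun w c => ?_
  let Φ : (C ⊗[k] C) ⊗[k] C →ₗ[k] ⨂[k]^(n + 3) C :=
    (snocEquiv k C (n + 2)).toLinearMap ∘ₗ
      ((snocTwo k C n) ∘ₗ (TensorProduct.mk k _ _) w).rTensor C
  have h1 : ∀ t : C ⊗[k] C, comulLast k C (n + 1) (snocTwo k C n (w ⊗ₜ t)) =
      Φ ((TensorProduct.assoc k C C C).symm ((Coalgebra.comul (R := k)).lTensor C t)) := by
    intro t
    induction t with
    | zero => simp
    | add x y hx hy => simp only [map_add, TensorProduct.tmul_add, hx, hy]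
    | tmul a b =>
      rw [snocTwo_tmul, comulLast_snoc, LinearMap.lTensor_tmul]
      generalize Coalgebra.comul (R := k) b = s
      induction s with
      | zero => simp
      | add x y hx hy => simp only [map_add, TensorProduct.tmul_add, hx, hy]
      | tmul p q => simp [Φ]
  have h2 : ∀ t : C ⊗[k] C, rWh (comulLast k C n) (snocTwo k C n (w ⊗ₜ t)) =
      Φ ((Coalgebra.comul (R := k)).rTensor C t) := by
    intro t
    induction t with
    | zero => simp
    | add x y hx hy => simp only [map_add, TensorProduct.tmul_add, hx, hy]
    | tmul a b => simp [Φ, comulLast_snoc]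
  rw [LinearMap.comp_apply, LinearMap.comp_apply, comulLast_snoc, h1, h2,
    Coalgebra.coassoc_symm_apply]

variable (k C) in
-- With at least two factors the two comultiplications act on different factors; with one factor
-- this is coassociativity.
theorem comulFirst_comulLast (n : ℕ) :
    comulFirst k C (n + 1) ∘ₗ comulLast k C n = comulLast k C (n + 1) ∘ₗ comulFirst k C n := by
  cases n with
  | zero =>
    rw [← comulFirst_zero, comulFirst_comulFirst, ← lWh_comulLast, comulFirst_zero]
  | succ n =>
    rw [← rWh_comulFirst k C n, comulLast_rWh, rWh_comulFirst, rWh_comulFirst]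

variable (k C) in
/-- `ε` on the first factor. -/
def counitFirst (n : ℕ) : ⨂[k]^(n + 1) C →ₗ[k] ⨂[k]^n C :=
  (TensorProduct.lid k _).toLinearMap ∘ₗ (Coalgebra.counit (R := k) (A := C)).rTensor _ ∘ₗ
    (consEquiv k C n).symm.toLinearMap

variable (k C) in
/-- `ε` on the last factor. -/
def counitLast (n : ℕ) : ⨂[k]^(n + 1) C →ₗ[k] ⨂[k]^n C :=
  (TensorProduct.rid k _).toLinearMap ∘ₗ (Coalgebra.counit (R := k) (A := C)).lTensor _ ∘ₗ
    (snocEquiv k C n).symm.toLinearMap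

@[simp]
theorem counitFirst_cons (n : ℕ) (c : C) (w : ⨂[k]^n C) :
    counitFirst k C n (consEquiv k C n (c ⊗ₜ w)) = Coalgebra.counit (R := k) c • w := by
  simp [counitFirst]

@[simp]
theorem counitLast_snoc (n : ℕ) (c : C) (w : ⨂[k]^n C) :
    counitLast k C n (snocEquiv k C n (w ⊗ₜ c)) = Coalgebra.counit (R := k) c • w := by
  simp [counitLast]

theorem counitFirst_lWh {m l : ℕ} (f : ⨂[k]^m C →ₗ[k] ⨂[k]^l C) :
    counitFirst k C l ∘ₗ lWh f = f ∘ₗ counitFirst k C m := ext_cons fun c w => by simp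

theorem counitLast_rWh {m l : ℕ} (f : ⨂[k]^m C →ₗ[k] ⨂[k]^l C) :
    counitLast k C l ∘ₗ rWh f = f ∘ₗ counitLast k C m := ext_snoc fun c w => by simp

variable (k C) in
theorem counitFirst_comulFirst (n : ℕ) :
    counitFirst k C (n + 1) ∘ₗ comulFirst k C n = LinearMap.id := by
  refine ext_cons fun c w => ?_
  have h : ∀ t : C ⊗[k] C, counitFirst k C (n + 1) (consTwo k C n (t ⊗ₜ w)) =
      consEquiv k C n (TensorProduct.lid k C ((Coalgebra.counit (R := k)).rTensor C t) ⊗ₜ w) := by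
    intro t
    induction t with
    | zero => simp
    | add x y hx hy => simp only [map_add, TensorProduct.add_tmul, hx, hy]
    | tmul a b => simp [← TensorProduct.smul_tmul']
  simp [comulFirst_cons, h]

variable (k C) in
theorem lWh_counitFirst_comulFirst (n : ℕ) :
    lWh (counitFirst k C n) ∘ₗ comulFirst k C n = LinearMap.id := by
  refine ext_cons fun c w => ?_
  have h : ∀ t : C ⊗[k] C, lWh (counitFirst k C n) (consTwo k C n (t ⊗ₜ w)) =
      consEquiv k C n (TensorProduct.rid k C ((Coalgebra.counit (R := k)).lTensor C t) ⊗ₜ w) := by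
    intro t
    induction t with
    | zero => simp
    | add x y hx hy => simp only [map_add, TensorProduct.add_tmul, hx, hy]
    | tmul a b => simp [← TensorProduct.smul_tmul']
  simp [comulFirst_cons, h]

variable (k C) in
theorem counitLast_comulLast (n : ℕ) :
    counitLast k C (n + 1) ∘ₗ comulLast k C n = LinearMap.id := by
  refine ext_snoc fun w c => ?_
  have h : ∀ t : C ⊗[k] C, counitLast k C (n + 1) (snocTwo k C n (w ⊗ₜ t)) =
      snocEquiv k C n (w ⊗ₜ TensorProduct.rid k C ((Coalgebra.counit (R := k)).lTensor C t)) := by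
    intro t
    induction t with
    | zero => simp
    | add x y hx hy => simp only [map_add, TensorProduct.tmul_add, hx, hy]
    | tmul a b => simp
  simp [comulLast_snoc, h]

variable (k C) in
theorem rWh_counitLast_comulLast (n : ℕ) :
    rWh (counitLast k C n) ∘ₗ comulLast k C n = LinearMap.id := by
  refine ext_snoc fun w c => ?_
  have h : ∀ t : C ⊗[k] C, rWh (counitLast k C n) (snocTwo k C n (w ⊗ₜ t)) =
      snocEquiv k C n (w ⊗ₜ TensorProduct.lid k C ((Coalgebra.counit (R := k)).rTensor C t)) := by
    intro t
    induction t with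
    | zero => simp
    | add x y hx hy => simp only [map_add, TensorProduct.tmul_add, hx, hy]
    | tmul a b => simp [TensorProduct.smul_tmul']
  simp [comulLast_snoc, h]

variable (k C) in
/-- The cobar differential `∑ᵢ (-1)ⁱ Id^{⊗ i} ⊗ Δ ⊗ Id^{⊗ (n-i-1)}`. -/
def cobar (n : ℕ) : ⨂[k]^n C →ₗ[k] ⨂[k]^(n + 1) C :=
  ∑ i : Fin n, (-1 : k) ^ (i : ℕ) • comulAt k C n i

variable (k C) in
theorem cobar_zero : cobar k C 0 = 0 := by simp [cobar]

variable (k C) in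
theorem cobar_succ (n : ℕ) : cobar k C (n + 1) = comulFirst k C n - lWh (cobar k C n) := by
  rw [cobar, Fin.sum_univ_succ]
  have : lWh (cobar k C n) = ∑ i : Fin n, (-1 : k) ^ (i : ℕ) • lWh (comulAt k C n i) := by
    change lWhHom k C _ _ _ = _
    simp [cobar, lWhHom]
  rw [this, sub_eq_add_neg, ← Finset.sum_neg_distrib]
  congr 1
  · simp [comulFirst]
  · refine Finset.sum_congr rfl fun i _ => ?_
    rw [comulAt_succ, Fin.val_succ, pow_succ, mul_neg_one]
    exact neg_smul_hom _ _

theorem differential_eq (g h : C) (n : ℕ) : differential k g h n =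
    leftTensor k g n - cobar k C n + (-1 : k) ^ (n + 1) • rightTensor k h n := by
  rw [differential, cobar, sub_eq_add_neg (leftTensor k g n), ← Finset.sum_neg_distrib]
  congr 2
  refine Finset.sum_congr rfl fun i _ => ?_
  rw [pow_succ, mul_neg_one]
  exact neg_smul_hom _ _

variable (k C) in
-- The companion of `cobar_succ` that peels off the last factor. The comultiplication on that factor
-- is the summand with index `n`, hence the sign.
theorem cobar_succ' (n : ℕ) :
    cobar k C (n + 1) = rWh (cobar k C n) + (-1 : k) ^ n • comulLast k C n := by
  induction n with
  | zero => rw [cobar_succ, cobar_zero, lWh_zero, rWh_zero, comulFirst_zero]; simp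
  | succ n ih =>
    rw [cobar_succ k C (n + 1)]
    conv_lhs => rw [ih]
    rw [cobar_succ k C n, rWh_sub, rWh_comulFirst, lWh_add, lWh_rWh, lWh_smul, lWh_comulLast, pow_succ,
      mul_neg_one]
    have : (-(-1 : k) ^ n) • comulLast k C (n + 1) = -((-1 : k) ^ n • comulLast k C (n + 1)) :=
      neg_smul_hom _ _
    rw [this]
    abel

variable (k C) in
theorem cobar_comp_cobar (n : ℕ) : cobar k C (n + 1) ∘ₗ cobar k C n = 0 := by
  induction n with
  | zero => simp [cobar_zero]
  | succ n ih =>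
    rw [cobar_succ k C (n + 1), LinearMap.sub_comp]
    conv_lhs => enter [1]; rw [cobar_succ k C n]
    rw [LinearMap.comp_sub, comulFirst_lWh]
    have : lWh (cobar k C (n + 1)) ∘ₗ cobar k C (n + 1) =
        lWh (cobar k C (n + 1)) ∘ₗ comulFirst k C n := by
      conv_lhs => enter [2]; rw [cobar_succ k C n]
      rw [LinearMap.comp_sub, ← lWh_comp, ih, lWh_zero, sub_zero]
    rw [this]
    conv_lhs => enter [2]; rw [cobar_succ k C n]
    rw [lWh_sub, LinearMap.sub_comp, comulFirst_comulFirst]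
    abel

variable (k C) in
-- The counit on the first factor is a contracting homotopy, so the cobar complex is exact. It is
-- not colinear on the left, which is why an exact complex can still fail to split as a complex of
-- bicomodules.
theorem counitFirst_cobar (n : ℕ) : counitFirst k C (n + 1) ∘ₗ cobar k C (n + 1) =
    LinearMap.id - cobar k C n ∘ₗ counitFirst k C n := by
  rw [cobar_succ, LinearMap.comp_sub, counitFirst_comulFirst, counitFirst_lWh]

variable (k C) in
-- Left colinearity of the cobar differential: in the recursion from the left end, the only term
-- that touches the first factor is handled by coassociativity. The next lemma is the right-hand
-- version.
theorem comulFirst_cobar (n : ℕ) : comulFirst k C (n + 1) ∘ₗ cobar k C (n + 1) =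
    lWh (cobar k C (n + 1)) ∘ₗ comulFirst k C n := by
  rw [cobar_succ k C n, LinearMap.comp_sub, comulFirst_lWh, comulFirst_comulFirst, lWh_sub,
    LinearMap.sub_comp]

variable (k C) in
theorem comulLast_cobar (n : ℕ) : comulLast k C (n + 1) ∘ₗ cobar k C (n + 1) =
    rWh (cobar k C (n + 1)) ∘ₗ comulLast k C n := by
  rw [cobar_succ' k C n, LinearMap.comp_add, comulLast_rWh, LinearMap.comp_smul,
    comulLast_comulLast, rWh_add, rWh_smul, LinearMap.add_comp, LinearMap.smul_comp]

end Cobar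

/-! ### Comodules over a pointed coalgebra -/

section Slices

variable {k : Type*} {C M M' : Type*} [Field k] [AddCommGroup C] [Module k C]
  [AddCommGroup M] [Module k M] [AddCommGroup M'] [Module k M']

/-- `f ⊗ Id : C ⊗ M → M`. -/
def slice (f : C →ₗ[k] k) : C ⊗[k] M →ₗ[k] M :=
  (TensorProduct.lid k M).toLinearMap ∘ₗ f.rTensor M

@[simp]
theorem slice_tmul (f : C →ₗ[k] k) (c : C) (x : M) : slice f (c ⊗ₜ[k] x) = f c • x := by
  simp [slice]

theorem slice_lTensor (f : C →ₗ[k] k) (F : M →ₗ[k] M') (t : C ⊗[k] M) :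
    slice f (F.lTensor C t) = F (slice f t) := by
  induction t with
  | zero => simp
  | add x y hx hy => simp only [map_add, hx, hy]
  | tmul a b => simp

theorem eq_zero_of_slice {t : C ⊗[k] M} (h : ∀ f : C →ₗ[k] k, slice f t = 0) : t = 0 := by
  classical
  let b := Module.Basis.ofVectorSpace k C
  apply (TensorProduct.equivFinsuppOfBasisLeft (N := M) b).injective
  rw [map_zero]
  ext i
  have : ∀ s : C ⊗[k] M, TensorProduct.equivFinsuppOfBasisLeft b s i = slice (b.coord i) s := by
    intro s
    induction s with
    | zero => simp
    | add x y hx hy => simp only [map_add, Finsupp.add_apply, hx, hy]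
    | tmul a b => simp
  rw [this, h]
  rfl

theorem eq_of_slice {s t : C ⊗[k] M} (h : ∀ f : C →ₗ[k] k, slice f s = slice f t) : s = t :=
  sub_eq_zero.1 (eq_zero_of_slice fun f => by rw [map_sub, h, sub_self])

theorem exists_finite_slice_mem (t : C ⊗[k] M) :
    ∃ P : Submodule k M, Module.Finite k P ∧ ∀ f : C →ₗ[k] k, slice f t ∈ P := by
  induction t with
  | zero => exact ⟨⊥, inferInstance, by simp⟩
  | tmul a b =>
    refine ⟨Submodule.span k {b}, inferInstance, fun f => ?_⟩
    rw [slice_tmul]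
    exact Submodule.smul_mem _ _ (Submodule.mem_span_singleton_self b)
  | add x y hx hy =>
    obtain ⟨P, hP, h1⟩ := hx
    obtain ⟨Q, hQ, h2⟩ := hy
    refine ⟨P ⊔ Q, inferInstance, fun f => ?_⟩
    rw [map_add]
    exact Submodule.add_mem_sup (h1 f) (h2 f)

theorem comm_lTensor_slice (f : C →ₗ[k] k) (t : M ⊗[k] C) :
    slice f (TensorProduct.comm k M C t) = TensorProduct.rid k M (f.lTensor M t) := by
  induction t with
  | zero => simp
  | add x y hx hy => simp only [map_add, hx, hy]
  | tmul a b => simp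

/-- This is `(D ⊗ C) ∩ (C ⊗ D) = D ⊗ D`: a linear retraction of `C` onto `D`, applied to either
factor, fixes `t`, so applying it to both factors gives a preimage. It lets the subcoalgebra
condition be tested by slices. -/
theorem mem_range_mapIncl {D : Submodule k C} {t : C ⊗[k] C}
    (h1 : ∀ f : C →ₗ[k] k, slice f t ∈ D)
    (h2 : ∀ f : C →ₗ[k] k, slice f (TensorProduct.comm k C C t) ∈ D) :
    t ∈ LinearMap.range (TensorProduct.mapIncl D D) := by
  obtain ⟨p, hp⟩ := D.subtype.exists_leftInverse_of_injective D.ker_subtype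
  have hp' : ∀ c ∈ D, D.subtype (p c) = c := fun c hc => by
    have := LinearMap.congr_fun hp ⟨c, hc⟩
    simp only [LinearMap.comp_apply, Submodule.subtype_apply, LinearMap.id_apply] at this
    simp [this]
  have e1 : (D.subtype ∘ₗ p).lTensor C t = t :=
    eq_of_slice fun f => by rw [slice_lTensor]; exact hp' _ (h1 f)
  have e2 : (D.subtype ∘ₗ p).rTensor C t = t := by
    apply (TensorProduct.comm k C C).injective
    have : TensorProduct.comm k C C ((D.subtype ∘ₗ p).rTensor C t) =
        (D.subtype ∘ₗ p).lTensor C (TensorProduct.comm k C C t) := by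
      rw [← LinearMap.comm_comp_rTensor_comp_comm_eq]; simp
    rw [this]
    exact eq_of_slice fun f => by rw [slice_lTensor]; exact hp' _ (h2 f)
  refine ⟨TensorProduct.map p p t, ?_⟩
  have : TensorProduct.mapIncl D D (TensorProduct.map p p t) =
      (D.subtype ∘ₗ p).lTensor C ((D.subtype ∘ₗ p).rTensor C t) := by
    induction t with
    | zero => simp
    | add x y hx hy =>
      clear hx hy
      simp only [TensorProduct.mapIncl, ← LinearMap.comp_apply, ← TensorProduct.map_comp,
        LinearMap.lTensor_comp_rTensor]
    | tmul a b => simp [TensorProduct.mapIncl]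
  rw [this, e2, e1]

theorem slice_mem_of_mem_range_mapIncl {D : Submodule k C} {t : C ⊗[k] C}
    (h : t ∈ LinearMap.range (TensorProduct.mapIncl D D)) (f : C →ₗ[k] k) : slice f t ∈ D := by
  obtain ⟨s, rfl⟩ := h
  induction s with
  | zero => simp
  | add x y hx hy => simpa only [map_add] using D.add_mem hx hy
  | tmul a b => simpa [TensorProduct.mapIncl] using D.smul_mem _ b.2

theorem slice_comm_mem_of_mem_range_mapIncl {D : Submodule k C} {t : C ⊗[k] C}
    (h : t ∈ LinearMap.range (TensorProduct.mapIncl D D)) (f : C →ₗ[k] k) :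
    slice f (TensorProduct.comm k C C t) ∈ D := by
  obtain ⟨s, rfl⟩ := h
  induction s with
  | zero => simp
  | add x y hx hy => simpa only [map_add] using D.add_mem hx hy
  | tmul a b => simpa [TensorProduct.mapIncl] using D.smul_mem _ a.2

/-- A subspace `N` is a subcomodule if it is stable under all `(f ⊗ Id) ρ`. -/
def IsStable (ρ : M →ₗ[k] C ⊗[k] M) (N : Submodule k M) : Prop :=
  ∀ f : C →ₗ[k] k, ∀ x ∈ N, slice f (ρ x) ∈ N

/-- The matrix coefficient `(Id ⊗ ψ) ρ`. -/
def coeff (ρ : M →ₗ[k] C ⊗[k] M) (ψ : M →ₗ[k] k) : M →ₗ[k] C :=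
  (TensorProduct.rid k C).toLinearMap ∘ₗ ψ.lTensor C ∘ₗ ρ

theorem exists_finite_coeff_mem (ρ : M →ₗ[k] C ⊗[k] M) (N : Submodule k M) [Module.Finite k N] :
    ∃ P : Submodule k C, Module.Finite k P ∧ ∀ (ψ : M →ₗ[k] k), ∀ x ∈ N, coeff ρ ψ x ∈ P := by
  obtain ⟨s, hs⟩ := (Module.Finite.iff_fg (N := N)).1 inferInstance
  choose Q hQ hQ' using fun x : M => exists_finite_slice_mem (TensorProduct.comm k C M (ρ x))
  refine ⟨⨆ x : s, Q x, inferInstance, fun ψ x hx => ?_⟩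
  rw [← hs] at hx
  induction hx using Submodule.span_induction with
  | mem x hx =>
    refine Submodule.mem_iSup_of_mem (⟨x, hx⟩ : s) ?_
    have := hQ' x ψ
    rwa [comm_lTensor_slice] at this
  | zero => simp
  | add x y _ _ hx hy => simpa only [map_add] using Submodule.add_mem _ hx hy
  | smul r x _ hx => simpa only [map_smul] using Submodule.smul_mem _ r hx

variable [Coalgebra k C]

theorem isSubcoalgebra_iff_slice {D : Submodule k C} : IsSubcoalgebra k D ↔
    ∀ c ∈ D, ∀ f : C →ₗ[k] k, slice f (Coalgebra.comul (R := k) c) ∈ D ∧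
      slice f (TensorProduct.comm k C C (Coalgebra.comul (R := k) c)) ∈ D :=
  ⟨fun h c hc f => ⟨slice_mem_of_mem_range_mapIncl (h c hc) f,
    slice_comm_mem_of_mem_range_mapIncl (h c hc) f⟩,
  fun h c hc => mem_range_mapIncl (fun f => (h c hc f).1) (fun f => (h c hc f).2)⟩

/-- `ρ : M → C ⊗ M` is a left comodule structure. -/
structure IsLeftComodule (ρ : M →ₗ[k] C ⊗[k] M) : Prop where
  coassoc : ∀ x, TensorProduct.assoc k C C M ((Coalgebra.comul (R := k)).rTensor M (ρ x)) =
    ρ.lTensor C (ρ x)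
  counit : ∀ x, slice (Coalgebra.counit (R := k)) (ρ x) = x

namespace IsLeftComodule

variable {ρ : M →ₗ[k] C ⊗[k] M}

/-- By coassociativity a left comodule is a right module over the convolution algebra of linear
forms on `C`. -/
theorem slice_slice (hρ : IsLeftComodule ρ) (f f' : C →ₗ[k] k) (x : M) : slice f (ρ (slice f' (ρ x))) =
    slice (LinearMap.mul' k k ∘ₗ TensorProduct.map f' f ∘ₗ Coalgebra.comul (R := k)) (ρ x) := by
  rw [← slice_lTensor, ← hρ.coassoc]
  generalize ρ x = t
  induction t with
  | zero => simp
  | add x y hx hy => simp only [map_add, hx, hy]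
  | tmul a b =>
    simp only [LinearMap.rTensor_tmul, slice_tmul, LinearMap.comp_apply]
    generalize Coalgebra.comul (R := k) a = s
    induction s with
    | zero => simp
    | add x y hx hy => simp only [map_add, TensorProduct.add_tmul, add_smul, hx, hy]
    | tmul p q => simp [mul_smul]

theorem comul_coeff (hρ : IsLeftComodule ρ) (ψ : M →ₗ[k] k) (x : M) :
    Coalgebra.comul (R := k) (coeff ρ ψ x) = (coeff ρ ψ).lTensor C (ρ x) := by
  have h1 : ∀ t : C ⊗[k] M, Coalgebra.comul (R := k) (TensorProduct.rid k C (ψ.lTensor C t)) =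
      ((TensorProduct.rid k C).toLinearMap ∘ₗ ψ.lTensor C).lTensor C
        (TensorProduct.assoc k C C M ((Coalgebra.comul (R := k)).rTensor M t)) := by
    intro t
    induction t with
    | zero => simp
    | add x y hx hy => simp only [map_add, hx, hy]
    | tmul a b =>
      simp only [LinearMap.rTensor_tmul, LinearMap.lTensor_tmul, TensorProduct.rid_tmul, map_smul]
      generalize Coalgebra.comul (R := k) a = s
      induction s with
      | zero => simp
      | add x y hx hy => simp only [map_add, TensorProduct.add_tmul, smul_add, hx, hy]
      | tmul p q => simp
  rw [coeff, LinearMap.comp_apply, LinearMap.comp_apply, LinearEquiv.coe_coe, h1, hρ.coassoc,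
    ← LinearMap.comp_assoc, LinearMap.lTensor_comp _ _ ρ, LinearMap.comp_apply]

theorem slice_comul_coeff (hρ : IsLeftComodule ρ) (f : C →ₗ[k] k) (ψ : M →ₗ[k] k) (x : M) :
    slice f (Coalgebra.comul (R := k) (coeff ρ ψ x)) = coeff ρ ψ (slice f (ρ x)) := by
  rw [hρ.comul_coeff, slice_lTensor]

theorem slice_comm_comul_coeff (hρ : IsLeftComodule ρ) (f : C →ₗ[k] k) (ψ : M →ₗ[k] k) (x : M) :
    slice f (TensorProduct.comm k C C (Coalgebra.comul (R := k) (coeff ρ ψ x))) =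
      coeff ρ (f ∘ₗ coeff ρ ψ) x := by
  rw [comm_lTensor_slice, hρ.comul_coeff, ← LinearMap.comp_apply, ← LinearMap.lTensor_comp]
  rfl

theorem counit_coeff (hρ : IsLeftComodule ρ) (ψ : M →ₗ[k] k) (x : M) :
    Coalgebra.counit (R := k) (coeff ρ ψ x) = ψ x := by
  conv_rhs => rw [← hρ.counit x]
  have h : ∀ t : C ⊗[k] M, Coalgebra.counit (R := k) (TensorProduct.rid k C (ψ.lTensor C t)) =
      ψ (slice (Coalgebra.counit (R := k)) t) := by
    intro t
    induction t with
    | zero => simp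
    | add x y hx hy => simp only [map_add, hx, hy]
    | tmul a b => simp [mul_comm]
  exact h _

/-- The orbit of `x` under all slices is a subcomodule by `slice_slice`, contains `x` because the
counit is one of the forms, and is finite-dimensional because `ρ x` is a finite sum of pure tensors.
-/
theorem exists_finite_stable (hρ : IsLeftComodule ρ) {N : Submodule k M} (hN : IsStable ρ N) {x : M} (hx : x ∈ N) :
    ∃ N' ≤ N, IsStable ρ N' ∧ Module.Finite k N' ∧ x ∈ N' := by
  let T : (C →ₗ[k] k) →ₗ[k] M :=
    { toFun := fun f => slice f (ρ x)
      map_add' := fun f g => by simp [slice, LinearMap.rTensor_add]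
      map_smul' := fun r f => by simp [slice, LinearMap.rTensor_smul] }
  obtain ⟨P, hP, hP'⟩ := exists_finite_slice_mem (ρ x)
  refine ⟨LinearMap.range T, ?_, ?_, ?_, ⟨Coalgebra.counit, hρ.counit x⟩⟩
  · rintro _ ⟨f, rfl⟩
    exact hN f x hx
  · rintro f _ ⟨f', rfl⟩
    exact ⟨_, (hρ.slice_slice f f' x).symm⟩
  · have : LinearMap.range T ≤ P := by
      rintro _ ⟨f, rfl⟩
      exact hP' f
    exact Module.Finite.of_injective (Submodule.inclusion this) (Submodule.inclusion_injective this)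

theorem exists_minimal_stable (hρ : IsLeftComodule ρ) {N : Submodule k M} (hN : IsStable ρ N) (h0 : N ≠ ⊥) :
    ∃ N' ≤ N, IsStable ρ N' ∧ Module.Finite k N' ∧ N' ≠ ⊥ ∧
      ∀ P ≤ N', IsStable ρ P → P ≠ ⊥ → P = N' := by
  let S : Set (Submodule k M) := {P | P ≤ N ∧ IsStable ρ P ∧ Module.Finite k P ∧ P ≠ ⊥}
  have hS : S.Nonempty := by
    obtain ⟨x, hx, hx0⟩ := N.exists_mem_ne_zero_of_ne_bot h0
    obtain ⟨N', h1, h2, h3, h4⟩ := hρ.exists_finite_stable hN hx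
    exact ⟨N', h1, h2, h3, fun h => hx0 (by simpa [h] using h4)⟩
  obtain ⟨N', ⟨h1, h2, h3, h4⟩, hmin⟩ :=
    (measure fun P : Submodule k M => Module.finrank k P).wf.has_min S hS
  refine ⟨N', h1, h2, h3, h4, fun P hP hP1 hP2 => ?_⟩
  have hfin : Module.Finite k P := Module.Finite.of_injective (Submodule.inclusion hP)
    (Submodule.inclusion_injective hP)
  exact Submodule.eq_of_le_of_finrank_le hP (not_lt.1 (hmin P ⟨hP.trans h1, hP1, hfin, hP2⟩))

/-- Taking matrix coefficients is a comodule map from `N^r` to `C`, so expressing `g` through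
coefficients lifts `g` to a tuple on which the coaction is `g ⊗ -` modulo the kernel. Minimality of
`N` makes it possible to shorten the tuple until one coordinate is an honest eigenvector. -/
theorem exists_eq_tmul_of_sum_coeff (hρ : IsLeftComodule ρ) {N : Submodule k M} (hN : IsStable ρ N)
    (hmin : ∀ P ≤ N, IsStable ρ P → P ≠ ⊥ → P = N) {g : C} (hg : IsGroupLikeElem k g) :
    ∀ (r : ℕ) (ψ : Fin r → (M →ₗ[k] k)) (x : Fin r → M), (∀ i, x i ∈ N) →
      ∑ i, coeff ρ (ψ i) (x i) = g → ∃ y ∈ N, y ≠ 0 ∧ ρ y = g ⊗ₜ y := by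
  intro r
  induction r with
  | zero =>
    intro ψ x _ h
    have := hg.ne_zero
    simp at h
    exact absurd h.symm this
  | succ r ih =>
    intro ψ x hx hsum
    let A : (Fin (r + 1) → M) →ₗ[k] C := ∑ i, coeff ρ (ψ i) ∘ₗ LinearMap.proj i
    have hA : ∀ y, A y = ∑ i, coeff ρ (ψ i) (y i) := fun y => by simp [A]
    let K : Submodule k (Fin (r + 1) → M) := Submodule.pi Set.univ (fun _ => N) ⊓ LinearMap.ker A
    have hK : ∀ y, y ∈ K ↔ (∀ i, y i ∈ N) ∧ A y = 0 := fun y => by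
      simp [K, Submodule.mem_pi]
    have hAact : ∀ f : C →ₗ[k] k, ∀ y : Fin (r + 1) → M,
        A (fun i => slice f (ρ (y i))) = slice f (Coalgebra.comul (R := k) (A y)) := fun f y => by
      simp only [hA, map_sum, hρ.slice_comul_coeff]
    let P : Submodule k M := K.map (LinearMap.proj (Fin.last r))
    have hP : P ≤ N := by
      rintro _ ⟨y, hy, rfl⟩
      exact ((hK y).1 hy).1 _
    have hPst : IsStable ρ P := by
      rintro f _ ⟨y, hy, rfl⟩
      refine ⟨fun i => slice f (ρ (y i)), (hK _).2 ⟨fun i => hN f _ (((hK y).1 hy).1 i), ?_⟩, rfl⟩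
      rw [hAact, ((hK y).1 hy).2]
      simp
    -- `P` is the projection of the kernel `K` to the last coordinate, a subcomodule of the minimal
    -- `N`. If it is zero, the last coordinate of `x` is zero or is the desired eigenvector; if it
    -- is all of `N`, an element of `K` can be subtracted to make the last coordinate zero.
    by_cases hP0 : P = ⊥
    · by_cases hx0 : x (Fin.last r) = 0
      · refine ih (fun i => ψ i.castSucc) (fun i => x i.castSucc) (fun i => hx _) ?_
        rw [← hsum, Fin.sum_univ_castSucc, hx0]
        simp
      · refine ⟨_, hx (Fin.last r), hx0, eq_of_slice fun f => ?_⟩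
        have : slice f (ρ (x (Fin.last r))) - f g • x (Fin.last r) ∈ P := by
          refine ⟨fun i => slice f (ρ (x i)) - f g • x i, (hK _).2 ⟨fun i =>
            N.sub_mem (hN f _ (hx i)) (N.smul_mem _ (hx i)), ?_⟩, rfl⟩
          have h1 : (fun i => slice f (ρ (x i)) - f g • x i) =
              (fun i => slice f (ρ (x i))) - f g • x := rfl
          rw [h1, map_sub, map_smul, hAact, hA, hsum, hg.comul_eq_tmul_self]
          simp
        rw [hP0, Submodule.mem_bot, sub_eq_zero] at this
        simpa using this
    · have hPN := hmin P hP hPst hP0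
      have hxl : x (Fin.last r) ∈ P := hPN ▸ hx _
      obtain ⟨y, hy, hyx⟩ := hxl
      refine ih (fun i => ψ i.castSucc) (fun i => x i.castSucc - y i.castSucc)
        (fun i => N.sub_mem (hx _) (((hK y).1 hy).1 _)) ?_
      have h1 : A (x - y) = g := by
        rw [map_sub, ((hK y).1 hy).2, hA, hsum, sub_zero]
      rw [hA, Fin.sum_univ_castSucc] at h1
      have h2 : (x - y) (Fin.last r) = 0 := by
        simpa [sub_eq_zero] using hyx.symm
      rw [h2] at h1
      simpa using h1

end IsLeftComodule

theorem IsSubcoalgebra.exists_simple {D : Submodule k C} (hD : IsSubcoalgebra k D) (h0 : D ≠ ⊥)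
    [Module.Finite k D] : ∃ E ≤ D, IsSimpleSubcoalgebra k E := by
  let S : Set (Submodule k C) := {P | P ≤ D ∧ IsSubcoalgebra k P ∧ P ≠ ⊥}
  obtain ⟨E, ⟨h1, h2, h3⟩, hmin⟩ :=
    (measure fun P : Submodule k C => Module.finrank k P).wf.has_min S ⟨D, le_rfl, hD, h0⟩
  refine ⟨E, h1, h2, h3, fun P hP hPE => ?_⟩
  by_cases hP0 : P = ⊥
  · exact Or.inl hP0
  · have hfin : Module.Finite k E := Module.Finite.of_injective (Submodule.inclusion h1)
      (Submodule.inclusion_injective h1)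
    exact Or.inr (Submodule.eq_of_le_of_finrank_le hPE
      (not_lt.1 (hmin P ⟨hPE.trans h1, hP, hP0⟩)))

/-- Grouplike elements are linearly independent, so some form `f` is `1` on one grouplike `g₀`
occurring in `e` and `0` on the others. Slicing `Δ e = ∑ a_g g ⊗ g` with `f` leaves `a_{g₀} g₀`,
which must lie in `E`. -/
theorem IsSubcoalgebra.exists_isGroupLikeElem {E : Submodule k C} (hE : IsSubcoalgebra k E)
    (h0 : E ≠ ⊥) (hle : E ≤ Submodule.span k {g : C | IsGroupLikeElem k g}) :
    ∃ g ∈ E, IsGroupLikeElem k g := by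
  obtain ⟨e, he, he0⟩ := E.exists_mem_ne_zero_of_ne_bot h0
  have hli : LinearIndependent k (fun g : {g : C | IsGroupLikeElem k g} => (g : C)) :=
    linearIndepOn_isGroupLikeElem
  have hspan := hle he
  rw [← Subtype.range_coe (s := {g : C | IsGroupLikeElem k g})] at hspan
  obtain ⟨a, ha⟩ := (Finsupp.mem_span_range_iff_exists_finsupp).1 hspan
  obtain ⟨g₀, hg₀⟩ : ∃ g₀, a g₀ ≠ 0 := by
    by_contra h
    push Not at h
    apply he0
    rw [← ha, Finsupp.sum]
    exact Finset.sum_eq_zero fun g _ => by simp [h g]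
  obtain ⟨f, hf⟩ := LinearMap.exists_extend
    ((Finsupp.lapply g₀ : _ →ₗ[k] k) ∘ₗ hli.repr)
  have hf' : ∀ g : {g : C | IsGroupLikeElem k g}, f g = Finsupp.single g (1 : k) g₀ := by
    intro g
    have := LinearMap.congr_fun hf ⟨g, Submodule.subset_span ⟨g, rfl⟩⟩
    simpa [hli.repr_eq_single g ⟨g, Submodule.subset_span ⟨g, rfl⟩⟩ rfl] using this
  have h1 : slice f (Coalgebra.comul (R := k) e) = a g₀ • (g₀ : C) := by
    rw [← ha, Finsupp.sum, map_sum, map_sum, Finset.sum_eq_single g₀]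
    · rw [map_smul, map_smul, g₀.2.comul_eq_tmul_self, slice_tmul, hf']
      simp
    · intro g _ hg
      rw [map_smul, map_smul, g.2.comul_eq_tmul_self, slice_tmul, hf']
      simp [hg]
    · intro h
      exact absurd (Finsupp.notMem_support_iff.1 h) hg₀
  have h2 := slice_mem_of_mem_range_mapIncl (hE e he) f
  rw [h1] at h2
  exact ⟨g₀, by simpa [smul_smul, inv_mul_cancel₀ hg₀] using E.smul_mem (a g₀)⁻¹ h2, g₀.2⟩

/-- A nonzero subcomodule of a left comodule over a pointed coalgebra contains a one-dimensional
subcomodule. -/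
theorem IsLeftComodule.exists_eq_tmul {ρ : M →ₗ[k] C ⊗[k] M} (hρ : IsLeftComodule ρ)
    (hC : IsPointed k C) {N : Submodule k M} (hN : IsStable ρ N) (h0 : N ≠ ⊥) :
    ∃ g : C, IsGroupLikeElem k g ∧ ∃ y ∈ N, y ≠ 0 ∧ ρ y = g ⊗ₜ y := by
  obtain ⟨N', hle, hst, hfin, hne, hmin⟩ := hρ.exists_minimal_stable hN h0
  -- The coefficients of `N'` span a finite-dimensional subcoalgebra; a simple subcoalgebra inside
  -- it lies in the coradical, where pointedness supplies a grouplike element.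
  let S : Set C := {c | ∃ ψ : M →ₗ[k] k, ∃ x ∈ N', coeff ρ ψ x = c}
  have hDsub : IsSubcoalgebra k (Submodule.span k S) := by
    intro c hc
    refine mem_range_mapIncl (fun f => ?_) (fun f => ?_)
    · induction hc using Submodule.span_induction with
      | mem c hc =>
        obtain ⟨ψ, x, hx, rfl⟩ := hc
        exact Submodule.subset_span ⟨ψ, _, hst f x hx, (hρ.slice_comul_coeff f ψ x).symm⟩
      | zero => simp
      | add x y _ _ hx hy => simpa only [map_add] using Submodule.add_mem _ hx hy
      | smul r x _ hx => simpa only [map_smul] using Submodule.smul_mem _ r hx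
    · induction hc using Submodule.span_induction with
      | mem c hc =>
        obtain ⟨ψ, x, hx, rfl⟩ := hc
        exact Submodule.subset_span ⟨_, x, hx, (hρ.slice_comm_comul_coeff f ψ x).symm⟩
      | zero => simp
      | add x y _ _ hx hy => simpa only [map_add] using Submodule.add_mem _ hx hy
      | smul r x _ hx => simpa only [map_smul] using Submodule.smul_mem _ r hx
  obtain ⟨x, hx, hx0⟩ := N'.exists_mem_ne_zero_of_ne_bot hne
  obtain ⟨E, hED, hE⟩ : ∃ E ≤ Submodule.span k S, IsSimpleSubcoalgebra k E := by
    obtain ⟨P, hP, hPmem⟩ := exists_finite_coeff_mem ρ N'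
    have hle : Submodule.span k S ≤ P := by
      rw [Submodule.span_le]
      rintro _ ⟨ψ, x, hx, rfl⟩
      exact hPmem ψ x hx
    have : Module.Finite k (Submodule.span k S) :=
      Module.Finite.of_injective (Submodule.inclusion hle) (Submodule.inclusion_injective hle)
    -- The coefficient space is nonzero because the counit recovers `ψ x` from the coefficient.
    refine hDsub.exists_simple fun h => ?_
    obtain ⟨ψ, hψ⟩ := Module.Projective.exists_dual_ne_zero k hx0
    have h1 : coeff ρ ψ x ∈ Submodule.span k S := Submodule.subset_span ⟨ψ, x, hx, rfl⟩
    rw [h, Submodule.mem_bot] at h1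
    exact hψ (by rw [← hρ.counit_coeff, h1, map_zero])
  have hE' : E ≤ Submodule.span k {g : C | IsGroupLikeElem k g} := by
    rw [← hC]
    exact le_sSup hE
  obtain ⟨g, hgE, hg⟩ := hE.1.exists_isGroupLikeElem hE.2.1 hE'
  -- Being in the coefficient space, `g` is a finite combination of coefficients; the scalars are
  -- absorbed into the vectors.
  obtain ⟨r, a, s, hs⟩ := Submodule.mem_span_set'.1 (hED hgE)
  choose ψ z hz hψ using fun i => (s i).2
  obtain ⟨y, hy, hy0, hyg⟩ := hρ.exists_eq_tmul_of_sum_coeff hst hmin hg r ψ (fun i => a i • z i)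
    (fun i => N'.smul_mem _ (hz i)) (by simp [hψ, hs])
  exact ⟨g, hg, y, hle hy, hy0, hyg⟩

end Slices

/-! ### The opposite coalgebra -/

section Cop

/-- The space underlying the opposite coalgebra. -/
def Cop (C : Type*) : Type _ := C

variable {k : Type*} {C : Type*} [Field k] [AddCommGroup C] [Module k C]

instance : AddCommGroup (Cop C) := inferInstanceAs (AddCommGroup C)

instance : Module k (Cop C) := inferInstanceAs (Module k C)

variable (k C) in
/-- The identity map from a coalgebra to its opposite. -/
def copEquiv : C ≃ₗ[k] Cop C := LinearEquiv.refl k C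

variable [Coalgebra k C]

instance : CoalgebraStruct k (Cop C) where
  comul := (TensorProduct.map (copEquiv k C).toLinearMap (copEquiv k C).toLinearMap) ∘ₗ
    (TensorProduct.comm k C C).toLinearMap ∘ₗ Coalgebra.comul ∘ₗ (copEquiv k C).symm.toLinearMap
  counit := Coalgebra.counit ∘ₗ (copEquiv k C).symm.toLinearMap

theorem comul_copEquiv (c : C) : Coalgebra.comul (R := k) (copEquiv k C c) =
    TensorProduct.map (copEquiv k C).toLinearMap (copEquiv k C).toLinearMap
      (TensorProduct.comm k C C (Coalgebra.comul (R := k) c)) := rfl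

theorem counit_copEquiv (c : C) : Coalgebra.counit (R := k) (copEquiv k C c) =
    Coalgebra.counit (R := k) c := rfl

/-- `x ⊗ y ⊗ z ↦ z ⊗ y ⊗ x`, with values in the opposite coalgebra. -/
def revThree : C ⊗[k] (C ⊗[k] C) →ₗ[k] Cop C ⊗[k] (Cop C ⊗[k] Cop C) :=
  TensorProduct.map (copEquiv k C).toLinearMap
      (TensorProduct.map (copEquiv k C).toLinearMap (copEquiv k C).toLinearMap) ∘ₗ
    (TensorProduct.assoc k C C C).toLinearMap ∘ₗ (TensorProduct.comm k _ _).toLinearMap ∘ₗ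
      (TensorProduct.comm k C C).toLinearMap.lTensor C

instance : Coalgebra k (Cop C) where
  coassoc := by
    ext c
    obtain ⟨c, rfl⟩ := (copEquiv k C).surjective c
    change TensorProduct.assoc k _ _ _ ((Coalgebra.comul (R := k) (A := Cop C)).rTensor _
      (Coalgebra.comul (R := k) (copEquiv k C c))) = _
    have h1 : ∀ t : C ⊗[k] C, TensorProduct.assoc k _ _ _
        ((Coalgebra.comul (R := k) (A := Cop C)).rTensor _
        (TensorProduct.map (copEquiv k C).toLinearMap (copEquiv k C).toLinearMap
          (TensorProduct.comm k C C t))) =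
        revThree ((Coalgebra.comul (R := k)).lTensor C t) := by
      intro t
      induction t with
      | zero => simp
      | add x y hx hy => simp only [map_add, hx, hy]
      | tmul a b =>
        simp only [TensorProduct.comm_tmul, TensorProduct.map_tmul, LinearMap.rTensor_tmul,
          LinearMap.lTensor_tmul, LinearEquiv.coe_coe, comul_copEquiv]
        generalize Coalgebra.comul (R := k) b = s
        induction s with
        | zero => simp
        | add x y hx hy => simp only [map_add, TensorProduct.add_tmul, TensorProduct.tmul_add,
            hx, hy]
        | tmul p q => simp [revThree]
    have h2 : ∀ t : C ⊗[k] C, (Coalgebra.comul (R := k) (A := Cop C)).lTensor _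
        (TensorProduct.map (copEquiv k C).toLinearMap (copEquiv k C).toLinearMap
          (TensorProduct.comm k C C t)) =
        revThree (TensorProduct.assoc k C C C ((Coalgebra.comul (R := k)).rTensor C t)) := by
      intro t
      induction t with
      | zero => simp
      | add x y hx hy => simp only [map_add, hx, hy]
      | tmul a b =>
        simp only [TensorProduct.comm_tmul, TensorProduct.map_tmul, LinearMap.rTensor_tmul,
          LinearMap.lTensor_tmul, LinearEquiv.coe_coe, comul_copEquiv]
        generalize Coalgebra.comul (R := k) a = s
        induction s with
        | zero => simp
        | add x y hx hy => simp only [map_add, TensorProduct.add_tmul, TensorProduct.tmul_add,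
            hx, hy]
        | tmul p q => simp [revThree]
    rw [LinearMap.comp_apply, comul_copEquiv, h1, h2, Coalgebra.coassoc_apply]
  rTensor_counit_comp_comul := by
    ext c
    obtain ⟨c, rfl⟩ := (copEquiv k C).surjective c
    change (Coalgebra.counit (R := k) (A := Cop C)).rTensor _
      (Coalgebra.comul (R := k) (copEquiv k C c)) = 1 ⊗ₜ (copEquiv k C c)
    have h : ∀ t : C ⊗[k] C, (Coalgebra.counit (R := k) (A := Cop C)).rTensor _
        (TensorProduct.map (copEquiv k C).toLinearMap (copEquiv k C).toLinearMap
          (TensorProduct.comm k C C t)) =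
        (copEquiv k C).toLinearMap.lTensor k
          (TensorProduct.comm k _ _ ((Coalgebra.counit (R := k)).lTensor C t)) := by
      intro t
      induction t with
      | zero => simp
      | add x y hx hy => simp only [map_add, hx, hy]
      | tmul a b => simp [counit_copEquiv]
    rw [comul_copEquiv, h, Coalgebra.lTensor_counit_comul]
    simp
  lTensor_counit_comp_comul := by
    ext c
    obtain ⟨c, rfl⟩ := (copEquiv k C).surjective c
    change (Coalgebra.counit (R := k) (A := Cop C)).lTensor _
      (Coalgebra.comul (R := k) (copEquiv k C c)) = (copEquiv k C c) ⊗ₜ 1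
    have h : ∀ t : C ⊗[k] C, (Coalgebra.counit (R := k) (A := Cop C)).lTensor _
        (TensorProduct.map (copEquiv k C).toLinearMap (copEquiv k C).toLinearMap
          (TensorProduct.comm k C C t)) =
        (copEquiv k C).toLinearMap.rTensor k
          (TensorProduct.comm k _ _ ((Coalgebra.counit (R := k)).rTensor C t)) := by
      intro t
      induction t with
      | zero => simp
      | add x y hx hy => simp only [map_add, hx, hy]
      | tmul a b => simp [counit_copEquiv]
    rw [comul_copEquiv, h, Coalgebra.rTensor_counit_comul]
    simp

theorem isGroupLikeElem_copEquiv {g : C} :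
    IsGroupLikeElem k (copEquiv k C g) ↔ IsGroupLikeElem k g := by
  constructor
  · rintro ⟨h1, h2⟩
    refine ⟨h1, ?_⟩
    rw [comul_copEquiv] at h2
    have h3 := congrArg (TensorProduct.comm k C C) h2
    have h4 := (TensorProduct.comm k C C).symm_apply_apply (Coalgebra.comul (R := k) g)
    have h5 : TensorProduct.map (copEquiv k C).toLinearMap (copEquiv k C).toLinearMap =
        LinearMap.id := TensorProduct.map_id
    rw [← h4]
    have h6 : TensorProduct.comm k C C (Coalgebra.comul (R := k) g) = g ⊗ₜ g :=
      (LinearMap.congr_fun h5 _).symm.trans h2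
    rw [h6]
    simp
  · rintro ⟨h1, h2⟩
    refine ⟨h1, ?_⟩
    rw [comul_copEquiv, h2]
    simp

theorem slice_comul_copEquiv (f : Cop C →ₗ[k] k) (c : C) :
    slice f (Coalgebra.comul (R := k) (copEquiv k C c)) = copEquiv k C
      (slice (f ∘ₗ (copEquiv k C).toLinearMap)
        (TensorProduct.comm k C C (Coalgebra.comul (R := k) c))) := by
  rw [comul_copEquiv]
  generalize TensorProduct.comm k C C (Coalgebra.comul (R := k) c) = t
  induction t with
  | zero => simp
  | add x y hx hy => simp only [map_add, hx, hy]
  | tmul a b => simp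

theorem slice_comm_comul_copEquiv (f : Cop C →ₗ[k] k) (c : C) :
    slice f (TensorProduct.comm k _ _ (Coalgebra.comul (R := k) (copEquiv k C c))) = copEquiv k C
      (slice (f ∘ₗ (copEquiv k C).toLinearMap) (Coalgebra.comul (R := k) c)) := by
  rw [comul_copEquiv]
  generalize Coalgebra.comul (R := k) c = t
  induction t with
  | zero => simp
  | add x y hx hy => simp only [map_add, hx, hy]
  | tmul a b => simp

theorem isSubcoalgebra_cop_iff {D : Submodule k C} :
    IsSubcoalgebra k (D.map (copEquiv k C).toLinearMap) ↔ IsSubcoalgebra k D := by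
  have hmem : ∀ c : C, copEquiv k C c ∈ D.map (copEquiv k C).toLinearMap ↔ c ∈ D := fun c =>
    ⟨fun ⟨c', h, h'⟩ => (copEquiv k C).injective h' ▸ h, fun h => ⟨c, h, rfl⟩⟩
  rw [isSubcoalgebra_iff_slice, isSubcoalgebra_iff_slice]
  constructor
  · intro h c hc f
    have := h _ ((hmem c).2 hc) (f ∘ₗ (copEquiv k C).symm.toLinearMap)
    rw [slice_comul_copEquiv, slice_comm_comul_copEquiv, hmem, hmem] at this
    exact this.symm
  · rintro h _ ⟨c, hc, rfl⟩ f
    have := h c hc (f ∘ₗ (copEquiv k C).toLinearMap)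
    rw [LinearEquiv.coe_coe, slice_comul_copEquiv, slice_comm_comul_copEquiv, hmem, hmem]
    exact this.symm

theorem isSimpleSubcoalgebra_cop_iff {D : Submodule k C} :
    IsSimpleSubcoalgebra k (D.map (copEquiv k C).toLinearMap) ↔ IsSimpleSubcoalgebra k D := by
  let e := Submodule.orderIsoMapComap (copEquiv k C)
  have he : ∀ E, D.map (copEquiv k C).toLinearMap = e D ∧
    E.map (copEquiv k C).toLinearMap = e E := fun E => ⟨rfl, rfl⟩
  have he' : ∀ E, IsSubcoalgebra k (e E) ↔ IsSubcoalgebra k E := fun E => isSubcoalgebra_cop_iff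
  rw [(he D).1]
  refine and_congr (he' D) (and_congr (map_eq_bot_iff e).not ?_)
  rw [e.surjective.forall]
  refine forall_congr' fun E => ?_
  rw [he', e.le_iff_le, map_eq_bot_iff, e.injective.eq_iff]

/-- Subcoalgebras and grouplike elements are insensitive to swapping the two factors of `Δ`. -/
theorem IsPointed.cop (h : IsPointed k C) : IsPointed k (Cop C) := by
  let e := Submodule.orderIsoMapComap (copEquiv k C)
  have h1 : {D : Submodule k (Cop C) | IsSimpleSubcoalgebra k D} =
      e '' {D : Submodule k C | IsSimpleSubcoalgebra k D} := by
    ext D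
    obtain ⟨D, rfl⟩ := e.surjective D
    rw [e.injective.mem_set_image]
    exact isSimpleSubcoalgebra_cop_iff
  have h2 : {g : Cop C | IsGroupLikeElem k g} =
      (copEquiv k C).toLinearMap '' {g : C | IsGroupLikeElem k g} := by
    ext g
    obtain ⟨g, rfl⟩ := (copEquiv k C).surjective g
    exact (isGroupLikeElem_copEquiv (g := g)).trans
      ((copEquiv k C).injective.mem_set_image (s := {g : C | IsGroupLikeElem k g})).symm
  unfold IsPointed coradical at h ⊢
  rw [h1, h2, Submodule.span_image, ← h, sSup_image]
  exact (e.map_sSup _).symm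

end Cop

/-! ### Quotient comodules and one-dimensional subbicomodules -/

section Bicomodule

variable {k : Type*} {C M : Type*} [Field k] [AddCommGroup C] [Module k C]
  [AddCommGroup M] [Module k M]

theorem IsStable.lTensor_mkQ_eq_zero {ρ : M →ₗ[k] C ⊗[k] M} {E : Submodule k M}
    (hE : IsStable ρ E) {x : M} (hx : x ∈ E) : E.mkQ.lTensor C (ρ x) = 0 :=
  eq_zero_of_slice fun f => by
    rw [slice_lTensor, Submodule.mkQ_apply, Submodule.Quotient.mk_eq_zero]
    exact hE f x hx

variable [Coalgebra k C]

theorem IsLeftComodule.exists_quotient {ρ : M →ₗ[k] C ⊗[k] M} (hρ : IsLeftComodule ρ)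
    {E : Submodule k M} (hE : IsStable ρ E) :
    ∃ ρ' : (M ⧸ E) →ₗ[k] C ⊗[k] (M ⧸ E), IsLeftComodule ρ' ∧
      ∀ x, ρ' (E.mkQ x) = E.mkQ.lTensor C (ρ x) := by
  let ρ' : (M ⧸ E) →ₗ[k] C ⊗[k] (M ⧸ E) :=
    E.liftQ (E.mkQ.lTensor C ∘ₗ ρ) fun x hx => hE.lTensor_mkQ_eq_zero hx
  have h : ∀ x, ρ' (E.mkQ x) = E.mkQ.lTensor C (ρ x) := fun x => rfl
  refine ⟨ρ', ⟨fun x => ?_, fun x => ?_⟩, h⟩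
  · obtain ⟨x, rfl⟩ := E.mkQ_surjective x
    have h1 : ρ' ∘ₗ E.mkQ = E.mkQ.lTensor C ∘ₗ ρ := LinearMap.ext h
    rw [h, ← LinearMap.comp_apply (ρ'.lTensor C), ← LinearMap.lTensor_comp, h1,
      LinearMap.lTensor_comp, LinearMap.comp_apply, ← hρ.coassoc]
    generalize ρ x = t
    induction t with
    | zero => simp
    | add x y hx hy => simp only [map_add, hx, hy]
    | tmul a b =>
      simp only [LinearMap.lTensor_tmul, LinearMap.rTensor_tmul]
      generalize Coalgebra.comul (R := k) a = s
      induction s with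
      | zero => simp
      | add x y hx hy => simp only [map_add, TensorProduct.add_tmul, hx, hy]
      | tmul p q => simp
  · obtain ⟨x, rfl⟩ := E.mkQ_surjective x
    rw [h, slice_lTensor, hρ.counit]

/-- A nonzero bicomodule over a pointed coalgebra contains a one-dimensional subbicomodule. -/
theorem exists_eq_tmul_of_bicomodule {ρ : M →ₗ[k] C ⊗[k] M} {ρ' : M →ₗ[k] Cop C ⊗[k] M}
    (hρ : IsLeftComodule ρ) (hρ' : IsLeftComodule ρ')
    (hcomm : ∀ (f : C →ₗ[k] k) (f' : Cop C →ₗ[k] k) (x : M),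
      slice f (ρ (slice f' (ρ' x))) = slice f' (ρ' (slice f (ρ x))))
    (hC : IsPointed k C) [Nontrivial M] :
    ∃ g h : C, IsGroupLikeElem k g ∧ IsGroupLikeElem k h ∧
      ∃ y : M, y ≠ 0 ∧ ρ y = g ⊗ₜ y ∧ ρ' y = copEquiv k C h ⊗ₜ y := by
  obtain ⟨g, hg, y, -, hy0, hy⟩ := hρ.exists_eq_tmul hC (N := ⊤)
    (fun _ _ _ => Submodule.mem_top) top_ne_bot
  -- The eigenspace of `g` for the left coaction is stable under the right coaction because the two
  -- commute. The one-sided result for the opposite coalgebra then finds a vector in it that is an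
  -- eigenvector on both sides.
  let N : Submodule k M := LinearMap.ker (ρ - TensorProduct.mk k C M g)
  have hN : ∀ x, x ∈ N ↔ ρ x = g ⊗ₜ x := fun x => by simp [N, sub_eq_zero]
  have hst : IsStable ρ' N := by
    intro f' x hx
    rw [hN] at hx ⊢
    refine eq_of_slice fun f => ?_
    rw [hcomm, hx, slice_tmul, map_smul, map_smul, slice_tmul]
  obtain ⟨h, hh, z, hz, hz0, hzh⟩ := hρ'.exists_eq_tmul hC.cop hst
    (fun h0 => hy0 (by simpa [h0] using (hN y).2 hy))
  obtain ⟨h, rfl⟩ := (copEquiv k C).surjective h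
  exact ⟨g, h, hg, isGroupLikeElem_copEquiv.1 hh, z, hz0, (hN z).1 hz, hzh⟩

end Bicomodule

/-! ### Tensor powers as bicomodules -/

section Coactions

variable {k : Type*} {C : Type*} [Field k] [AddCommGroup C] [Module k C]

/-- `f ⊗ Id^{⊗ m}`. -/
def sliceFirst (f : C →ₗ[k] k) (m : ℕ) : ⨂[k]^(m + 1) C →ₗ[k] ⨂[k]^m C :=
  slice f ∘ₗ (consEquiv k C m).symm.toLinearMap

/-- `Id^{⊗ m} ⊗ f`. -/
def sliceLast (f : C →ₗ[k] k) (m : ℕ) : ⨂[k]^(m + 1) C →ₗ[k] ⨂[k]^m C :=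
  slice f ∘ₗ (TensorProduct.comm k _ _).toLinearMap ∘ₗ (snocEquiv k C m).symm.toLinearMap

@[simp]
theorem sliceFirst_cons (f : C →ₗ[k] k) (m : ℕ) (c : C) (w : ⨂[k]^m C) :
    sliceFirst f m (consEquiv k C m (c ⊗ₜ w)) = f c • w := by
  simp [sliceFirst]

@[simp]
theorem sliceLast_snoc (f : C →ₗ[k] k) (m : ℕ) (c : C) (w : ⨂[k]^m C) :
    sliceLast f m (snocEquiv k C m (w ⊗ₜ c)) = f c • w := by
  simp [sliceLast]

theorem sliceFirst_lWh (f : C →ₗ[k] k) {m l : ℕ} (φ : ⨂[k]^m C →ₗ[k] ⨂[k]^l C) :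
    sliceFirst f l ∘ₗ lWh φ = φ ∘ₗ sliceFirst f m := ext_cons fun c w => by simp

theorem sliceLast_rWh (f : C →ₗ[k] k) {m l : ℕ} (φ : ⨂[k]^m C →ₗ[k] ⨂[k]^l C) :
    sliceLast f l ∘ₗ rWh φ = φ ∘ₗ sliceLast f m := ext_snoc fun c w => by simp

theorem rWh_sliceFirst (f : C →ₗ[k] k) (m : ℕ) :
    rWh (sliceFirst f m) = sliceFirst f (m + 1) := by
  refine ext_snoc fun w x => ?_
  obtain ⟨t, rfl⟩ := (consEquiv k C m).surjective w
  induction t with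
  | zero => simp
  | add x y hx hy => simp only [map_add, TensorProduct.add_tmul, hx, hy]
  | tmul c w =>
    rw [rWh_snoc, sliceFirst_cons, snoc_cons, sliceFirst_cons, ← TensorProduct.smul_tmul',
      map_smul]

theorem sliceLast_sliceFirst (f f' : C →ₗ[k] k) (m : ℕ) :
    sliceLast f' m ∘ₗ sliceFirst f (m + 1) = sliceFirst f m ∘ₗ sliceLast f' (m + 1) := by
  rw [← rWh_sliceFirst, sliceLast_rWh]

variable (k C) in
/-- Appending a tensor from `Cop C ⊗ C^{⊗ m}`. -/
def snocCop (m : ℕ) : Cop C ⊗[k] (⨂[k]^m C) ≃ₗ[k] ⨂[k]^(m + 1) C :=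
  (TensorProduct.congr (copEquiv k C).symm (LinearEquiv.refl k _)).trans
    ((TensorProduct.comm k _ _).trans (snocEquiv k C m))

@[simp]
theorem snocCop_tmul (m : ℕ) (c : C) (w : ⨂[k]^m C) :
    snocCop k C m (copEquiv k C c ⊗ₜ w) = snocEquiv k C m (w ⊗ₜ c) := by simp [snocCop]

variable [Coalgebra k C]

variable (k C) in
/-- The left coaction on `C^{⊗ (m+1)}`. -/
def coactL (m : ℕ) : ⨂[k]^(m + 1) C →ₗ[k] C ⊗[k] (⨂[k]^(m + 1) C) :=
  (consEquiv k C (m + 1)).symm.toLinearMap ∘ₗ comulFirst k C m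

variable (k C) in
/-- The right coaction on `C^{⊗ (m+1)}`, as a left coaction of the opposite coalgebra. -/
def coactR (m : ℕ) : ⨂[k]^(m + 1) C →ₗ[k] Cop C ⊗[k] (⨂[k]^(m + 1) C) :=
  (copEquiv k C).toLinearMap.rTensor _ ∘ₗ (TensorProduct.comm k _ _).toLinearMap ∘ₗ
    (snocEquiv k C (m + 1)).symm.toLinearMap ∘ₗ comulLast k C m

theorem cons_coactL (m : ℕ) (x : ⨂[k]^(m + 1) C) :
    consEquiv k C (m + 1) (coactL k C m x) = comulFirst k C m x := by simp [coactL]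

theorem snocCop_coactR (m : ℕ) (x : ⨂[k]^(m + 1) C) :
    snocCop k C (m + 1) (coactR k C m x) = comulLast k C m x := by
  apply (snocEquiv k C (m + 1)).symm.injective
  simp only [coactR, LinearMap.comp_apply, LinearEquiv.coe_coe]
  generalize (snocEquiv k C (m + 1)).symm (comulLast k C m x) = t
  induction t with
  | zero => simp
  | add x y hx hy => simp only [map_add, hx, hy]
  | tmul a b => simp

theorem slice_coactL (f : C →ₗ[k] k) (m : ℕ) (x : ⨂[k]^(m + 1) C) :
    slice f (coactL k C m x) = sliceFirst f (m + 1) (comulFirst k C m x) := rfl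

theorem slice_coactR (f : Cop C →ₗ[k] k) (m : ℕ) (x : ⨂[k]^(m + 1) C) :
    slice f (coactR k C m x) =
      sliceLast (f ∘ₗ (copEquiv k C).toLinearMap) (m + 1) (comulLast k C m x) := by
  simp only [coactR, sliceLast, LinearMap.comp_apply, LinearEquiv.coe_coe]
  generalize (snocEquiv k C (m + 1)).symm (comulLast k C m x) = t
  induction t with
  | zero => simp
  | add x y hx hy => simp only [map_add, hx, hy]
  | tmul a b => simp

theorem lWh_comulFirst_apply {m l : ℕ} (F : ⨂[k]^(m + 1) C →ₗ[k] ⨂[k]^l C) (x) :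
    lWh F (comulFirst k C m x) = consEquiv k C l (F.lTensor C (coactL k C m x)) := by
  simp [lWh, coactL]

theorem rWh_comulLast_apply {m l : ℕ} (F : ⨂[k]^(m + 1) C →ₗ[k] ⨂[k]^l C) (x) :
    rWh F (comulLast k C m x) = snocCop k C l (F.lTensor (Cop C) (coactR k C m x)) := by
  rw [← snocCop_coactR]
  generalize coactR k C m x = t
  induction t with
  | zero => simp
  | add x y hx hy => simp only [map_add, hx, hy]
  | tmul a b =>
    obtain ⟨a, rfl⟩ := (copEquiv k C).surjective a
    simp

variable (k C) in
theorem isLeftComodule_coactL (m : ℕ) : IsLeftComodule (coactL k C m) where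
  coassoc x := by
    have hinj : Function.Injective ((consEquiv k C (m + 2)).toLinearMap ∘ₗ
        (consEquiv k C (m + 1)).toLinearMap.lTensor C) := by
      rw [LinearMap.coe_comp]
      refine (consEquiv k C (m + 2)).injective.comp ?_
      exact (LinearEquiv.lTensor C (consEquiv k C (m + 1))).injective
    apply hinj
    have h1 := LinearMap.congr_fun (comulFirst_comulFirst k C m) x
    simp only [LinearMap.comp_apply] at h1
    have h2 : comulFirst k C (m + 1) (comulFirst k C m x) =
        consTwo k C (m + 1) ((Coalgebra.comul (R := k)).rTensor _ (coactL k C m x)) := by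
      rw [← cons_coactL m x]
      generalize coactL k C m x = t
      induction t with
      | zero => simp
      | add x y hx hy => simp only [map_add, hx, hy]
      | tmul a b => simp [comulFirst_cons]
    have h3 : lWh (comulFirst k C m) (comulFirst k C m x) = ((consEquiv k C (m + 2)).toLinearMap ∘ₗ
        (consEquiv k C (m + 1)).toLinearMap.lTensor C) ((coactL k C m).lTensor C
          (coactL k C m x)) := by
      rw [← cons_coactL m x]
      generalize coactL k C m x = t
      induction t with
      | zero => simp
      | add x y hx hy => simp only [map_add, hx, hy]
      | tmul a b => simp [cons_coactL]
    rw [← h3, ← h1, h2]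
    rfl
  counit x := by
    have h := LinearMap.congr_fun (counitFirst_comulFirst k C m) x
    exact h

variable (k C) in
theorem isLeftComodule_coactR (m : ℕ) : IsLeftComodule (coactR k C m) where
  coassoc x := by
    have hinj : Function.Injective ((snocCop k C (m + 2)).toLinearMap ∘ₗ
        (snocCop k C (m + 1)).toLinearMap.lTensor (Cop C)) := by
      rw [LinearMap.coe_comp]
      refine (snocCop k C (m + 2)).injective.comp ?_
      exact (LinearEquiv.lTensor (Cop C) (snocCop k C (m + 1))).injective
    apply hinj
    have h1 := LinearMap.congr_fun (comulLast_comulLast k C m) x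
    simp only [LinearMap.comp_apply] at h1
    have h2 : comulLast k C (m + 1) (comulLast k C m x) =
        ((snocCop k C (m + 2)).toLinearMap ∘ₗ
        (snocCop k C (m + 1)).toLinearMap.lTensor (Cop C)) (TensorProduct.assoc k _ _ _
          ((Coalgebra.comul (R := k)).rTensor _ (coactR k C m x))) := by
      rw [← snocCop_coactR m x]
      generalize coactR k C m x = t
      induction t with
      | zero => simp
      | add x y hx hy => simp only [map_add, hx, hy]
      | tmul a b =>
        obtain ⟨a, rfl⟩ := (copEquiv k C).surjective a
        rw [snocCop_tmul, comulLast_snoc, LinearMap.rTensor_tmul, comul_copEquiv]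
        generalize Coalgebra.comul (R := k) a = s
        induction s with
        | zero => simp
        | add x y hx hy =>
          simp only [map_add, TensorProduct.add_tmul, TensorProduct.tmul_add, hx, hy]
        | tmul p q => simp
    have h3 : rWh (comulLast k C m) (comulLast k C m x) = ((snocCop k C (m + 2)).toLinearMap ∘ₗ
        (snocCop k C (m + 1)).toLinearMap.lTensor (Cop C)) ((coactR k C m).lTensor (Cop C)
          (coactR k C m x)) := by
      rw [← snocCop_coactR m x]
      generalize coactR k C m x = t
      induction t with
      | zero => simp
      | add x y hx hy => simp only [map_add, hx, hy]
      | tmul a b =>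
        obtain ⟨a, rfl⟩ := (copEquiv k C).surjective a
        simp [snocCop_coactR]
    rw [← h3, ← h1, h2]
  counit x := by
    rw [slice_coactR]
    have h := LinearMap.congr_fun (counitLast_comulLast k C m) x
    rw [LinearMap.comp_apply, LinearMap.id_apply] at h
    refine Eq.trans ?_ h
    generalize comulLast k C m x = t
    refine LinearMap.congr_fun (ext_snoc (fun w c => ?_)) t
    rw [sliceLast_snoc, counitLast_snoc]
    rfl

/-- The bicomodule condition in terms of slices. It rests on the commutation of `comulFirst` with
`comulLast`, so it also covers `m = 0`, where both act on the same factor. -/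
theorem slice_coactL_slice_coactR (m : ℕ) (f : C →ₗ[k] k) (f' : Cop C →ₗ[k] k)
    (x : ⨂[k]^(m + 1) C) : slice f (coactL k C m (slice f' (coactR k C m x))) =
      slice f' (coactR k C m (slice f (coactL k C m x))) := by
  simp only [slice_coactL, slice_coactR]
  generalize f' ∘ₗ (copEquiv k C).toLinearMap = f'
  have h1 : comulFirst k C m ∘ₗ sliceLast f' (m + 1) =
      sliceLast f' (m + 2) ∘ₗ comulFirst k C (m + 1) := by
    rw [← rWh_comulFirst, sliceLast_rWh]
  have h2 : comulLast k C m ∘ₗ sliceFirst f (m + 1) =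
      sliceFirst f (m + 2) ∘ₗ comulLast k C (m + 1) := by
    rw [← lWh_comulLast, sliceFirst_lWh]
  have h1' := LinearMap.congr_fun h1 (comulLast k C m x)
  have h2' := LinearMap.congr_fun h2 (comulFirst k C m x)
  have h3 := LinearMap.congr_fun (comulFirst_comulLast k C m) x
  simp only [LinearMap.comp_apply] at h1' h2' h3
  rw [h1', h2', h3]
  exact (LinearMap.congr_fun (sliceLast_sliceFirst f f' (m + 1)) _).symm

end Coactions

/-! ### Bicolinear maps between tensor powers -/

section Hat

variable {k : Type*} {C : Type*} [Field k] [AddCommGroup C] [Module k C] [Coalgebra k C]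

/-- The bicolinear map `C^{⊗ (m+2)} → C^{⊗ (j+2)}` that corresponds to the linear map `s`. -/
def hat {m j : ℕ} (s : ⨂[k]^(m + 2) C →ₗ[k] ⨂[k]^j C) : ⨂[k]^(m + 2) C →ₗ[k] ⨂[k]^(j + 2) C :=
  lWh (rWh s) ∘ₗ comulFirst k C (m + 2) ∘ₗ comulLast k C (m + 1)

/-- The differential of the complex of linear maps from the bicomodule `C^{⊗ (m+1)}` to tensor
powers of `C`. -/
def hoch {m j : ℕ} (s : ⨂[k]^(m + 1) C →ₗ[k] ⨂[k]^j C) : ⨂[k]^(m + 1) C →ₗ[k] ⨂[k]^(j + 1) C :=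
  lWh s ∘ₗ comulFirst k C m - cobar k C j ∘ₗ s - (-1 : k) ^ j • (rWh s ∘ₗ comulLast k C m)

theorem hoch_add {m j : ℕ} (s t : ⨂[k]^(m + 1) C →ₗ[k] ⨂[k]^j C) :
    hoch (s + t) = hoch s + hoch t := by
  simp only [hoch, lWh_add, rWh_add, LinearMap.add_comp, LinearMap.comp_add, smul_add]
  abel

theorem hoch_neg {m j : ℕ} (s : ⨂[k]^(m + 1) C →ₗ[k] ⨂[k]^j C) : hoch (-s) = -hoch s := by
  have h : hoch (0 : ⨂[k]^(m + 1) C →ₗ[k] ⨂[k]^j C) = 0 := by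
    simp [hoch, lWh_zero, rWh_zero]
  exact eq_neg_of_add_eq_zero_left (by rw [← hoch_add, neg_add_cancel, h])

theorem hoch_sub {m j : ℕ} (s t : ⨂[k]^(m + 1) C →ₗ[k] ⨂[k]^j C) :
    hoch (s - t) = hoch s - hoch t := by
  rw [sub_eq_add_neg, hoch_add, hoch_neg, ← sub_eq_add_neg]

theorem hat_eq {m j : ℕ} (s : ⨂[k]^(m + 2) C →ₗ[k] ⨂[k]^j C) :
    hat s = rWh (lWh s) ∘ₗ comulLast k C (m + 2) ∘ₗ comulFirst k C (m + 1) := by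
  rw [hat, lWh_rWh, comulFirst_comulLast]

theorem hat_sub {m j : ℕ} (s t : ⨂[k]^(m + 2) C →ₗ[k] ⨂[k]^j C) :
    hat (s - t) = hat s - hat t := by
  simp only [hat, lWh_sub, rWh_sub, LinearMap.sub_comp]

theorem hat_smul {m j : ℕ} (r : k) (s : ⨂[k]^(m + 2) C →ₗ[k] ⨂[k]^j C) :
    hat (r • s) = r • hat s := by
  simp only [hat, lWh_smul, rWh_smul, LinearMap.smul_comp]

theorem hat_apply {m j : ℕ} (s : ⨂[k]^(m + 2) C →ₗ[k] ⨂[k]^j C) (x : ⨂[k]^(m + 2) C) :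
    hat s x = lWh (rWh s) (comulFirst k C (m + 2) (comulLast k C (m + 1) x)) := rfl

theorem hat_apply' {m j : ℕ} (s : ⨂[k]^(m + 2) C →ₗ[k] ⨂[k]^j C) (x : ⨂[k]^(m + 2) C) :
    hat s x = rWh (lWh s) (comulLast k C (m + 2) (comulFirst k C (m + 1) x)) := by
  rw [hat_eq]; rfl

/-- Left colinearity of `hat s`: its new first factor is split off by a comultiplication, so
coassociativity applies. Right colinearity is `comulLast_hat`. -/
theorem comulFirst_hat {m j : ℕ} (s : ⨂[k]^(m + 2) C →ₗ[k] ⨂[k]^j C) :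
    comulFirst k C (j + 1) ∘ₗ hat s = lWh (hat s) ∘ₗ comulFirst k C (m + 1) := by
  ext1
  ext a
  generalize hx : (PiTensorProduct.tprod k) a = x
  simp only [LinearMap.compMultilinearMap_apply, hx, LinearMap.comp_apply]
  have h1 := LinearMap.congr_fun (comulFirst_lWh (rWh s))
    (comulFirst k C (m + 2) (comulLast k C (m + 1) x))
  have h2 := LinearMap.congr_fun (comulFirst_comulFirst k C (m + 2)) (comulLast k C (m + 1) x)
  have h3 := LinearMap.congr_fun (comulFirst_comulLast k C (m + 1)) x
  simp only [LinearMap.comp_apply] at h1 h2 h3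
  rw [hat_apply, h1, h2, h3, hat, lWh_comp, lWh_comp, lWh_comulLast]
  simp only [LinearMap.comp_apply]

theorem comulLast_hat {m j : ℕ} (s : ⨂[k]^(m + 2) C →ₗ[k] ⨂[k]^j C) :
    comulLast k C (j + 1) ∘ₗ hat s = rWh (hat s) ∘ₗ comulLast k C (m + 1) := by
  ext1
  ext a
  generalize hx : (PiTensorProduct.tprod k) a = x
  simp only [LinearMap.compMultilinearMap_apply, hx, LinearMap.comp_apply]
  have h1 := LinearMap.congr_fun (comulLast_rWh (lWh s))
    (comulLast k C (m + 2) (comulFirst k C (m + 1) x))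
  have h2 := LinearMap.congr_fun (comulLast_comulLast k C (m + 2)) (comulFirst k C (m + 1) x)
  have h3 := LinearMap.congr_fun (comulFirst_comulLast k C (m + 1)) x
  simp only [LinearMap.comp_apply] at h1 h2 h3
  rw [hat_apply', h1, h2, ← h3, hat_eq, rWh_comp, rWh_comp, rWh_comulFirst]
  simp only [LinearMap.comp_apply]

theorem hat_lWh {m j : ℕ} (s : ⨂[k]^(m + 2) C →ₗ[k] ⨂[k]^j C) :
    hat (lWh s ∘ₗ comulFirst k C (m + 1)) = comulFirst k C (j + 1) ∘ₗ hat s := by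
  ext1
  ext a
  generalize hx : (PiTensorProduct.tprod k) a = x
  simp only [LinearMap.compMultilinearMap_apply, hx, LinearMap.comp_apply]
  have h1 := LinearMap.congr_fun (comulFirst_lWh (rWh s))
    (comulFirst k C (m + 2) (comulLast k C (m + 1) x))
  have h2 := LinearMap.congr_fun (comulFirst_comulFirst k C (m + 2)) (comulLast k C (m + 1) x)
  simp only [LinearMap.comp_apply] at h1 h2
  rw [hat_apply s, h1, h2, hat_apply, rWh_comp, lWh_comp, rWh_comulFirst, ← lWh_rWh]
  simp only [LinearMap.comp_apply]

theorem hat_rWh {m j : ℕ} (s : ⨂[k]^(m + 2) C →ₗ[k] ⨂[k]^j C) :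
    hat (rWh s ∘ₗ comulLast k C (m + 1)) = comulLast k C (j + 1) ∘ₗ hat s := by
  ext1
  ext a
  generalize hx : (PiTensorProduct.tprod k) a = x
  simp only [LinearMap.compMultilinearMap_apply, hx, LinearMap.comp_apply]
  have h1 := LinearMap.congr_fun (comulLast_rWh (lWh s))
    (comulLast k C (m + 2) (comulFirst k C (m + 1) x))
  have h2 := LinearMap.congr_fun (comulLast_comulLast k C (m + 2)) (comulFirst k C (m + 1) x)
  simp only [LinearMap.comp_apply] at h1 h2
  rw [hat_apply' s, h1, h2, hat_apply', lWh_comp, rWh_comp, lWh_comulLast, lWh_rWh]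
  rfl

theorem hat_comp_left {m j l : ℕ} (s : ⨂[k]^(m + 2) C →ₗ[k] ⨂[k]^j C)
    (φ : ⨂[k]^j C →ₗ[k] ⨂[k]^l C) : hat (φ ∘ₗ s) = lWh (rWh φ) ∘ₗ hat s := by
  rw [hat, rWh_comp, lWh_comp, LinearMap.comp_assoc]
  rfl

/-- Peeling both outer factors off the cobar differential leaves three terms: `Δ` on the first
factor, `Δ` on the last, and the cobar differential of the middle. They match the three terms of
`hoch`, which is the reason for its form and signs. -/
theorem cobar_hat {m j : ℕ} (s : ⨂[k]^(m + 2) C →ₗ[k] ⨂[k]^j C) :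
    cobar k C (j + 2) ∘ₗ hat s = hat (hoch s) := by
  rw [hoch, hat_sub, hat_sub, hat_smul, hat_lWh, hat_rWh, hat_comp_left, cobar_succ k C (j + 1),
    cobar_succ' k C j, lWh_add, lWh_smul, lWh_comulLast, LinearMap.sub_comp, LinearMap.add_comp,
    LinearMap.smul_comp]
  abel

/-- Counits at both ends undo `hat`. Hence `hat` is injective, and identities for `hoch` can be
deduced from those for `cobar`. -/
theorem counit_hat {m j : ℕ} (s : ⨂[k]^(m + 2) C →ₗ[k] ⨂[k]^j C) :
    counitFirst k C j ∘ₗ counitLast k C (j + 1) ∘ₗ hat s = s := by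
  rw [hat_eq, ← LinearMap.comp_assoc (comulLast k C _ ∘ₗ _), counitLast_rWh, LinearMap.comp_assoc,
    ← LinearMap.comp_assoc (comulFirst k C _), counitLast_comulLast, LinearMap.id_comp,
    ← LinearMap.comp_assoc, counitFirst_lWh, LinearMap.comp_assoc, counitFirst_comulFirst,
    LinearMap.comp_id]

theorem hoch_hoch {m j : ℕ} (s : ⨂[k]^(m + 2) C →ₗ[k] ⨂[k]^j C) : hoch (hoch s) = 0 := by
  rw [← counit_hat (hoch (hoch s)), ← cobar_hat, ← cobar_hat,
    ← LinearMap.comp_assoc (hat s), cobar_comp_cobar, LinearMap.zero_comp, LinearMap.comp_zero,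
    LinearMap.comp_zero]

variable (k C) in
theorem rWh_counitFirst (n : ℕ) : rWh (counitFirst k C n) = counitFirst k C (n + 1) :=
  rWh_sliceFirst _ n

variable (k C) in
/-- The linear map corresponding to the identity of `C^{⊗ (m+2)}`. -/
def counitEnds (m : ℕ) : ⨂[k]^(m + 2) C →ₗ[k] ⨂[k]^m C :=
  counitFirst k C m ∘ₗ counitLast k C (m + 1)

variable (k C) in
theorem hat_counitEnds (m : ℕ) : hat (counitEnds k C m) = LinearMap.id := by
  rw [hat, counitEnds, comulFirst_comulLast, rWh_comp, lWh_comp, rWh_counitFirst,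
    ← lWh_comulLast, LinearMap.comp_assoc, ← LinearMap.comp_assoc (comulFirst k C _), ← lWh_comp,
    rWh_counitLast_comulLast, lWh_id, LinearMap.id_comp, lWh_counitFirst_comulFirst]

/-- Bicolinearity of `cobar` moves it inside. The right side is written out because the source may
have a single factor, where `hat` is not available; with at least two factors it is
`hat_comp_cobar_succ`. -/
theorem hat_comp_cobar {m j : ℕ} (s : ⨂[k]^(m + 2) C →ₗ[k] ⨂[k]^j C) :
    hat s ∘ₗ cobar k C (m + 1) = lWh (rWh (s ∘ₗ cobar k C (m + 1))) ∘ₗ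
      comulLast k C (m + 1) ∘ₗ comulFirst k C m := by
  rw [hat, comulFirst_comulLast, LinearMap.comp_assoc, LinearMap.comp_assoc, comulFirst_cobar,
    ← lWh_comulLast, ← LinearMap.comp_assoc (comulFirst k C m), ← lWh_comp, comulLast_cobar,
    lWh_comp, lWh_comulLast, LinearMap.comp_assoc, ← LinearMap.comp_assoc _ _ (lWh (rWh s)),
    ← lWh_comp, ← rWh_comp]

theorem hat_comp_cobar_succ {m j : ℕ} (s : ⨂[k]^(m + 3) C →ₗ[k] ⨂[k]^j C) :
    hat s ∘ₗ cobar k C (m + 2) = hat (s ∘ₗ cobar k C (m + 2)) := by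
  rw [hat_comp_cobar, hat_eq (s ∘ₗ _), lWh_rWh]

/-- A map that factors through the quotient by `E` sees the two coactions at `x` only through `g ⊗
-` and `- ⊗ h`. Thus the outer terms of `hoch` become the outer terms of `∂_{g,h}`. -/
theorem hoch_apply_of_quotient {m j : ℕ} {E : Submodule k (⨂[k]^(m + 1) C)}
    {F : ⨂[k]^(m + 1) C →ₗ[k] ⨂[k]^j C} (hF : ∀ x ∈ E, F x = 0) {g h : C} {x : ⨂[k]^(m + 1) C}
    (hg : E.mkQ.lTensor C (coactL k C m x) = g ⊗ₜ E.mkQ x)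
    (hh : E.mkQ.lTensor (Cop C) (coactR k C m x) = copEquiv k C h ⊗ₜ E.mkQ x) :
    hoch F x = differential k g h j (F x) := by
  let F' := E.liftQ F hF
  have hF' : F = F' ∘ₗ E.mkQ := (E.liftQ_mkQ F hF).symm
  have hFx : F' (E.mkQ x) = F x := by rw [hF']; rfl
  rw [hoch, differential_eq, LinearMap.sub_apply, LinearMap.sub_apply, LinearMap.smul_apply,
    LinearMap.comp_apply, LinearMap.comp_apply, LinearMap.comp_apply, lWh_comulFirst_apply,
    rWh_comulLast_apply]
  have h1 : F.lTensor C (coactL k C m x) = g ⊗ₜ F x := by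
    conv_lhs => rw [hF', LinearMap.lTensor_comp, LinearMap.comp_apply, hg, LinearMap.lTensor_tmul,
      hFx]
  have h2 : F.lTensor (Cop C) (coactR k C m x) = copEquiv k C h ⊗ₜ F x := by
    conv_lhs => rw [hF', LinearMap.lTensor_comp, LinearMap.comp_apply, hh, LinearMap.lTensor_tmul,
      hFx]
  rw [h1, h2, LinearMap.add_apply, LinearMap.sub_apply, LinearMap.smul_apply, leftTensor_apply,
    rightTensor_apply, snocCop_tmul, pow_succ, mul_neg_one, neg_smul, ← sub_eq_add_neg]

end Hat

/-! ### Splitting the bicomodule cobar resolution and propagating the vanishing of cohomology -/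

section Splitting

variable {k : Type*} {C : Type*} [Field k] [AddCommGroup C] [Module k C]

theorem IsStable.sup_span {M : Type*} [AddCommGroup M] [Module k M] {ρ : M →ₗ[k] C ⊗[k] M}
    {E : Submodule k M} (hE : IsStable ρ E) {x : M} {g : C}
    (hx : E.mkQ.lTensor C (ρ x) = g ⊗ₜ E.mkQ x) : IsStable ρ (E ⊔ Submodule.span k {x}) := by
  intro f y hy
  obtain ⟨e, he, z, hz, rfl⟩ := Submodule.mem_sup.1 hy
  obtain ⟨r, rfl⟩ := Submodule.mem_span_singleton.1 hz
  have h1 : slice f (ρ x) - f g • x ∈ E := by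
    rw [← Submodule.Quotient.mk_eq_zero, ← Submodule.mkQ_apply, map_sub, map_smul,
      ← slice_lTensor, hx, slice_tmul, sub_self]
  have h2 : slice f (ρ (e + r • x)) =
      (slice f (ρ e) + r • (slice f (ρ x) - f g • x)) + (r * f g) • x := by
    rw [map_add, map_add, map_smul, map_smul, smul_sub, mul_smul]
    abel
  rw [h2]
  exact Submodule.add_mem_sup (E.add_mem (hE f e he) (E.smul_mem _ h1))
    (Submodule.smul_mem _ _ (Submodule.mem_span_singleton_self x))

/-- `w ↦ g ⊗ w ⊗ h`. -/
def insertEnds (g h : C) (m : ℕ) (w : ⨂[k]^m C) : ⨂[k]^(m + 2) C :=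
  consEquiv k C (m + 1) (g ⊗ₜ snocEquiv k C m (w ⊗ₜ h))

theorem insertEnds_eq (g h : C) (m : ℕ) (w : ⨂[k]^m C) : insertEnds g h m w =
    snocEquiv k C (m + 1) (consEquiv k C m (g ⊗ₜ w) ⊗ₜ h) := (snoc_cons m g h w).symm

variable [Coalgebra k C]

variable (k C) in
/-- Every `(n+1)`-cocycle of every complex `T_{g,h} C` is a coboundary. -/
def CohomologyVanishes (n : ℕ) : Prop :=
  ∀ g h : C, IsGroupLikeElem k g → IsGroupLikeElem k h →
    ∀ z : ⨂[k]^(n + 1) C, differential k g h (n + 1) z = 0 → ∃ y, differential k g h n y = z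

variable (k C) in
theorem isStable_coactL_range_cobar (n : ℕ) :
    IsStable (coactL k C (n + 1)) (LinearMap.range (cobar k C (n + 1))) := by
  rintro f _ ⟨x, rfl⟩
  have h1 := LinearMap.congr_fun (comulFirst_cobar k C n) x
  have h2 := LinearMap.congr_fun (sliceFirst_lWh f (cobar k C (n + 1))) (comulFirst k C n x)
  simp only [LinearMap.comp_apply] at h1 h2
  rw [slice_coactL, h1, h2]
  exact ⟨_, rfl⟩

variable (k C) in
theorem isStable_coactR_range_cobar (n : ℕ) :
    IsStable (coactR k C (n + 1)) (LinearMap.range (cobar k C (n + 1))) := by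
  rintro f _ ⟨x, rfl⟩
  have h1 := LinearMap.congr_fun (comulLast_cobar k C n) x
  have h2 := LinearMap.congr_fun (sliceLast_rWh (f ∘ₗ (copEquiv k C).toLinearMap)
    (cobar k C (n + 1))) (comulLast k C n x)
  simp only [LinearMap.comp_apply] at h1 h2
  rw [slice_coactR, h1, h2]
  exact ⟨_, rfl⟩

theorem hoch_apply_eq_zero {m j : ℕ} {E : Submodule k (⨂[k]^(m + 1) C)}
    (hL : IsStable (coactL k C m) E) (hR : IsStable (coactR k C m) E)
    {F : ⨂[k]^(m + 1) C →ₗ[k] ⨂[k]^j C} (hF : ∀ x ∈ E, F x = 0) {x : ⨂[k]^(m + 1) C}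
    (hx : x ∈ E) : hoch F x = 0 := by
  -- For `x` in `E` both coactions vanish modulo `E`, so the formula holds with any `g` and `h`, in
  -- particular with zero; no grouplike condition is needed there.
  rw [hoch_apply_of_quotient hF (g := 0) (h := 0), hF x hx, map_zero]
  · rw [hL.lTensor_mkQ_eq_zero hx, TensorProduct.zero_tmul]
  · rw [hR.lTensor_mkQ_eq_zero hx, map_zero, TensorProduct.zero_tmul]

theorem hoch_congr {m j : ℕ} {E : Submodule k (⨂[k]^(m + 1) C)}
    (hL : IsStable (coactL k C m) E) (hR : IsStable (coactR k C m) E)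
    {F G : ⨂[k]^(m + 1) C →ₗ[k] ⨂[k]^j C} (hF : ∀ x ∈ E, F x = G x) {x : ⨂[k]^(m + 1) C}
    (hx : x ∈ E) : hoch F x = hoch G x := by
  have := hoch_apply_eq_zero hL hR (F := F - G)
    (fun x hx => by rw [LinearMap.sub_apply, hF x hx, sub_self]) hx
  rwa [hoch_sub, LinearMap.sub_apply, sub_eq_zero] at this

/-- A stage of the construction of a bicolinear projection. -/
structure IsPartialSplitting (n : ℕ) (E : Submodule k (⨂[k]^(n + 2) C))
    (s : ⨂[k]^(n + 2) C →ₗ[k] ⨂[k]^n C) : Prop where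
  stableL : IsStable (coactL k C (n + 1)) E
  stableR : IsStable (coactR k C (n + 1)) E
  range_le : LinearMap.range (cobar k C (n + 1)) ≤ E
  comp_cobar : s ∘ₗ cobar k C (n + 1) = 0
  hoch_eq : ∀ x ∈ E, hoch s x = hoch (counitEnds k C n) x

/-- Under `hat`, the map `hoch (counitEnds k C n)` is the cobar differential itself, which vanishes
on coboundaries. This makes `s = 0` on the range of `cobar` an admissible start for the extension
process. -/
theorem counitEnds_comp_cobar_hoch (n : ℕ) {x : ⨂[k]^(n + 2) C}
    (hx : x ∈ LinearMap.range (cobar k C (n + 1))) : hoch (counitEnds k C n) x = 0 := by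
  obtain ⟨x, rfl⟩ := hx
  have h : hat (hoch (counitEnds k C n)) ∘ₗ cobar k C (n + 1) = 0 := by
    rw [← cobar_hat, hat_counitEnds, LinearMap.comp_id, cobar_comp_cobar]
  rw [← counit_hat (hoch (counitEnds k C n))]
  have := LinearMap.congr_fun h x
  simp only [LinearMap.comp_apply] at this ⊢
  rw [this]
  simp

/-- The obstruction to adding a vector `x` that is one-dimensional modulo `E` is a class in
`𝔓ⁿ⁺¹_{g,h}(C)`, which vanishes by hypothesis. -/
theorem IsPartialSplitting.extend (hC : IsPointed k C) {n : ℕ} (hv : CohomologyVanishes k C n)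
    {E : Submodule k (⨂[k]^(n + 2) C)} {s : ⨂[k]^(n + 2) C →ₗ[k] ⨂[k]^n C}
    (hs : IsPartialSplitting n E s) (hE : E ≠ ⊤) :
    ∃ E' s', IsPartialSplitting n E' s' ∧ E < E' ∧ ∀ x ∈ E, s' x = s x := by
  obtain ⟨ρ, hρ, hρ'⟩ := (isLeftComodule_coactL k C (n + 1)).exists_quotient hs.stableL
  obtain ⟨τ, hτ, hτ'⟩ := (isLeftComodule_coactR k C (n + 1)).exists_quotient hs.stableR
  have hnt : Nontrivial (⨂[k]^(n + 2) C ⧸ E) := Submodule.Quotient.nontrivial_iff.2 hE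
  obtain ⟨g, h, hg, hh, x, hx0, hxg, hxh⟩ := exists_eq_tmul_of_bicomodule hρ hτ (fun f f' x => by
    obtain ⟨x, rfl⟩ := E.mkQ_surjective x
    rw [hτ', slice_lTensor, hρ', slice_lTensor, hρ', slice_lTensor, hτ', slice_lTensor,
      slice_coactL_slice_coactR]) hC
  obtain ⟨x, rfl⟩ := E.mkQ_surjective x
  rw [hρ'] at hxg
  rw [hτ'] at hxh
  obtain ⟨φ, hφ⟩ := Module.Projective.exists_dual_eq_one k hx0
  let F := hoch (counitEnds k C n - s)
  have hFE : ∀ y ∈ E, F y = 0 := fun y hy => by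
    simp only [F, hoch_sub, LinearMap.sub_apply, hs.hoch_eq y hy, sub_self]
  have hFx : differential k g h (n + 1) (F x) = 0 := by
    rw [← hoch_apply_of_quotient hFE hxg hxh, hoch_hoch, LinearMap.zero_apply]
  obtain ⟨y, hy⟩ := hv g h hg hh _ hFx
  -- The correction is zero on `E` and takes `x` to a cochain `y` bounding the defect, so it removes
  -- the defect at `x` without changing anything on `E`.
  let G : ⨂[k]^(n + 2) C →ₗ[k] ⨂[k]^n C := (φ ∘ₗ E.mkQ).smulRight y
  have hGE : ∀ e ∈ E, G e = 0 := fun e he => by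
    simp [G, (Submodule.Quotient.mk_eq_zero E).2 he]
  have hGx : G x = y := by
    simp only [G, LinearMap.smulRight_apply, LinearMap.comp_apply, hφ, one_smul]
  have hGh : hoch G x = F x := by
    rw [hoch_apply_of_quotient hGE hxg hxh, hGx, hy]
  refine ⟨E ⊔ Submodule.span k {x}, s + G, ⟨hs.stableL.sup_span hxg, hs.stableR.sup_span hxh,
    hs.range_le.trans le_sup_left, ?_, ?_⟩, ?_, ?_⟩
  · refine LinearMap.ext fun w => ?_
    have h1 := LinearMap.congr_fun hs.comp_cobar w
    rw [LinearMap.comp_apply] at h1 ⊢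
    rw [LinearMap.add_apply, h1, hGE _ (hs.range_le ⟨w, rfl⟩)]
    simp
  · intro w hw
    have hle : E ⊔ Submodule.span k {x} ≤
        LinearMap.ker (hoch (s + G) - hoch (counitEnds k C n)) := by
      rw [sup_le_iff, Submodule.span_singleton_le_iff_mem]
      refine ⟨fun e he => ?_, ?_⟩
      · rw [LinearMap.mem_ker, hoch_add, LinearMap.sub_apply, LinearMap.add_apply,
          hs.hoch_eq e he, hoch_apply_eq_zero hs.stableL hs.stableR hGE he, add_zero, sub_self]
      · rw [LinearMap.mem_ker, hoch_add, LinearMap.sub_apply, LinearMap.add_apply, hGh]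
        simp only [F, hoch_sub, LinearMap.sub_apply]
        abel
    have := hle hw
    rwa [LinearMap.mem_ker, LinearMap.sub_apply, sub_eq_zero] at this
  · refine lt_of_le_of_ne le_sup_left fun heq => hx0 ?_
    rw [Submodule.mkQ_apply, Submodule.Quotient.mk_eq_zero, heq]
    exact Submodule.mem_sup_right (Submodule.mem_span_singleton_self x)
  · intro e he
    rw [LinearMap.add_apply, hGE e he, add_zero]

/-- If `𝔓ⁿ⁺¹_{g,h}(C) = 0` for all grouplike `g`, `h`, then the bicomodule cobar resolution of `C`
splits in degree `n`. -/
theorem exists_splitting (hC : IsPointed k C) {n : ℕ} (hv : CohomologyVanishes k C n) :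
    ∃ s : ⨂[k]^(n + 2) C →ₗ[k] ⨂[k]^n C, s ∘ₗ cobar k C (n + 1) = 0 ∧
      hoch s = hoch (counitEnds k C n) := by
  -- Partial maps are ordered by extension, and the conditions are imposed on some total extension.
  -- By `hoch_congr`, the values of `hoch` on a stable domain do not depend on that extension, so
  -- the choice is harmless in unions of chains.
  let S : Set (⨂[k]^(n + 2) C →ₗ.[k] ⨂[k]^n C) :=
    {p | ∃ s, IsPartialSplitting n p.domain s ∧ ∀ x : p.domain, p x = s x}
  have hne : LinearPMap.mk (LinearMap.range (cobar k C (n + 1)))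
      ((0 : ⨂[k]^(n + 2) C →ₗ[k] ⨂[k]^n C).domRestrict _) ∈ S := by
    refine ⟨0, ⟨isStable_coactL_range_cobar k C n, isStable_coactR_range_cobar k C n, le_rfl,
      LinearMap.zero_comp _, fun x hx => ?_⟩, fun x => rfl⟩
    rw [counitEnds_comp_cobar_hoch n hx, hoch_apply_eq_zero (isStable_coactL_range_cobar k C n)
      (isStable_coactR_range_cobar k C n) (fun _ _ => rfl) hx]
  obtain ⟨p, -, hp⟩ := zorn_le_nonempty₀ S (fun c hcS hc p₀ hp₀ => by
    have hdir : DirectedOn (· ≤ ·) c := hc.directedOn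
    refine ⟨LinearPMap.sSup c hdir, ?_, fun z hz => LinearPMap.le_sSup hdir hz⟩
    obtain ⟨s, hs⟩ := LinearMap.exists_extend (LinearPMap.sSup c hdir).toFun
    have hs' : ∀ x : (LinearPMap.sSup c hdir).domain, LinearPMap.sSup c hdir x = s x := fun x =>
      (LinearMap.congr_fun hs x).symm
    have hmem : ∀ x, x ∈ (LinearPMap.sSup c hdir).domain ↔ ∃ p ∈ c, x ∈ p.domain := by
      intro x
      rw [LinearPMap.domain_sSup, Submodule.mem_sSup_of_directed (Set.Nonempty.image _ ⟨p₀, hp₀⟩)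
        (directedOn_image.2 (hdir.mono' fun a _ b _ hab => hab.1))]
      simp
    have hle : ∀ p ∈ c, p.domain ≤ (LinearPMap.sSup c hdir).domain := fun p hpc =>
      (LinearPMap.le_sSup hdir hpc).1
    have hagree : ∀ p ∈ c, ∀ t : ⨂[k]^(n + 2) C →ₗ[k] ⨂[k]^n C, (∀ x : p.domain, p x = t x) → ∀ x ∈ p.domain, s x = t x := by
      intro p hpc t ht x hx
      rw [← hs' ⟨x, hle p hpc hx⟩, ← ht ⟨x, hx⟩]
      exact ((LinearPMap.le_sSup hdir hpc).2 rfl).symm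
    refine ⟨s, ⟨?_, ?_, ?_, ?_, ?_⟩, hs'⟩
    · intro f x hx
      obtain ⟨p, hpc, hxp⟩ := (hmem x).1 hx
      obtain ⟨t, ht, -⟩ := hcS hpc
      exact hle p hpc (ht.stableL f x hxp)
    · intro f x hx
      obtain ⟨p, hpc, hxp⟩ := (hmem x).1 hx
      obtain ⟨t, ht, -⟩ := hcS hpc
      exact hle p hpc (ht.stableR f x hxp)
    · obtain ⟨t, ht, -⟩ := hcS hp₀
      exact ht.range_le.trans (hle p₀ hp₀)
    · obtain ⟨t, ht, ht'⟩ := hcS hp₀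
      refine LinearMap.ext fun w => ?_
      rw [LinearMap.comp_apply, hagree p₀ hp₀ t ht' _ (ht.range_le ⟨w, rfl⟩)]
      exact LinearMap.congr_fun ht.comp_cobar w
    · intro x hx
      obtain ⟨p, hpc, hxp⟩ := (hmem x).1 hx
      obtain ⟨t, ht, ht'⟩ := hcS hpc
      rw [← ht.hoch_eq x hxp]
      exact hoch_congr ht.stableL ht.stableR (hagree p hpc t ht') hxp) _ hne
  obtain ⟨⟨s, hs, hps⟩, hmax⟩ := hp
  by_cases htop : p.domain = ⊤
  · exact ⟨s, hs.comp_cobar, LinearMap.ext fun x => hs.hoch_eq x (htop ▸ Submodule.mem_top)⟩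
  · exfalso
    obtain ⟨E', s', hs', hlt, hss⟩ := hs.extend hC hv htop
    have h1 : LinearPMap.mk E' (s'.domRestrict E') ∈ S := ⟨s', hs', fun x => rfl⟩
    have h2 : p ≤ LinearPMap.mk E' (s'.domRestrict E') := by
      refine ⟨hlt.le, fun x y hxy => ?_⟩
      rw [hps x, ← hss x x.2, hxy]
      rfl
    exact hlt.not_ge (hmax h1 h2).1

/-- Extension of bicolinear maps along the cobar differential. -/
theorem exists_hat_comp_cobar {m j : ℕ} (s : ⨂[k]^(m + 2) C →ₗ[k] ⨂[k]^j C)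
    (hs : hat s ∘ₗ cobar k C (m + 1) = 0) :
    ∃ t : ⨂[k]^(m + 3) C →ₗ[k] ⨂[k]^j C, hat t ∘ₗ cobar k C (m + 2) = hat s := by
  -- By the counit homotopy, composing this map with the differential gives `s` minus a term
  -- containing `s ∘ cobar`, which is zero.
  refine ⟨s ∘ₗ counitFirst k C (m + 2), ?_⟩
  have hs' : s ∘ₗ cobar k C (m + 1) = 0 := by
    rw [← counit_hat s, LinearMap.comp_assoc, LinearMap.comp_assoc, hs, LinearMap.comp_zero,
      LinearMap.comp_zero]
  rw [hat_comp_cobar_succ, LinearMap.comp_assoc, counitFirst_cobar, LinearMap.comp_sub,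
    LinearMap.comp_id, ← LinearMap.comp_assoc, hs', LinearMap.zero_comp, sub_zero]

variable (k C) in
/-- The bicomodule cobar resolution has a contracting homotopy in degree `m + 1`. -/
def HasHomotopy (m : ℕ) : Prop :=
  ∃ (t : ⨂[k]^(m + 3) C →ₗ[k] ⨂[k]^m C) (t' : ⨂[k]^(m + 4) C →ₗ[k] ⨂[k]^(m + 1) C),
    hat t' ∘ₗ cobar k C (m + 3) + cobar k C (m + 2) ∘ₗ hat t = LinearMap.id

/-- The hypothesis says that `id - cobar ∘ hat φ` kills the image of the incoming differential. It
is bicolinear, so it factors through the outgoing one. -/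
theorem HasHomotopy.of_comp {m : ℕ} (φ : ⨂[k]^(m + 3) C →ₗ[k] ⨂[k]^m C)
    (hφ : cobar k C (m + 2) ∘ₗ hat φ ∘ₗ cobar k C (m + 2) = cobar k C (m + 2)) :
    HasHomotopy k C m := by
  have h1 : hat (counitEnds k C (m + 1) - hoch φ) =
      LinearMap.id - cobar k C (m + 2) ∘ₗ hat φ := by
    rw [hat_sub, hat_counitEnds, cobar_hat]
  obtain ⟨t', ht'⟩ := exists_hat_comp_cobar (counitEnds k C (m + 1) - hoch φ) (by
    rw [h1, LinearMap.sub_comp, LinearMap.id_comp, LinearMap.comp_assoc, hφ, sub_self])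
  exact ⟨φ, t', by rw [ht', h1, sub_add_cancel]⟩

/-- Applying the outgoing differential to the homotopy identity kills the term with `hat t` and
leaves `cobar ∘ hat t' ∘ cobar = cobar`. -/
theorem HasHomotopy.succ {m : ℕ} (h : HasHomotopy k C m) : HasHomotopy k C (m + 1) := by
  obtain ⟨t, t', h⟩ := h
  refine HasHomotopy.of_comp t' ?_
  rw [eq_sub_of_add_eq h, LinearMap.comp_sub, LinearMap.comp_id, ← LinearMap.comp_assoc,
    cobar_comp_cobar, LinearMap.zero_comp, sub_zero]

theorem CohomologyVanishes.hasHomotopy (hC : IsPointed k C) {n : ℕ} (hv : CohomologyVanishes k C n)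
    {m : ℕ} (hm : n ≤ m) : HasHomotopy k C m := by
  induction m, hm using Nat.le_induction with
  | base =>
    obtain ⟨s, hs, hs'⟩ := exists_splitting hC hv
    have h0 : hat s ∘ₗ cobar k C (n + 1) = 0 := by
      rw [hat_comp_cobar, hs, rWh_zero, lWh_zero, LinearMap.zero_comp]
    obtain ⟨t, ht⟩ := exists_hat_comp_cobar s h0
    exact HasHomotopy.of_comp t (by
      rw [ht, cobar_hat, hs', ← cobar_hat, hat_counitEnds, LinearMap.comp_id])
  | succ m _ ih => exact ih.succ

theorem counitEnds_insertEnds {g h : C} (hg : IsGroupLikeElem k g) (hh : IsGroupLikeElem k h)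
    (m : ℕ) (w : ⨂[k]^m C) : counitEnds k C m (insertEnds g h m w) = w := by
  rw [insertEnds_eq, counitEnds, LinearMap.comp_apply, counitLast_snoc, hh.counit_eq_one, one_smul,
    counitFirst_cons, hg.counit_eq_one, one_smul]

/-- Tensors `g ⊗ w ⊗ h` are eigenvectors for both coactions, a form that bicolinear maps preserve.
So a homotopy of the resolution restricts to the embedded complex `T_{g,h} C`. -/
theorem hat_insertEnds {g h : C} (hg : IsGroupLikeElem k g) (hh : IsGroupLikeElem k h) {m j : ℕ}
    (s : ⨂[k]^(m + 2) C →ₗ[k] ⨂[k]^j C) (w : ⨂[k]^m C) :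
    hat s (insertEnds g h m w) = insertEnds g h j (s (insertEnds g h m w)) := by
  have h1 : comulLast k C (m + 1) (insertEnds g h m w) =
      snocEquiv k C (m + 2) (insertEnds g h m w ⊗ₜ h) := by
    rw [insertEnds_eq, comulLast_snoc, hh.comul_eq_tmul_self, snocTwo_tmul]
  have h2 : comulFirst k C (m + 1) (insertEnds g h m w) =
      consEquiv k C (m + 2) (g ⊗ₜ insertEnds g h m w) := by
    rw [insertEnds, comulFirst_cons, hg.comul_eq_tmul_self, consTwo_tmul]
  rw [hat_apply, h1, ← rWh_comulFirst, rWh_snoc, h2, snoc_cons, lWh_cons, rWh_snoc]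
  rfl

theorem cobar_insertEnds {g h : C} (hg : IsGroupLikeElem k g) (hh : IsGroupLikeElem k h) (m : ℕ)
    (w : ⨂[k]^m C) :
    cobar k C (m + 2) (insertEnds g h m w) = insertEnds g h (m + 1) (differential k g h m w) := by
  rw [cobar_succ, LinearMap.sub_apply, differential_eq]
  have h1 : comulFirst k C (m + 1) (insertEnds g h m w) =
      consEquiv k C (m + 2) (g ⊗ₜ insertEnds g h m w) := by
    rw [insertEnds, comulFirst_cons, hg.comul_eq_tmul_self, consTwo_tmul]
  have h2 : cobar k C (m + 1) (snocEquiv k C m (w ⊗ₜ h)) =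
      snocEquiv k C (m + 1) (cobar k C m w ⊗ₜ h) +
        (-1 : k) ^ m • snocEquiv k C (m + 1) (snocEquiv k C m (w ⊗ₜ h) ⊗ₜ h) := by
    rw [cobar_succ', LinearMap.add_apply, rWh_snoc, LinearMap.smul_apply, comulLast_snoc,
      hh.comul_eq_tmul_self, snocTwo_tmul]
  rw [h1, insertEnds, lWh_cons, h2, insertEnds, ← map_sub, ← TensorProduct.tmul_sub]
  congr 2
  rw [LinearMap.add_apply, LinearMap.sub_apply, LinearMap.smul_apply, leftTensor_apply,
    rightTensor_apply, TensorProduct.add_tmul, TensorProduct.sub_tmul, map_add, map_sub,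
    ← TensorProduct.smul_tmul', map_smul, snoc_cons, pow_succ, mul_neg_one, neg_smul]
  abel

theorem apply_apply_eq_of_homotopy {U V W : Type*} [AddCommMonoid U] [Module k U]
    [AddCommMonoid V] [Module k V] [AddCommMonoid W] [Module k W] {f : V →ₗ[k] U} {g : U →ₗ[k] V}
    {a : W →ₗ[k] U} {b : U →ₗ[k] W} (h : f ∘ₗ g + a ∘ₗ b = LinearMap.id) {x : U} (hx : g x = 0) :
    a (b x) = x := by
  simpa [hx] using LinearMap.congr_fun h x

set_option maxRecDepth 20000 in
-- One splitting gives homotopies in all later degrees; evaluated at `g ⊗ z ⊗ h` they exhibit `z` as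
-- a coboundary.
theorem CohomologyVanishes.of_le (hC : IsPointed k C) {n m : ℕ} (hv : CohomologyVanishes k C n)
    (hnm : n ≤ m) : CohomologyVanishes k C m := by
  intro g h hg hh z hz
  obtain ⟨t, t', ht⟩ := hv.hasHomotopy hC hnm
  refine ⟨t (insertEnds g h (m + 1) z), ?_⟩
  have h0 : insertEnds g h (m + 2) (0 : ⨂[k]^(m + 2) C) = 0 := by simp [insertEnds]
  have h3 : cobar k C (m + 3) (insertEnds g h (m + 1) z) = 0 := by
    rw [cobar_insertEnds hg hh (m + 1), hz, h0]
  have h1 := apply_apply_eq_of_homotopy ht h3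
  rw [hat_insertEnds hg hh, cobar_insertEnds hg hh] at h1
  have h2 := congrArg (counitEnds k C (m + 1)) h1
  rwa [counitEnds_insertEnds hg hh, counitEnds_insertEnds hg hh] at h2

end Splitting

/-! ### Primitive cohomological dimension -/

section Dimension

variable {k : Type*} {C : Type*} [Field k] [AddCommGroup C] [Module k C] [Coalgebra k C]

theorem nontrivial_primCohomology_iff (g h : C) (n : ℕ) : Nontrivial (PrimCohomology k g h n) ↔
    ∃ z, differential k g h n z = 0 ∧ z ∉ coboundaries k g h n := by
  rw [Submodule.Quotient.nontrivial_iff, Ne, Submodule.submoduleOf, Submodule.comap_subtype_eq_top,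
    SetLike.not_le_iff_exists]
  simp

theorem cohomologyVanishes_iff (n : ℕ) : CohomologyVanishes k C n ↔
    ¬ ∃ g h : C, IsGroupLikeElem k g ∧ IsGroupLikeElem k h ∧
      Nontrivial (PrimCohomology k g h (n + 1)) := by
  simp only [nontrivial_primCohomology_iff, coboundaries, LinearMap.mem_range, CohomologyVanishes]
  push Not
  rfl

/-- On scalars the differential is multiplication by `g - g`. Hence the existence of one grouplike
element already forces `PCdim` to be at least `0`. -/
theorem nontrivial_primCohomology_zero (g : C) : Nontrivial (PrimCohomology k g g 0) := by
  rw [nontrivial_primCohomology_iff]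
  refine ⟨PiTensorProduct.tprod k Fin.elim0, ?_, ?_⟩
  · rw [differential_eq, cobar_zero, LinearMap.add_apply, LinearMap.sub_apply,
      LinearMap.smul_apply, leftTensor_apply, rightTensor_apply, cons_zero_eq_snoc]
    simp
  · rw [coboundaries, Submodule.mem_bot]
    intro h
    have := congrArg (PiTensorProduct.isEmptyEquiv (R := k) (s := fun _ => C) (Fin 0)) h
    simp at this

theorem le_PCdim {n : ℕ} {g h : C} (hg : IsGroupLikeElem k g) (hh : IsGroupLikeElem k h)
    (hn : Nontrivial (PrimCohomology k g h n)) : (n : WithBot ℕ∞) ≤ PCdim k C :=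
  le_sSup ⟨n, rfl, g, h, hg, hh, hn⟩

theorem PCdim_le {d : WithBot ℕ∞} (h : ∀ (n : ℕ) (g h : C), IsGroupLikeElem k g →
    IsGroupLikeElem k h → Nontrivial (PrimCohomology k g h n) → (n : WithBot ℕ∞) ≤ d) :
    PCdim k C ≤ d := by
  refine sSup_le ?_
  rintro _ ⟨n, rfl, g, g', hg, hg', hn⟩
  exact h n g g' hg hg' hn

theorem exists_nontrivial_of_le_PCdim (hC : IsPointed k C) {n : ℕ}
    (hn : (n : WithBot ℕ∞) ≤ PCdim k C) : ∃ g h : C, IsGroupLikeElem k g ∧ IsGroupLikeElem k h ∧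
      Nontrivial (PrimCohomology k g h n) := by
  by_contra hcon
  have key : ∀ m : ℕ, n ≤ m → ∀ g h : C, IsGroupLikeElem k g → IsGroupLikeElem k h →
      ¬ Nontrivial (PrimCohomology k g h m) := by
    -- For `n = 0` the assumption excludes every grouplike element, so `PCdim` is `-∞`. For positive
    -- `n` the vanishing propagates upwards and bounds `PCdim` by `n - 1`.
    cases n with
    | zero =>
      intro m _ g h hg hh _
      exact hcon ⟨g, g, hg, hg, nontrivial_primCohomology_zero g⟩
    | succ n =>
      rw [← cohomologyVanishes_iff] at hcon
      intro m hm g h hg hh hnt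
      obtain ⟨m, rfl⟩ := Nat.exists_eq_add_of_le' ((Nat.le_add_left 1 n).trans hm)
      exact (cohomologyVanishes_iff m).1 (hcon.of_le hC (by omega)) ⟨g, h, hg, hh, hnt⟩
  cases n with
  | zero =>
    have : PCdim k C ≤ ⊥ := PCdim_le fun m g h hg hh hnt =>
      absurd hnt (key m (Nat.zero_le m) g h hg hh)
    have h2 := hn.trans this
    simp at h2
  | succ n =>
    have : PCdim k C ≤ (n : ℕ) := PCdim_le fun m g h hg hh hnt => by
      have : ¬ n + 1 ≤ m := fun hm => key m hm g h hg hh hnt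
      exact_mod_cast (show m ≤ n by omega)
    have h2 := hn.trans this
    have h3 : n + 1 ≤ n := by exact_mod_cast h2
    omega

end Dimension

/-! ### Projective dimension and resolutions -/

section Resolution

universe w

variable {A : Type w} [Ring A]

open CategoryTheory

theorem hasProjectiveDimensionLT_range_iff {P N : Type w} [AddCommGroup P] [Module A P]
    [AddCommGroup N] [Module A N] [Module.Projective A P] (f : P →ₗ[A] N) (n : ℕ) :
    HasProjectiveDimensionLT (ModuleCat.of A (LinearMap.range f)) (n + 2) ↔
      HasProjectiveDimensionLT (ModuleCat.of A (LinearMap.ker f)) (n + 1) := by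
  have h := LinearMap.shortExact_shortComplexKer (f := f.rangeRestrict) f.surjective_rangeRestrict
  have h2 := h.hasProjectiveDimensionLT_X₃_iff n
    ((IsProjective.iff_projective P).mp inferInstance)
  rw [← LinearMap.ker_rangeRestrict f]
  exact h2

variable {X : ℕ → ModuleCat.{w} A} {d : ∀ i, X (i + 1) →ₗ[A] X i}

/-- Repeated dimension shifting. `X 0` is the resolved module and `d 0` the augmentation, so the
range of `d n` is the `n`th syzygy, with the module itself for `n = 0`. -/
theorem hasProjectiveDimensionLT_iff_of_resolution (hX : ∀ i, Module.Projective A (X (i + 1)))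
    (h0 : Function.Surjective (d 0))
    (hd : ∀ i, LinearMap.ker (d i) = LinearMap.range (d (i + 1))) (n : ℕ) :
    HasProjectiveDimensionLT (X 0) (n + 1) ↔ Module.Projective A (LinearMap.range (d n)) := by
  have key : ∀ n i, HasProjectiveDimensionLT (X 0) (n + i + 1) ↔
      HasProjectiveDimensionLT (ModuleCat.of A (LinearMap.range (d i))) (n + 1) := by
    intro n i
    induction i generalizing n with
    | zero =>
      have e : ModuleCat.of A (LinearMap.range (d 0)) ≅ X 0 :=
        (((LinearEquiv.ofEq _ _ (LinearMap.range_eq_top.mpr h0)).trans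
          (Submodule.topEquiv : (⊤ : Submodule A (X 0)) ≃ₗ[A] X 0)).toModuleIso)
      exact ⟨fun _ => hasProjectiveDimensionLT_of_iso e.symm _,
        fun _ => hasProjectiveDimensionLT_of_iso e _⟩
    | succ i ih =>
      rw [show n + (i + 1) + 1 = (n + 1) + i + 1 by ring, ih (n + 1),
        hasProjectiveDimensionLT_range_iff, hd i]
  have h1 := key 0 n
  rw [zero_add] at h1
  rw [IsProjective.iff_projective, projective_iff_hasProjectiveDimensionLT_one, h1]

/-- The map `id - σ` kills the range of `d (n + 1)`, which is the kernel of `d n`, so it descends to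
a section of `X (n + 1)` onto the range of `d n`. The syzygy is then a direct summand of a
projective module. -/
theorem hasProjectiveDimensionLT_of_homotopy (hX : ∀ i, Module.Projective A (X (i + 1)))
    (h0 : Function.Surjective (d 0))
    (hd : ∀ i, LinearMap.ker (d i) = LinearMap.range (d (i + 1))) {n : ℕ}
    (σ : X (n + 1) →ₗ[A] X (n + 1)) (hσ : ∀ x, d n (σ x) = 0)
    (hσd : ∀ x, σ (d (n + 1) x) = d (n + 1) x) :
    HasProjectiveDimensionLT (X 0) (n + 1) := by
  rw [hasProjectiveDimensionLT_iff_of_resolution hX h0 hd]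
  have hker : LinearMap.ker (d n) ≤ LinearMap.ker (LinearMap.id - σ) := by
    rw [hd n]
    rintro _ ⟨x, rfl⟩
    simp [hσd]
  let τ : LinearMap.range (d n) →ₗ[A] X (n + 1) :=
    (LinearMap.ker (d n)).liftQ (LinearMap.id - σ) hker ∘ₗ
      (d n).quotKerEquivRange.symm.toLinearMap
  have hτ : ∀ x, τ ⟨d n x, x, rfl⟩ = x - σ x := by
    intro x
    have : (d n).quotKerEquivRange.symm ⟨d n x, x, rfl⟩ = (LinearMap.ker (d n)).mkQ x := by
      rw [LinearEquiv.symm_apply_eq]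
      rfl
    simp [τ, this]
  have := hX n
  refine Module.Projective.of_split τ (d n).rangeRestrict ?_
  ext ⟨_, x, rfl⟩
  simp [hτ, hσ]

/-- The vanishing of `Ext` in degree `m + 1`, made explicit: the syzygy is projective, so `X (m +
1)` retracts onto the range of `d (m + 1)`, on which `ζ` induces a map that can be composed with the
retraction. -/
theorem exists_comp_eq_of_hasProjectiveDimensionLT (hX : ∀ i, Module.Projective A (X (i + 1)))
    (h0 : Function.Surjective (d 0))
    (hd : ∀ i, LinearMap.ker (d i) = LinearMap.range (d (i + 1))) {m : ℕ}
    (hpd : HasProjectiveDimensionLT (X 0) (m + 1)) {L : Type*} [AddCommGroup L] [Module A L]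
    (ζ : X (m + 2) →ₗ[A] L) (hζ : ∀ x, ζ (d (m + 2) x) = 0) :
    ∃ η : X (m + 1) →ₗ[A] L, ∀ x, ζ x = η (d (m + 1) x) := by
  rw [hasProjectiveDimensionLT_iff_of_resolution hX h0 hd] at hpd
  obtain ⟨s, hs⟩ := Module.projective_lifting_property (d m).rangeRestrict LinearMap.id
    (d m).surjective_rangeRestrict
  have hs' : ∀ x, d m (s ((d m).rangeRestrict x)) = d m x := fun x =>
    congrArg Subtype.val (LinearMap.congr_fun hs ((d m).rangeRestrict x))
  let p : X (m + 1) →ₗ[A] LinearMap.range (d (m + 1)) :=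
    (LinearMap.id - s ∘ₗ (d m).rangeRestrict).codRestrict _ fun x => by
      rw [← hd m]
      simp [hs']
  have hker : LinearMap.ker (d (m + 1)) ≤ LinearMap.ker ζ := by
    rw [hd (m + 1)]
    rintro _ ⟨x, rfl⟩
    exact hζ x
  refine ⟨(LinearMap.ker (d (m + 1))).liftQ ζ hker ∘ₗ
      (d (m + 1)).quotKerEquivRange.symm.toLinearMap ∘ₗ p, fun x => ?_⟩
  have h1 : p (d (m + 1) x) = ⟨d (m + 1) x, x, rfl⟩ := by
    have h2 : (d m).rangeRestrict (d (m + 1) x) = 0 := by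
      have : d (m + 1) x ∈ LinearMap.ker (d m) := by rw [hd m]; exact ⟨x, rfl⟩
      exact Subtype.ext this
    apply Subtype.ext
    simp [p, h2]
  have h3 : (d (m + 1)).quotKerEquivRange.symm ⟨d (m + 1) x, x, rfl⟩ =
      (LinearMap.ker (d (m + 1))).mkQ x := by
    rw [LinearEquiv.symm_apply_eq]
    rfl
  simp [h1, h3]

end Resolution

/-! ### The bar differential of an algebra -/

section BarDifferential

variable (k : Type*) (A : Type*) [Field k] [Ring A] [Algebra k A]

/-- Multiplication of the first two factors. -/
def mulFirst (m : ℕ) : ⨂[k]^(m + 2) A →ₗ[k] ⨂[k]^(m + 1) A :=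
  (consEquiv k A m).toLinearMap ∘ₗ (LinearMap.mul' k A).rTensor (⨂[k]^m A) ∘ₗ
    (TensorProduct.assoc k A A (⨂[k]^m A)).symm.toLinearMap ∘ₗ
    (consEquiv k A m).symm.toLinearMap.lTensor A ∘ₗ (consEquiv k A (m + 1)).symm.toLinearMap

/-- Multiplication of the last two factors. -/
def mulLast (m : ℕ) : ⨂[k]^(m + 2) A →ₗ[k] ⨂[k]^(m + 1) A :=
  (snocEquiv k A m).toLinearMap ∘ₗ (LinearMap.mul' k A).lTensor (⨂[k]^m A) ∘ₗ
    (TensorProduct.assoc k (⨂[k]^m A) A A).toLinearMap ∘ₗ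
    (snocEquiv k A m).symm.toLinearMap.rTensor A ∘ₗ (snocEquiv k A (m + 1)).symm.toLinearMap

variable {k A} in
@[simp]
theorem mulFirst_cons (m : ℕ) (a b : A) (w : ⨂[k]^m A) :
    mulFirst k A m (consEquiv k A (m + 1) (a ⊗ₜ consEquiv k A m (b ⊗ₜ w))) =
      consEquiv k A m ((a * b) ⊗ₜ w) := by
  simp [mulFirst]

variable {k A} in
@[simp]
theorem mulLast_snoc (m : ℕ) (a b : A) (w : ⨂[k]^m A) :
    mulLast k A m (snocEquiv k A (m + 1) (snocEquiv k A m (w ⊗ₜ a) ⊗ₜ b)) =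
      snocEquiv k A m (w ⊗ₜ (a * b)) := by
  simp [mulLast]

variable {k A} in
theorem ext_cons_cons {W : Type*} [AddCommGroup W] [Module k W] {n : ℕ}
    {f g : ⨂[k]^(n + 2) A →ₗ[k] W}
    (h : ∀ a b w, f (consEquiv k A (n + 1) (a ⊗ₜ consEquiv k A n (b ⊗ₜ w))) =
      g (consEquiv k A (n + 1) (a ⊗ₜ consEquiv k A n (b ⊗ₜ w)))) : f = g :=
  ext_cons fun a x => by
    have : f ∘ₗ (consEquiv k A (n + 1)).toLinearMap ∘ₗ TensorProduct.mk k A _ a =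
        g ∘ₗ (consEquiv k A (n + 1)).toLinearMap ∘ₗ TensorProduct.mk k A _ a :=
      ext_cons fun b w => h a b w
    exact LinearMap.congr_fun this x

variable {k A} in
theorem ext_snoc_snoc {W : Type*} [AddCommGroup W] [Module k W] {n : ℕ}
    {f g : ⨂[k]^(n + 2) A →ₗ[k] W}
    (h : ∀ w a b, f (snocEquiv k A (n + 1) (snocEquiv k A n (w ⊗ₜ a) ⊗ₜ b)) =
      g (snocEquiv k A (n + 1) (snocEquiv k A n (w ⊗ₜ a) ⊗ₜ b))) : f = g :=
  ext_snoc fun x b => by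
    have : f ∘ₗ (snocEquiv k A (n + 1)).toLinearMap ∘ₗ (TensorProduct.mk k _ A).flip b =
        g ∘ₗ (snocEquiv k A (n + 1)).toLinearMap ∘ₗ (TensorProduct.mk k _ A).flip b :=
      ext_snoc fun w a => h w a b
    exact LinearMap.congr_fun this x

variable {k A} in
theorem mulFirst_cons_snoc (m : ℕ) (a b : A) (w : ⨂[k]^(m + 1) A) :
    mulFirst k A (m + 1) (consEquiv k A (m + 2) (a ⊗ₜ snocEquiv k A (m + 1) (w ⊗ₜ b))) =
      snocEquiv k A (m + 1) (mulFirst k A m (consEquiv k A (m + 1) (a ⊗ₜ w)) ⊗ₜ b) := by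
  have : mulFirst k A (m + 1) ∘ₗ (consEquiv k A (m + 2)).toLinearMap ∘ₗ
      TensorProduct.mk k A _ a ∘ₗ (snocEquiv k A (m + 1)).toLinearMap ∘ₗ
      (TensorProduct.mk k _ A).flip b = (snocEquiv k A (m + 1)).toLinearMap ∘ₗ
      (TensorProduct.mk k _ A).flip b ∘ₗ mulFirst k A m ∘ₗ (consEquiv k A (m + 1)).toLinearMap ∘ₗ
      TensorProduct.mk k A _ a :=
    ext_cons fun c x => by simp [snoc_cons]
  exact LinearMap.congr_fun this w

theorem rWh_mulFirst (m : ℕ) : rWh (mulFirst k A m) = mulFirst k A (m + 1) := by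
  refine ext_snoc fun w b => ?_
  have : rWh (mulFirst k A m) ∘ₗ (snocEquiv k A (m + 2)).toLinearMap ∘ₗ
      (TensorProduct.mk k _ A).flip b = mulFirst k A (m + 1) ∘ₗ
      (snocEquiv k A (m + 2)).toLinearMap ∘ₗ (TensorProduct.mk k _ A).flip b :=
    ext_cons fun a x => by
      change rWh (mulFirst k A m) (snocEquiv k A (m + 2) (consEquiv k A (m + 1) (a ⊗ₜ x) ⊗ₜ b)) =
        mulFirst k A (m + 1) (snocEquiv k A (m + 2) (consEquiv k A (m + 1) (a ⊗ₜ x) ⊗ₜ b))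
      rw [rWh_snoc, snoc_cons, mulFirst_cons_snoc]
  exact LinearMap.congr_fun this w

theorem lWh_mulLast (m : ℕ) : lWh (mulLast k A m) = mulLast k A (m + 1) := by
  refine ext_cons fun a x => ?_
  have : lWh (mulLast k A m) ∘ₗ (consEquiv k A (m + 2)).toLinearMap ∘ₗ
      TensorProduct.mk k A _ a = mulLast k A (m + 1) ∘ₗ
      (consEquiv k A (m + 2)).toLinearMap ∘ₗ TensorProduct.mk k A _ a :=
    ext_snoc_snoc fun w b c => by
      change lWh (mulLast k A m) (consEquiv k A (m + 2)
          (a ⊗ₜ snocEquiv k A (m + 1) (snocEquiv k A m (w ⊗ₜ b) ⊗ₜ c))) =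
        mulLast k A (m + 1) (consEquiv k A (m + 2)
          (a ⊗ₜ snocEquiv k A (m + 1) (snocEquiv k A m (w ⊗ₜ b) ⊗ₜ c)))
      rw [lWh_cons, mulLast_snoc, ← snoc_cons, ← snoc_cons, ← snoc_cons, mulLast_snoc]
  exact LinearMap.congr_fun this x

theorem mulFirst_zero : mulFirst k A 0 = mulLast k A 0 := by
  refine ext_cons_cons fun a b w => ?_
  rw [mulFirst_cons, cons_zero_eq_snoc, cons_zero_eq_snoc, ← snoc_cons, cons_zero_eq_snoc,
    mulLast_snoc]

/-- The part of the bar differential that multiplies adjacent factors: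
`a₀ ⊗ ⋯ ⊗ aₙ ↦ ∑ (-1)ⁱ a₀ ⊗ ⋯ ⊗ aᵢaᵢ₊₁ ⊗ ⋯ ⊗ aₙ`. -/
def barDiff : (n : ℕ) → (⨂[k]^(n + 1) A →ₗ[k] ⨂[k]^n A)
  | 0 => 0
  | n + 1 => mulFirst k A n - lWh (barDiff n)

theorem barDiff_zero : barDiff k A 0 = 0 := rfl

theorem barDiff_succ (n : ℕ) : barDiff k A (n + 1) = mulFirst k A n - lWh (barDiff k A n) := rfl

theorem barDiff_succ' (n : ℕ) : barDiff k A (n + 1) =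
    rWh (barDiff k A n) + (-1 : k) ^ n • mulLast k A n := by
  induction n with
  | zero => simp [barDiff_succ, barDiff_zero, mulFirst_zero, rWh_zero, lWh_zero]
  | succ n ih =>
    have h1 : rWh (barDiff k A (n + 1)) = mulFirst k A (n + 1) - rWh (lWh (barDiff k A n)) := by
      rw [barDiff_succ k A n, rWh_sub, rWh_mulFirst]
    rw [barDiff_succ k A (n + 1), h1, ih, lWh_add, lWh_smul, lWh_mulLast, lWh_rWh, pow_succ,
      mul_neg_one, neg_smul_hom]
    abel

end BarDifferential

/-! ### The bar resolution of a module -/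

section BarResolution

variable {k : Type*} {A : Type*} (M : Type*) [Field k] [Ring A] [Algebra k A] [AddCommGroup M]
  [Module k M]

/-- The `A`-linear extension of a `k`-linear map to the free module. -/
def freeLift {N P : Type*} [AddCommGroup N] [Module k N] [AddCommGroup P] [Module k P] [Module A P]
    [IsScalarTower k A P] (f : N →ₗ[k] P) : A ⊗[k] N →ₗ[A] P :=
  TensorProduct.AlgebraTensorModule.lift (LinearMap.toSpanSingleton A (N →ₗ[k] P) f)

@[simp]
theorem freeLift_tmul {N P : Type*} [AddCommGroup N] [Module k N] [AddCommGroup P] [Module k P]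
    [Module A P] [IsScalarTower k A P] (f : N →ₗ[k] P) (a : A) (x : N) :
    freeLift f (a ⊗ₜ[k] x) = a • f x := rfl

theorem freeLift_ext {N P : Type*} [AddCommGroup N] [Module k N] [AddCommGroup P] [Module A P]
    {f g : A ⊗[k] N →ₗ[A] P} (h : ∀ x, f (1 ⊗ₜ x) = g (1 ⊗ₜ x)) : f = g := by
  refine LinearMap.ext fun x => ?_
  induction x with
  | zero => simp
  | add x y hx hy => rw [map_add, map_add, hx, hy]
  | tmul a x =>
    rw [show a ⊗ₜ[k] x = a • ((1 : A) ⊗ₜ[k] x) by simp [TensorProduct.smul_tmul'], map_smul,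
      map_smul, h]

variable (k A)

/-- `cons` with coefficients. -/
def consCoeff (i : ℕ) : A ⊗[k] ((⨂[k]^i A) ⊗[k] M) ≃ₗ[k] (⨂[k]^(i + 1) A) ⊗[k] M :=
  (TensorProduct.assoc k A (⨂[k]^i A) M).symm.trans
    (TensorProduct.congr (consEquiv k A i) (LinearEquiv.refl k M))

variable {k A M} in
@[simp]
theorem consCoeff_tmul (i : ℕ) (a : A) (w : ⨂[k]^i A) (m : M) :
    consCoeff k A M i (a ⊗ₜ (w ⊗ₜ m)) = consEquiv k A i (a ⊗ₜ w) ⊗ₜ m := rfl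

variable {k A} in
/-- Left multiplication by `a` on `A^{⊗ (i+1)} ⊗ M`. -/
def mulCoeff (i : ℕ) (a : A) : (⨂[k]^(i + 1) A) ⊗[k] M →ₗ[k] (⨂[k]^(i + 1) A) ⊗[k] M :=
  (mulFirst k A i ∘ₗ (consEquiv k A (i + 1)).toLinearMap ∘ₗ TensorProduct.mk k A _ a).rTensor M

variable {k A M} in
theorem mulCoeff_consCoeff (i : ℕ) (a : A) (x : A ⊗[k] ((⨂[k]^i A) ⊗[k] M)) :
    mulCoeff M i a (consCoeff k A M i x) = consCoeff k A M i (a • x) := by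
  induction x with
  | zero => simp
  | add x y hx hy => simp only [map_add, smul_add, hx, hy]
  | tmul b t =>
    induction t with
    | zero => simp
    | add x y hx hy => simp only [TensorProduct.tmul_add, map_add, smul_add, hx, hy]
    | tmul w m => simp [mulCoeff, TensorProduct.smul_tmul']

variable {k A M}

theorem ext_snoc_coeff {W : Type*} [AddCommGroup W] [Module k W] {i : ℕ}
    {f g : (⨂[k]^(i + 1) A) ⊗[k] M →ₗ[k] W}
    (h : ∀ w a m, f (snocEquiv k A i (w ⊗ₜ a) ⊗ₜ m) = g (snocEquiv k A i (w ⊗ₜ a) ⊗ₜ m)) :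
    f = g :=
  TensorProduct.ext' fun x m => by
    have : f ∘ₗ (TensorProduct.mk k _ M).flip m = g ∘ₗ (TensorProduct.mk k _ M).flip m :=
      ext_snoc fun w a => h w a m
    exact LinearMap.congr_fun this x

variable [Module A M] [IsScalarTower k A M]

variable (k A M) in
/-- The action of the last factor on the coefficients. -/
def actCoeff (i : ℕ) : (⨂[k]^(i + 1) A) ⊗[k] M →ₗ[k] (⨂[k]^i A) ⊗[k] M :=
  (TensorProduct.lift (Algebra.lsmul k k M).toLinearMap).lTensor (⨂[k]^i A) ∘ₗ
    (TensorProduct.assoc k (⨂[k]^i A) A M).toLinearMap ∘ₗ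
    (snocEquiv k A i).symm.toLinearMap.rTensor M

@[simp]
theorem actCoeff_tmul (i : ℕ) (w : ⨂[k]^i A) (a : A) (m : M) :
    actCoeff k A M i (snocEquiv k A i (w ⊗ₜ a) ⊗ₜ m) = w ⊗ₜ (a • m) := by
  simp [actCoeff]

theorem actCoeff_consCoeff (i : ℕ) (a : A) (t : (⨂[k]^(i + 1) A) ⊗[k] M) :
    actCoeff k A M (i + 1) (consCoeff k A M (i + 1) (a ⊗ₜ t)) =
      consCoeff k A M i (a ⊗ₜ actCoeff k A M i t) := by
  have : actCoeff k A M (i + 1) ∘ₗ (consCoeff k A M (i + 1)).toLinearMap ∘ₗ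
      TensorProduct.mk k A _ a = (consCoeff k A M i).toLinearMap ∘ₗ
      TensorProduct.mk k A _ a ∘ₗ actCoeff k A M i :=
    ext_snoc_coeff fun w b m => by
      simp [← snoc_cons]
  exact LinearMap.congr_fun this t

theorem actCoeff_mulCoeff (i : ℕ) (a : A) (t : (⨂[k]^(i + 2) A) ⊗[k] M) :
    actCoeff k A M (i + 1) (mulCoeff M (i + 1) a t) = mulCoeff M i a (actCoeff k A M (i + 1) t) := by
  have : actCoeff k A M (i + 1) ∘ₗ mulCoeff M (i + 1) a =
      mulCoeff M i a ∘ₗ actCoeff k A M (i + 1) :=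
    ext_snoc_coeff fun w b m => by
      simp [mulCoeff, mulFirst_cons_snoc]
  exact LinearMap.congr_fun this t

theorem actCoeff_mulLast (i : ℕ) (t : (⨂[k]^(i + 2) A) ⊗[k] M) :
    actCoeff k A M i ((mulLast k A i).rTensor M t) =
      actCoeff k A M i (actCoeff k A M (i + 1) t) := by
  have : actCoeff k A M i ∘ₗ (mulLast k A i).rTensor M =
      actCoeff k A M i ∘ₗ actCoeff k A M (i + 1) :=
    TensorProduct.ext' fun x m => by
      have : actCoeff k A M i ∘ₗ (mulLast k A i).rTensor M ∘ₗ (TensorProduct.mk k _ M).flip m =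
          actCoeff k A M i ∘ₗ actCoeff k A M (i + 1) ∘ₗ (TensorProduct.mk k _ M).flip m :=
        ext_snoc_snoc fun w a b => by
          simp [mul_smul]
      exact LinearMap.congr_fun this x
  exact LinearMap.congr_fun this t

theorem actCoeff_rWh {i j : ℕ} (f : ⨂[k]^i A →ₗ[k] ⨂[k]^j A) (t : (⨂[k]^(i + 1) A) ⊗[k] M) :
    actCoeff k A M j ((rWh f).rTensor M t) = f.rTensor M (actCoeff k A M i t) := by
  have : actCoeff k A M j ∘ₗ (rWh f).rTensor M = f.rTensor M ∘ₗ actCoeff k A M i :=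
    ext_snoc_coeff fun w b m => by simp
  exact LinearMap.congr_fun this t

variable (k A M)

/-- The differential of the bar complex of `M`, up to the identification `consCoeff`. -/
def barCoeff (i : ℕ) : (⨂[k]^(i + 1) A) ⊗[k] M →ₗ[k] (⨂[k]^i A) ⊗[k] M :=
  (barDiff k A i).rTensor M + (-1 : k) ^ i • actCoeff k A M i

variable {k A M}

theorem barCoeff_apply (i : ℕ) (t : (⨂[k]^(i + 1) A) ⊗[k] M) : barCoeff k A M i t =
    (barDiff k A i).rTensor M t + (-1 : k) ^ i • actCoeff k A M i t := rfl

theorem barCoeff_zero (t : (⨂[k]^1 A) ⊗[k] M) : barCoeff k A M 0 t = actCoeff k A M 0 t := by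
  simp [barCoeff, barDiff_zero]

theorem barCoeff_consCoeff (i : ℕ) (a : A) (t : (⨂[k]^(i + 1) A) ⊗[k] M) :
    barCoeff k A M (i + 1) (consCoeff k A M (i + 1) (a ⊗ₜ t)) =
      mulCoeff M i a t - consCoeff k A M i (a ⊗ₜ barCoeff k A M i t) := by
  have h : (barDiff k A (i + 1)).rTensor M (consCoeff k A M (i + 1) (a ⊗ₜ t)) =
      mulCoeff M i a t - consCoeff k A M i (a ⊗ₜ (barDiff k A i).rTensor M t) := by
    induction t with
    | zero => simp
    | add x y hx hy =>
      simp only [TensorProduct.tmul_add, map_add, hx, hy]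
      abel
    | tmul w m => simp [barDiff_succ, mulCoeff]
  rw [barCoeff_apply, h, actCoeff_consCoeff, barCoeff_apply, TensorProduct.tmul_add, map_add,
    TensorProduct.tmul_smul, map_smul, pow_succ, mul_neg_one]
  have h' : ∀ u : (⨂[k]^(i + 1) A) ⊗[k] M, (-(-1 : k) ^ i) • u = -((-1 : k) ^ i • u) :=
    fun u => neg_smul _ u
  rw [h']
  abel

/-- Letting the last factor act on `M` is the passage from `A^{⊗ (i+2)} ⊗ M` to its quotient over
`A`; the product of the last two factors turns into the action. This relates the bar complex of `M`
to that of `A`. -/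
theorem barCoeff_actCoeff (i : ℕ) (t : (⨂[k]^(i + 2) A) ⊗[k] M) :
    barCoeff k A M i (actCoeff k A M (i + 1) t) =
      actCoeff k A M i ((barDiff k A (i + 1)).rTensor M t) := by
  rw [barCoeff_apply, barDiff_succ', LinearMap.rTensor_add, LinearMap.rTensor_smul,
    LinearMap.add_apply, LinearMap.smul_apply, map_add, map_smul, actCoeff_rWh, actCoeff_mulLast]

end BarResolution

/-! ### Exactness of the bar resolution and its splitting by bimodule maps -/

section BarComplex

open CategoryTheory

universe u v

variable {k : Type u} {A : Type (max u v)} {M : Type (max u v)} [Field k] [Ring A] [Algebra k A]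
  [AddCommGroup M] [Module k M]

variable (k A M) in
/-- `A^{⊗ 0} ⊗ M ≃ M`. -/
def zeroCoeff : (⨂[k]^0 A) ⊗[k] M ≃ₗ[k] M :=
  (TensorProduct.congr (PiTensorProduct.isEmptyEquiv (Fin 0)) (LinearEquiv.refl k M)).trans
    (TensorProduct.lid k M)

theorem mulLast_snoc_one (n : ℕ) (w : ⨂[k]^(n + 1) A) :
    mulLast k A n (snocEquiv k A (n + 1) (w ⊗ₜ (1 : A))) = w := by
  obtain ⟨w, rfl⟩ := (snocEquiv k A n).surjective w
  induction w with
  | zero => simp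
  | add x y hx hy => simp only [map_add, TensorProduct.add_tmul, hx, hy]
  | tmul w a => rw [mulLast_snoc, mul_one]

variable [Module A M]

variable (k A M) in
/-- The modules of the bar resolution of `M`, with `M` itself in degree `0`. -/
def barObj : ℕ → ModuleCat.{max u v} A
  | 0 => ModuleCat.of A M
  | i + 1 => ModuleCat.of A (A ⊗[k] ((⨂[k]^i A) ⊗[k] M))

variable (k A M) in
theorem projective_barObj (i : ℕ) : Module.Projective A (barObj k A M (i + 1)) :=
  inferInstanceAs (Module.Projective A (A ⊗[k] ((⨂[k]^i A) ⊗[k] M)))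

variable [IsScalarTower k A M]

variable (k A M) in
/-- The augmentation of the bar resolution of `M`. -/
def barAug : A ⊗[k] ((⨂[k]^0 A) ⊗[k] M) →ₗ[A] M :=
  freeLift (zeroCoeff k A M).toLinearMap

variable (k A M) in
/-- The differential of the bar resolution of `M`. -/
def barD (i : ℕ) : A ⊗[k] ((⨂[k]^(i + 1) A) ⊗[k] M) →ₗ[A] A ⊗[k] ((⨂[k]^i A) ⊗[k] M) :=
  freeLift ((consCoeff k A M i).symm.toLinearMap -
    TensorProduct.mk k A _ 1 ∘ₗ barCoeff k A M i)

theorem barAug_eq (x : A ⊗[k] ((⨂[k]^0 A) ⊗[k] M)) : barAug k A M x =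
    zeroCoeff k A M (barCoeff k A M 0 (consCoeff k A M 0 x)) := by
  rw [barCoeff_zero]
  induction x with
  | zero => simp
  | add x y hx hy => simp only [map_add, hx, hy]
  | tmul a t =>
    rw [barAug, freeLift_tmul]
    induction t with
    | zero => simp
    | add x y hx hy => simp only [TensorProduct.tmul_add, map_add, smul_add, hx, hy]
    | tmul w m =>
      rw [consCoeff_tmul, cons_zero_eq_snoc, actCoeff_tmul]
      simp only [zeroCoeff, LinearEquiv.trans_apply, LinearEquiv.coe_coe, TensorProduct.congr_tmul,
        LinearEquiv.refl_apply, TensorProduct.lid_tmul]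
      exact smul_comm _ _ _

theorem consCoeff_barD (i : ℕ) (x : A ⊗[k] ((⨂[k]^(i + 1) A) ⊗[k] M)) :
    consCoeff k A M i (barD k A M i x) =
      barCoeff k A M (i + 1) (consCoeff k A M (i + 1) x) := by
  induction x with
  | zero => simp
  | add x y hx hy => simp only [map_add, hx, hy]
  | tmul a t =>
    rw [barCoeff_consCoeff, barD, freeLift_tmul, ← mulCoeff_consCoeff]
    simp only [LinearMap.sub_apply, LinearEquiv.coe_coe, map_sub, LinearEquiv.apply_symm_apply,
      mulCoeff_consCoeff, LinearMap.comp_apply, TensorProduct.mk_apply, TensorProduct.smul_tmul',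
      smul_eq_mul, mul_one]

/-- Inserting `1` in front is a `k`-linear contracting homotopy. The identity gives exactness and
also drives the induction proving that the differentials compose to zero. -/
theorem barD_one_tmul (i : ℕ) (x : A ⊗[k] ((⨂[k]^i A) ⊗[k] M)) :
    barD k A M i (1 ⊗ₜ consCoeff k A M i x) =
      x - 1 ⊗ₜ barCoeff k A M i (consCoeff k A M i x) := by
  simp [barD]

theorem barAug_eq_zero_iff (x : A ⊗[k] ((⨂[k]^0 A) ⊗[k] M)) :
    barAug k A M x = 0 ↔ barCoeff k A M 0 (consCoeff k A M 0 x) = 0 := by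
  rw [barAug_eq, LinearEquiv.map_eq_zero_iff]

theorem barD_eq_zero_iff (i : ℕ) (x : A ⊗[k] ((⨂[k]^(i + 1) A) ⊗[k] M)) :
    barD k A M i x = 0 ↔ barCoeff k A M (i + 1) (consCoeff k A M (i + 1) x) = 0 := by
  rw [← consCoeff_barD, LinearEquiv.map_eq_zero_iff]

theorem barCoeff_consCoeff_barD (i : ℕ) (x : A ⊗[k] ((⨂[k]^(i + 1) A) ⊗[k] M)) :
    barCoeff k A M i (consCoeff k A M i (barD k A M i x)) = 0 := by
  induction i with
  | zero =>
    rw [← barAug_eq_zero_iff]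
    suffices h : barAug k A M ∘ₗ barD k A M 0 = 0 from LinearMap.congr_fun h x
    refine freeLift_ext fun t => ?_
    obtain ⟨x, rfl⟩ := (consCoeff k A M 0).surjective t
    rw [LinearMap.comp_apply, barD_one_tmul, map_sub, barAug_eq x, barAug, freeLift_tmul, one_smul]
    simp
  | succ i ih =>
    rw [← barD_eq_zero_iff]
    suffices h : barD k A M i ∘ₗ barD k A M (i + 1) = 0 from LinearMap.congr_fun h x
    refine freeLift_ext fun t => ?_
    obtain ⟨x, rfl⟩ := (consCoeff k A M (i + 1)).surjective t
    rw [LinearMap.comp_apply, barD_one_tmul, map_sub, ← consCoeff_barD, barD_one_tmul, ih x]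
    simp

theorem barAug_eq_zero_iff_mem_range (x : A ⊗[k] ((⨂[k]^0 A) ⊗[k] M)) :
    barAug k A M x = 0 ↔ x ∈ LinearMap.range (barD k A M 0) := by
  rw [barAug_eq_zero_iff]
  refine ⟨fun h => ⟨1 ⊗ₜ consCoeff k A M 0 x, ?_⟩, ?_⟩
  · rw [barD_one_tmul, h, TensorProduct.tmul_zero, sub_zero]
  · rintro ⟨y, rfl⟩
    exact barCoeff_consCoeff_barD 0 y

theorem barD_eq_zero_iff_mem_range (i : ℕ) (x : A ⊗[k] ((⨂[k]^(i + 1) A) ⊗[k] M)) :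
    barD k A M i x = 0 ↔ x ∈ LinearMap.range (barD k A M (i + 1)) := by
  rw [barD_eq_zero_iff]
  refine ⟨fun h => ⟨1 ⊗ₜ consCoeff k A M (i + 1) x, ?_⟩, ?_⟩
  · rw [barD_one_tmul, h, TensorProduct.tmul_zero, sub_zero]
  · rintro ⟨y, rfl⟩
    exact barCoeff_consCoeff_barD (i + 1) y

variable (k A M) in
/-- The differentials of the bar resolution of `M`, with the augmentation in degree `0`. -/
def barMap : ∀ i, barObj k A M (i + 1) →ₗ[A] barObj k A M i
  | 0 => barAug k A M
  | i + 1 => barD k A M i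

variable (k A M) in
theorem ker_barMap (i : ℕ) :
    LinearMap.ker (barMap k A M i) = LinearMap.range (barMap k A M (i + 1)) := by
  cases i with
  | zero => exact Submodule.ext fun x => barAug_eq_zero_iff_mem_range x
  | succ i => exact Submodule.ext fun x => barD_eq_zero_iff_mem_range i x

variable (k A M) in
theorem barMap_zero_surjective : Function.Surjective (barMap k A M 0) := fun m =>
  ⟨((1 : A) ⊗ₜ[k] (zeroCoeff k A M).symm m : A ⊗[k] ((⨂[k]^0 A) ⊗[k] M)), by
    change barAug k A M _ = m
    rw [barAug, freeLift_tmul, one_smul]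
    exact LinearEquiv.apply_symm_apply _ _⟩

theorem barMap_eq_zero_of_barCoeff (i : ℕ) (x : A ⊗[k] ((⨂[k]^i A) ⊗[k] M))
    (h : barCoeff k A M i (consCoeff k A M i x) = 0) : barMap k A M i x = 0 := by
  cases i with
  | zero => exact (barAug_eq_zero_iff x).mpr h
  | succ i => exact (barD_eq_zero_iff i x).mpr h

section

variable {n : ℕ} (S : ⨂[k]^(n + 2) A →ₗ[k] ⨂[k]^(n + 2) A)

variable (M) in
/-- The operator on the bar resolution induced by an operator on the tensor powers of `A`. -/
def barCoeffLift : (⨂[k]^(n + 1) A) ⊗[k] M →ₗ[k] (⨂[k]^(n + 1) A) ⊗[k] M :=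
  actCoeff k A M (n + 1) ∘ₗ (S ∘ₗ (snocEquiv k A (n + 1)).toLinearMap ∘ₗ
    (TensorProduct.mk k _ A).flip 1).rTensor M

theorem barCoeffLift_tmul (w : ⨂[k]^(n + 1) A) (m : M) : barCoeffLift M S (w ⊗ₜ m) =
    actCoeff k A M (n + 1) (S (snocEquiv k A (n + 1) (w ⊗ₜ 1)) ⊗ₜ m) := rfl

variable {S}

theorem barCoeffLift_mulCoeff (hS : mulFirst k A (n + 1) ∘ₗ lWh S = S ∘ₗ mulFirst k A (n + 1))
    (a : A) (t : (⨂[k]^(n + 1) A) ⊗[k] M) :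
    barCoeffLift M S (mulCoeff M n a t) = mulCoeff M n a (barCoeffLift M S t) := by
  induction t with
  | zero => simp
  | add x y hx hy => simp only [map_add, hx, hy]
  | tmul w m =>
    rw [barCoeffLift_tmul, ← actCoeff_mulCoeff]
    have h := LinearMap.congr_fun hS
      (consEquiv k A (n + 2) (a ⊗ₜ snocEquiv k A (n + 1) (w ⊗ₜ (1 : A))))
    rw [LinearMap.comp_apply, LinearMap.comp_apply, lWh_cons, mulFirst_cons_snoc] at h
    change _ = actCoeff k A M (n + 1) (mulFirst k A (n + 1) (consEquiv k A (n + 2)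
      (a ⊗ₜ S (snocEquiv k A (n + 1) (w ⊗ₜ 1)))) ⊗ₜ m)
    rw [h]
    rfl

/-- Appending a `1` chooses a representative in the tensor product over `A`. Right linearity of `S`
says that the choice is immaterial, so `barCoeffLift` is `S ⊗_A M`. -/
theorem barCoeffLift_actCoeff (hS : mulLast k A (n + 1) ∘ₗ rWh S = S ∘ₗ mulLast k A (n + 1))
    (t : (⨂[k]^(n + 2) A) ⊗[k] M) :
    barCoeffLift M S (actCoeff k A M (n + 1) t) = actCoeff k A M (n + 1) (S.rTensor M t) := by
  have : barCoeffLift M S ∘ₗ actCoeff k A M (n + 1) = actCoeff k A M (n + 1) ∘ₗ S.rTensor M :=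
    ext_snoc_coeff fun w a m => by
      have h := LinearMap.congr_fun hS
        (snocEquiv k A (n + 2) (snocEquiv k A (n + 1) (w ⊗ₜ (1 : A)) ⊗ₜ a))
      rw [LinearMap.comp_apply, LinearMap.comp_apply, rWh_snoc, mulLast_snoc, one_mul] at h
      rw [LinearMap.comp_apply, LinearMap.comp_apply, LinearMap.rTensor_tmul, ← h, actCoeff_tmul,
        barCoeffLift_tmul, ← LinearMap.rTensor_tmul M (mulLast k A (n + 1)),
        actCoeff_mulLast, actCoeff_tmul]
  exact LinearMap.congr_fun this t

theorem barCoeff_barCoeffLift (hS : barDiff k A (n + 1) ∘ₗ S = 0)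
    (t : (⨂[k]^(n + 1) A) ⊗[k] M) : barCoeff k A M n (barCoeffLift M S t) = 0 := by
  induction t with
  | zero => simp
  | add x y hx hy => rw [map_add, map_add, hx, hy, add_zero]
  | tmul w m =>
    rw [barCoeffLift_tmul, barCoeff_actCoeff, LinearMap.rTensor_tmul, ← LinearMap.comp_apply, hS]
    simp

theorem barCoeffLift_barCoeff (hS : mulLast k A (n + 1) ∘ₗ rWh S = S ∘ₗ mulLast k A (n + 1))
    (hS' : S ∘ₗ barDiff k A (n + 2) = barDiff k A (n + 2)) (t : (⨂[k]^(n + 2) A) ⊗[k] M) :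
    barCoeffLift M S (barCoeff k A M (n + 1) t) = barCoeff k A M (n + 1) t := by
  induction t with
  | zero => simp
  | add x y hx hy => rw [map_add, map_add, hx, hy]
  | tmul w m =>
    have h := LinearMap.congr_fun hS' (snocEquiv k A (n + 2) (w ⊗ₜ (1 : A)))
    have h1 : barDiff k A (n + 2) (snocEquiv k A (n + 2) (w ⊗ₜ (1 : A))) =
        snocEquiv k A (n + 1) (barDiff k A (n + 1) w ⊗ₜ 1) + (-1 : k) ^ (n + 1) • w := by
      rw [barDiff_succ', LinearMap.add_apply, rWh_snoc, LinearMap.smul_apply]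
      rw [mulLast_snoc_one]
    rw [LinearMap.comp_apply, h1, map_add, map_smul] at h
    rw [barCoeff_apply, map_add, map_smul, barCoeffLift_actCoeff hS, LinearMap.rTensor_tmul,
      LinearMap.rTensor_tmul, barCoeffLift_tmul, ← map_smul, ← map_add, TensorProduct.smul_tmul',
      ← TensorProduct.add_tmul, h, TensorProduct.add_tmul, map_add, actCoeff_tmul, one_smul,
      ← TensorProduct.smul_tmul', map_smul]

variable (M) in
/-- The endomorphism of the bar resolution of `M` induced by a bimodule endomorphism of a tensor
power of `A`. -/
def barLift (hS : mulFirst k A (n + 1) ∘ₗ lWh S = S ∘ₗ mulFirst k A (n + 1)) :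
    A ⊗[k] ((⨂[k]^n A) ⊗[k] M) →ₗ[A] A ⊗[k] ((⨂[k]^n A) ⊗[k] M) where
  toFun x := (consCoeff k A M n).symm (barCoeffLift M S (consCoeff k A M n x))
  map_add' x y := by rw [map_add, map_add, map_add]
  map_smul' a x := by
    rw [← mulCoeff_consCoeff, barCoeffLift_mulCoeff hS, LinearEquiv.symm_apply_eq,
      RingHom.id_apply, ← mulCoeff_consCoeff, LinearEquiv.apply_symm_apply]

theorem consCoeff_barLift (hS : mulFirst k A (n + 1) ∘ₗ lWh S = S ∘ₗ mulFirst k A (n + 1))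
    (x : A ⊗[k] ((⨂[k]^n A) ⊗[k] M)) :
    consCoeff k A M n (barLift M hS x) = barCoeffLift M S (consCoeff k A M n x) :=
  LinearEquiv.apply_symm_apply _ _

variable (M) in
-- The hypotheses make `S` a bimodule map with values in the cycles that fixes the boundaries. This
-- is preserved by `- ⊗_A M`, and the result splits the bar resolution of `M`.
theorem hasProjectiveDimensionLT_of_bimodule_homotopy
    (h₁ : mulFirst k A (n + 1) ∘ₗ lWh S = S ∘ₗ mulFirst k A (n + 1))
    (h₂ : mulLast k A (n + 1) ∘ₗ rWh S = S ∘ₗ mulLast k A (n + 1))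
    (h₃ : barDiff k A (n + 1) ∘ₗ S = 0) (h₄ : S ∘ₗ barDiff k A (n + 2) = barDiff k A (n + 2)) :
    HasProjectiveDimensionLT (ModuleCat.of A M) (n + 1) := by
  refine hasProjectiveDimensionLT_of_homotopy (X := barObj k A M) (projective_barObj k A M)
    (barMap_zero_surjective k A M) (ker_barMap k A M) (barLift M h₁) (fun x => ?_) fun x => ?_
  · have h : ∀ x, barCoeff k A M n (consCoeff k A M n (barLift M h₁ x)) = 0 := fun x => by
      rw [consCoeff_barLift, barCoeff_barCoeffLift h₃]
    exact barMap_eq_zero_of_barCoeff n _ (h x)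
  · have h : ∀ x, barLift M h₁ (barD k A M n x) = barD k A M n x := fun x => by
      apply (consCoeff k A M n).injective
      rw [consCoeff_barLift, consCoeff_barD, barCoeffLift_barCoeff h₂ h₄]
    exact h x

end

variable {L : Type*} [AddCommGroup L] [Module k L] [Module A L] [IsScalarTower k A L]

/-- The cocycle condition is stated for `k`-linear cochains; the corresponding `A`-linear maps on
the free bar modules are their extensions, to which the vanishing of `Ext` in degree `m + 1`
applies. -/
theorem exists_cobounding {m : ℕ} (hpd : HasProjectiveDimensionLT (ModuleCat.of A M) (m + 1))
    (ζ : (⨂[k]^(m + 1) A) ⊗[k] M →ₗ[k] L)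
    (hζ : ∀ a t, a • ζ t = ζ (barCoeff k A M (m + 1) (consCoeff k A M (m + 1) (a ⊗ₜ t)))) :
    ∃ η : (⨂[k]^m A) ⊗[k] M →ₗ[k] L, ∀ a t, ζ (consCoeff k A M m (a ⊗ₜ t)) =
      a • η t - η (barCoeff k A M m (consCoeff k A M m (a ⊗ₜ t))) := by
  have hζ' : ∀ x, freeLift ζ x =
      ζ (barCoeff k A M (m + 1) (consCoeff k A M (m + 1) x)) := by
    intro x
    induction x with
    | zero => simp
    | add x y hx hy => simp only [map_add, hx, hy]
    | tmul a t => exact hζ a t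
  have h0 : freeLift ζ ∘ₗ barD k A M (m + 1) = 0 := by
    refine freeLift_ext fun t => ?_
    obtain ⟨x, rfl⟩ := (consCoeff k A M (m + 1)).surjective t
    rw [LinearMap.comp_apply, barD_one_tmul, map_sub, hζ' x, freeLift_tmul, one_smul, sub_self]
    rfl
  obtain ⟨η, hη⟩ : ∃ η : A ⊗[k] ((⨂[k]^m A) ⊗[k] M) →ₗ[A] L,
      ∀ x, freeLift ζ x = η (barD k A M m x) :=
    exists_comp_eq_of_hasProjectiveDimensionLT (X := barObj k A M)
      (projective_barObj k A M) (barMap_zero_surjective k A M) (ker_barMap k A M) hpd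
      (freeLift ζ) (LinearMap.congr_fun h0)
  refine ⟨η.restrictScalars k ∘ₗ TensorProduct.mk k A _ 1, fun a t => ?_⟩
  have h1 := hη (1 ⊗ₜ consCoeff k A M m (a ⊗ₜ t))
  have h2 : a ⊗ₜ[k] t = a • ((1 : A) ⊗ₜ[k] t) := by simp [TensorProduct.smul_tmul']
  rw [barD_one_tmul, freeLift_tmul, one_smul, map_sub] at h1
  rw [h1]
  congr 1
  rw [h2, map_smul]
  rfl

end BarComplex

/-! ### Graded bases and homogeneous maps -/

section Homogeneous

open Module

variable {k ι : Type*} [Field k] [DecidableEq ι]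
variable {V I W J X K : Type*} [AddCommGroup V] [Module k V] [AddCommGroup W] [Module k W]
  [AddCommGroup X] [Module k X]

/-- The projection of `V` to its component of degree `a`, for a basis whose elements have
degrees. -/
def degProj (e : Basis I k V) (deg : I → ι) (a : ι) : V →ₗ[k] V :=
  e.constr k fun i => if deg i = a then e i else 0

/-- The part of degree zero of a linear map. -/
def homogenize (e : Basis I k V) (deg : I → ι) (e' : Basis J k W) (deg' : J → ι)
    (φ : V →ₗ[k] W) : V →ₗ[k] W :=
  e.constr k fun i => degProj e' deg' (deg i) (φ (e i))

/-- Maps that preserve degrees. -/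
def IsHomogeneousMap (e : Basis I k V) (deg : I → ι) (e' : Basis J k W) (deg' : J → ι)
    (φ : V →ₗ[k] W) : Prop :=
  ∀ i, degProj e' deg' (deg i) (φ (e i)) = φ (e i)

variable {e : Basis I k V} {deg : I → ι} {e' : Basis J k W} {deg' : J → ι}
  {e'' : Basis K k X} {deg'' : K → ι}

theorem degProj_basis (a : ι) (i : I) :
    degProj e deg a (e i) = if deg i = a then e i else 0 := by
  simp [degProj]

theorem repr_degProj (a : ι) (x : V) (i : I) :
    e.repr (degProj e deg a x) i = if deg i = a then e.repr x i else 0 := by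
  classical
  have : (Finsupp.lapply i : (I →₀ k) →ₗ[k] k) ∘ₗ e.repr.toLinearMap ∘ₗ degProj e deg a =
      (if deg i = a then (1 : k) else 0) • (Finsupp.lapply i ∘ₗ e.repr.toLinearMap) := by
    refine e.ext fun j => ?_
    by_cases hj : deg j = a <;> by_cases hi : deg i = a <;> by_cases hij : j = i <;>
      simp_all [degProj_basis]
  refine (LinearMap.congr_fun this x).trans ?_
  split_ifs <;> simp

theorem degProj_degProj (a : ι) (x : V) :
    degProj e deg a (degProj e deg a x) = degProj e deg a x := by
  apply e.repr.injective
  ext i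
  simp only [repr_degProj]
  split_ifs <;> rfl

theorem degProj_degProj_of_ne {a a' : ι} (h : a ≠ a') (x : V) :
    degProj e deg a (degProj e deg a' x) = 0 := by
  apply e.repr.injective
  ext i
  simp only [repr_degProj, map_zero, Finsupp.coe_zero, Pi.zero_apply]
  split_ifs with h1 h2
  · exact absurd (h1.symm.trans h2) h
  · rfl
  · rfl

theorem homogenize_basis (φ : V →ₗ[k] W) (i : I) :
    homogenize e deg e' deg' φ (e i) = degProj e' deg' (deg i) (φ (e i)) := by
  simp [homogenize]

theorem isHomogeneousMap_homogenize (φ : V →ₗ[k] W) :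
    IsHomogeneousMap e deg e' deg' (homogenize e deg e' deg' φ) := fun i => by
  rw [homogenize_basis, degProj_degProj]

theorem IsHomogeneousMap.homogenize_eq {φ : V →ₗ[k] W} (h : IsHomogeneousMap e deg e' deg' φ) :
    homogenize e deg e' deg' φ = φ :=
  e.ext fun i => by rw [homogenize_basis, h i]

theorem IsHomogeneousMap.degProj_apply {φ : V →ₗ[k] W} (h : IsHomogeneousMap e deg e' deg' φ)
    (a : ι) (x : V) : degProj e' deg' a (φ x) = φ (degProj e deg a x) := by
  have : degProj e' deg' a ∘ₗ φ = φ ∘ₗ degProj e deg a := by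
    refine e.ext fun i => ?_
    rw [LinearMap.comp_apply, LinearMap.comp_apply, degProj_basis]
    split_ifs with hi
    · rw [← hi, h i]
    · rw [← h i, degProj_degProj_of_ne (Ne.symm hi), map_zero]
  exact LinearMap.congr_fun this x

theorem IsHomogeneousMap.add {φ ψ : V →ₗ[k] W} (hφ : IsHomogeneousMap e deg e' deg' φ)
    (hψ : IsHomogeneousMap e deg e' deg' ψ) : IsHomogeneousMap e deg e' deg' (φ + ψ) := fun i => by
  rw [LinearMap.add_apply, map_add, hφ i, hψ i]

theorem IsHomogeneousMap.sub {φ ψ : V →ₗ[k] W} (hφ : IsHomogeneousMap e deg e' deg' φ)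
    (hψ : IsHomogeneousMap e deg e' deg' ψ) : IsHomogeneousMap e deg e' deg' (φ - ψ) := fun i => by
  rw [LinearMap.sub_apply, map_sub, hφ i, hψ i]

theorem IsHomogeneousMap.smul {φ : V →ₗ[k] W} (r : k) (hφ : IsHomogeneousMap e deg e' deg' φ) :
    IsHomogeneousMap e deg e' deg' (r • φ) := fun i => by
  rw [LinearMap.smul_apply, map_smul, hφ i]

theorem IsHomogeneousMap.zero : IsHomogeneousMap e deg e' deg' (0 : V →ₗ[k] W) := fun i => by
  simp

theorem homogenize_degProj (φ : V →ₗ[k] W) (a : ι) (x : V) :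
    homogenize e deg e' deg' φ (degProj e deg a x) = degProj e' deg' a (φ (degProj e deg a x)) := by
  have : homogenize e deg e' deg' φ ∘ₗ degProj e deg a =
      degProj e' deg' a ∘ₗ φ ∘ₗ degProj e deg a := by
    refine e.ext fun i => ?_
    simp only [LinearMap.comp_apply, degProj_basis]
    split_ifs with hi
    · rw [homogenize_basis, hi]
    · simp
  exact LinearMap.congr_fun this x

/-- Together with `homogenize_comp_right`, this transfers linear identities between `σ` and
degree-preserving structure maps to the degree-preserving part of `σ`. -/
theorem homogenize_comp_left {φ : V →ₗ[k] W} {ψ : W →ₗ[k] X}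
    (hψ : IsHomogeneousMap e' deg' e'' deg'' ψ) :
    homogenize e deg e'' deg'' (ψ ∘ₗ φ) = ψ ∘ₗ homogenize e deg e' deg' φ :=
  e.ext fun i => by
    rw [homogenize_basis, LinearMap.comp_apply, LinearMap.comp_apply, homogenize_basis,
      hψ.degProj_apply]

theorem homogenize_comp_right {φ : V →ₗ[k] W} {ψ : W →ₗ[k] X}
    (hφ : IsHomogeneousMap e deg e' deg' φ) :
    homogenize e deg e'' deg'' (ψ ∘ₗ φ) = homogenize e' deg' e'' deg'' ψ ∘ₗ φ :=
  e.ext fun i => by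
    rw [homogenize_basis, LinearMap.comp_apply, LinearMap.comp_apply, ← hφ i, homogenize_degProj]

end Homogeneous

/-! ### Degrees on tensor powers -/

section TensorBasis

open Module

variable {k ι C B : Type*} [Field k] [AddCommGroup C] [Module k C]
variable (b : Basis B k C) (δ : B → ι)

/-- The basis of `C^{⊗ m}` given by a basis of `C`. -/
def tensorBasis (m : ℕ) : Basis (Fin m → B) k (⨂[k]^m C) :=
  Basis.piTensorProduct fun _ => b

theorem tensorBasis_apply (m : ℕ) (v : Fin m → B) :
    tensorBasis b m v = PiTensorProduct.tprod k fun j => b (v j) :=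
  Basis.piTensorProduct_apply _ v

theorem tensorBasis_cons (m : ℕ) (i : B) (v : Fin m → B) :
    tensorBasis b (m + 1) (Fin.cons i v : Fin (m + 1) → B) =
      consEquiv k C m (b i ⊗ₜ tensorBasis b m v) := by
  rw [tensorBasis_apply, tensorBasis_apply, consEquiv_tmul_tprod]
  congr 1
  funext j
  refine Fin.cases ?_ (fun j => ?_) j <;> simp

theorem tensorBasis_snoc (m : ℕ) (i : B) (v : Fin m → B) :
    tensorBasis b (m + 1) (Fin.snoc v i : Fin (m + 1) → B) =
      snocEquiv k C m (tensorBasis b m v ⊗ₜ b i) := by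
  rw [tensorBasis_apply, tensorBasis_apply, snocEquiv_tmul_tprod]
  congr 1
  funext j
  refine Fin.lastCases ?_ (fun j => ?_) j <;> simp

variable [AddCommMonoid ι]

/-- The degrees of the elements of `tensorBasis`. -/
def tensorDeg (m : ℕ) (v : Fin m → B) : ι := ∑ j, δ (v j)

theorem tensorDeg_cons (m : ℕ) (i : B) (v : Fin m → B) :
    tensorDeg δ (m + 1) (Fin.cons i v : Fin (m + 1) → B) = δ i + tensorDeg δ m v := by
  simp [tensorDeg, Fin.sum_univ_succ]

theorem tensorDeg_snoc (m : ℕ) (i : B) (v : Fin m → B) :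
    tensorDeg δ (m + 1) (Fin.snoc v i : Fin (m + 1) → B) = tensorDeg δ m v + δ i := by
  simp [tensorDeg, Fin.sum_univ_castSucc]

variable [DecidableEq ι]

/-- The projection of `C^{⊗ m}` to its component of degree `a`. -/
abbrev tensorProj (m : ℕ) (a : ι) : ⨂[k]^m C →ₗ[k] ⨂[k]^m C :=
  degProj (tensorBasis b m) (tensorDeg δ m) a

/-- Homogenization of maps between tensor powers. -/
abbrev tensorHomogenize {m l : ℕ} (φ : ⨂[k]^m C →ₗ[k] ⨂[k]^l C) : ⨂[k]^m C →ₗ[k] ⨂[k]^l C :=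
  homogenize (tensorBasis b m) (tensorDeg δ m) (tensorBasis b l) (tensorDeg δ l) φ

/-- Homogeneous maps between tensor powers. -/
abbrev IsTensorHomogeneous {m l : ℕ} (φ : ⨂[k]^m C →ₗ[k] ⨂[k]^l C) : Prop :=
  IsHomogeneousMap (tensorBasis b m) (tensorDeg δ m) (tensorBasis b l) (tensorDeg δ l) φ

variable {b δ} [IsCancelAdd ι]

theorem tensorProj_cons (m : ℕ) (i : B) (a : ι) (x : ⨂[k]^m C) :
    tensorProj b δ (m + 1) (δ i + a) (consEquiv k C m (b i ⊗ₜ x)) =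
      consEquiv k C m (b i ⊗ₜ tensorProj b δ m a x) := by
  have : tensorProj b δ (m + 1) (δ i + a) ∘ₗ (consEquiv k C m).toLinearMap ∘ₗ
      TensorProduct.mk k C _ (b i) = (consEquiv k C m).toLinearMap ∘ₗ
      TensorProduct.mk k C _ (b i) ∘ₗ tensorProj b δ m a := by
    refine (tensorBasis b m).ext fun v => ?_
    simp only [LinearMap.comp_apply, LinearEquiv.coe_coe, TensorProduct.mk_apply,
      ← tensorBasis_cons, degProj_basis, tensorDeg_cons, add_right_inj]
    split_ifs
    · rw [← tensorBasis_cons]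
    · simp
  exact LinearMap.congr_fun this x

theorem tensorProj_snoc (m : ℕ) (i : B) (a : ι) (x : ⨂[k]^m C) :
    tensorProj b δ (m + 1) (a + δ i) (snocEquiv k C m (x ⊗ₜ b i)) =
      snocEquiv k C m (tensorProj b δ m a x ⊗ₜ b i) := by
  have : tensorProj b δ (m + 1) (a + δ i) ∘ₗ (snocEquiv k C m).toLinearMap ∘ₗ
      (TensorProduct.mk k _ C).flip (b i) = (snocEquiv k C m).toLinearMap ∘ₗ
      (TensorProduct.mk k _ C).flip (b i) ∘ₗ tensorProj b δ m a := by
    refine (tensorBasis b m).ext fun v => ?_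
    simp only [LinearMap.comp_apply, LinearEquiv.coe_coe, TensorProduct.mk_apply,
      LinearMap.flip_apply, ← tensorBasis_snoc, degProj_basis, tensorDeg_snoc, add_left_inj]
    split_ifs
    · rw [← tensorBasis_snoc]
    · simp
  exact LinearMap.congr_fun this x

/-- A basis vector carried along in front shifts source and target degrees equally; by cancellation
in `ι`, equality of degrees before and after the shift is the same condition. -/
theorem tensorHomogenize_lWh {m l : ℕ} (φ : ⨂[k]^m C →ₗ[k] ⨂[k]^l C) :
    tensorHomogenize b δ (lWh φ) = lWh (tensorHomogenize b δ φ) := by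
  refine (tensorBasis b (m + 1)).ext fun v => ?_
  obtain ⟨i, v, rfl⟩ : ∃ i w, v = Fin.cons i w := ⟨v 0, Fin.tail v, (Fin.cons_self_tail v).symm⟩
  rw [homogenize_basis, tensorBasis_cons, lWh_cons, lWh_cons, tensorDeg_cons, homogenize_basis,
    tensorProj_cons]

theorem tensorHomogenize_rWh {m l : ℕ} (φ : ⨂[k]^m C →ₗ[k] ⨂[k]^l C) :
    tensorHomogenize b δ (rWh φ) = rWh (tensorHomogenize b δ φ) := by
  refine (tensorBasis b (m + 1)).ext fun v => ?_
  obtain ⟨w, i, rfl⟩ : ∃ w i, v = Fin.snoc w i :=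
    ⟨Fin.init v, v (Fin.last m), (Fin.snoc_init_self v).symm⟩
  rw [homogenize_basis, tensorBasis_snoc, rWh_snoc, rWh_snoc, tensorDeg_snoc, homogenize_basis,
    tensorProj_snoc]

theorem IsHomogeneousMap.lWh {m l : ℕ} {φ : ⨂[k]^m C →ₗ[k] ⨂[k]^l C}
    (h : IsTensorHomogeneous b δ φ) : IsTensorHomogeneous b δ (lWh φ) := by
  have h1 := tensorHomogenize_lWh (b := b) (δ := δ) φ
  rw [show tensorHomogenize b δ φ = φ from h.homogenize_eq] at h1
  rw [← h1]
  exact isHomogeneousMap_homogenize _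

end TensorBasis

/-! ### Homogeneous bases of graded coalgebras -/

section GradedCoalgebra

open Module

variable {k ι C B : Type*} [Field k] [AddCommGroup C] [Module k C] [DecidableEq ι]

/-- A basis of a graded vector space that consists of homogeneous elements and is finite in each
degree. -/
structure IsHomogeneousBasis (𝒜 : ι → Submodule k C) (b : Basis B k C) (δ : B → ι) : Prop where
  mem : ∀ i, b i ∈ 𝒜 (δ i)
  repr_eq_zero : ∀ n, ∀ c ∈ 𝒜 n, ∀ i, δ i ≠ n → b.repr c i = 0
  finite : ∀ n, {i | δ i = n}.Finite

theorem exists_isHomogeneousBasis {𝒜 : ι → Submodule k C} (h : DirectSum.IsInternal 𝒜)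
    (hfin : ∀ n, Module.Finite k (𝒜 n)) :
    ∃ b : Basis (Σ n, Fin (finrank k (𝒜 n))) k C, IsHomogeneousBasis 𝒜 b Sigma.fst := by
  refine ⟨h.collectedBasis fun n => finBasis k (𝒜 n), ?_, ?_, ?_⟩
  · exact fun i => h.collectedBasis_mem _ i
  · rintro n c hc ⟨j, a⟩ hj
    exact h.collectedBasis_repr_of_mem_ne _ (Ne.symm hj) hc
  · intro n
    refine (Set.finite_range fun a : Fin (finrank k (𝒜 n)) =>
      (⟨n, a⟩ : Σ n, Fin (finrank k (𝒜 n)))).subset ?_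
    rintro ⟨j, a⟩ rfl
    exact ⟨a, rfl⟩

variable {𝒜 : ι → Submodule k C} {b : Basis B k C} {δ : B → ι}

theorem IsHomogeneousBasis.mem_span (hb : IsHomogeneousBasis 𝒜 b δ) {n : ι} {c : C}
    (hc : c ∈ 𝒜 n) : c ∈ Submodule.span k (b '' {i | δ i = n}) := by
  rw [← b.linearCombination_repr c, Finsupp.linearCombination_apply]
  refine Submodule.sum_mem _ fun i hi => Submodule.smul_mem _ _ (Submodule.subset_span ⟨i, ?_, rfl⟩)
  by_contra hne
  exact (Finsupp.mem_support_iff.mp hi) (hb.repr_eq_zero n c hc i hne)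

variable [AddCommMonoid ι] [Coalgebra k C]

/-- A basis of a coalgebra whose elements have degrees preserved by the comultiplication, with
finitely many elements in each degree. -/
structure IsGradedBasis (b : Basis B k C) (δ : B → ι) : Prop where
  comul_mem : ∀ i, Coalgebra.comul (R := k) (b i) ∈
    Submodule.span k {t | ∃ p q, δ p + δ q = δ i ∧ t = b p ⊗ₜ[k] b q}
  finite : ∀ n, {i | δ i = n}.Finite

theorem IsHomogeneousBasis.isGradedBasis (hb : IsHomogeneousBasis 𝒜 b δ) (h𝒜 : IsGradedCoalgebra k 𝒜) :
    IsGradedBasis b δ := by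
  refine ⟨fun i => ?_, hb.finite⟩
  refine (iSup_le ?_ : (⨆ p : {p : ι × ι // p.1 + p.2 = δ i},
    LinearMap.range (TensorProduct.mapIncl (𝒜 p.1.1) (𝒜 p.1.2))) ≤ _)
    (h𝒜.comul_mem (δ i) (b i) (hb.mem i))
  rintro ⟨⟨n, n'⟩, hn⟩
  rintro _ ⟨t, rfl⟩
  induction t with
  | zero => simp
  | add x y hx hy => rw [map_add]; exact add_mem hx hy
  | tmul x y =>
    rw [TensorProduct.mapIncl, TensorProduct.map_tmul]
    refine Submodule.span_induction₂ (p := fun x y _ _ => x ⊗ₜ[k] y ∈ _) ?_ ?_ ?_ ?_ ?_ ?_ ?_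
      (hb.mem_span x.2) (hb.mem_span y.2)
    · rintro _ _ ⟨p, hp, rfl⟩ ⟨q, hq, rfl⟩
      exact Submodule.subset_span ⟨p, q, by rw [hp, hq, hn], rfl⟩
    · intros; simp
    · intros; simp
    · intro x y z _ _ _ h1 h2
      rw [TensorProduct.add_tmul]; exact add_mem h1 h2
    · intro x y z _ _ _ h1 h2
      rw [TensorProduct.tmul_add]; exact add_mem h1 h2
    · intro r x y _ _ h1
      rw [← TensorProduct.smul_tmul']; exact Submodule.smul_mem _ _ h1
    · intro r x y _ _ h1
      rw [TensorProduct.tmul_smul]; exact Submodule.smul_mem _ _ h1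

variable [IsCancelAdd ι]

theorem isTensorHomogeneous_comulFirst (hb : IsGradedBasis b δ) (m : ℕ) : IsTensorHomogeneous b δ (comulFirst k C m) := by
  intro v
  obtain ⟨i, v, rfl⟩ : ∃ i w, v = Fin.cons i w := ⟨v 0, Fin.tail v, (Fin.cons_self_tail v).symm⟩
  rw [tensorBasis_cons, comulFirst_cons, tensorDeg_cons]
  refine Submodule.span_induction (p := fun t _ => tensorProj b δ (m + 2) (δ i + tensorDeg δ m v)
    (consTwo k C m (t ⊗ₜ tensorBasis b m v)) = consTwo k C m (t ⊗ₜ tensorBasis b m v))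
    ?_ ?_ ?_ ?_ (hb.comul_mem i)
  · rintro _ ⟨p, q, hpq, rfl⟩
    rw [consTwo_tmul, ← hpq, add_assoc, tensorProj_cons, tensorProj_cons, degProj_basis, if_pos rfl]
  · simp
  · intro x y _ _ hx hy
    simp only [TensorProduct.add_tmul, map_add, hx, hy]
  · intro r x _ hx
    simp only [← TensorProduct.smul_tmul', map_smul, hx]

theorem isTensorHomogeneous_comulLast (hb : IsGradedBasis b δ) (m : ℕ) : IsTensorHomogeneous b δ (comulLast k C m) := by
  intro v
  obtain ⟨v, i, rfl⟩ : ∃ w i, v = Fin.snoc w i :=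
    ⟨Fin.init v, v (Fin.last m), (Fin.snoc_init_self v).symm⟩
  rw [tensorBasis_snoc, comulLast_snoc, tensorDeg_snoc]
  refine Submodule.span_induction (p := fun t _ => tensorProj b δ (m + 2) (tensorDeg δ m v + δ i)
    (snocTwo k C m (tensorBasis b m v ⊗ₜ t)) = snocTwo k C m (tensorBasis b m v ⊗ₜ t))
    ?_ ?_ ?_ ?_ (hb.comul_mem i)
  · rintro _ ⟨p, q, hpq, rfl⟩
    rw [snocTwo_tmul, ← hpq, ← add_assoc, tensorProj_snoc, tensorProj_snoc, degProj_basis,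
      if_pos rfl]
  · simp
  · intro x y _ _ hx hy
    simp only [TensorProduct.tmul_add, map_add, hx, hy]
  · intro r x _ hx
    simp only [TensorProduct.tmul_smul, map_smul, hx]

theorem isTensorHomogeneous_cobar (hb : IsGradedBasis b δ) (m : ℕ) : IsTensorHomogeneous b δ (cobar k C m) := by
  induction m with
  | zero => rw [cobar_zero]; exact IsHomogeneousMap.zero
  | succ m ih =>
    rw [cobar_succ]
    exact (isTensorHomogeneous_comulFirst hb m).sub ih.lWh

end GradedCoalgebra

/-! ### The pairing between tensor powers of a coalgebra and of a dual algebra -/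

section Pairing

open Module

variable {k C A : Type*} [Field k] [AddCommGroup C] [Module k C] [Ring A] [Algebra k A]
variable (ev : A →ₗ[k] Dual k C)

/-- The pairing of `A^{⊗ m}` with `C^{⊗ m}` induced by a pairing of `A` with `C`. -/
def pairing (m : ℕ) : ⨂[k]^m A →ₗ[k] Dual k (⨂[k]^m C) :=
  PiTensorProduct.dualDistrib ∘ₗ PiTensorProduct.map fun _ => ev

theorem pairing_tprod (m : ℕ) (a : Fin m → A) (c : Fin m → C) :
    pairing ev m (PiTensorProduct.tprod k a) (PiTensorProduct.tprod k c) = ∏ j, ev (a j) (c j) := by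
  rw [pairing, LinearMap.comp_apply, PiTensorProduct.map_tprod, PiTensorProduct.dualDistrib_apply]

@[simp]
theorem pairing_cons (m : ℕ) (a : A) (w : ⨂[k]^m A) (c : C) (x : ⨂[k]^m C) :
    pairing ev (m + 1) (consEquiv k A m (a ⊗ₜ w)) (consEquiv k C m (c ⊗ₜ x)) =
      ev a c * pairing ev m w x := by
  induction w using PiTensorProduct.induction_on with
  | smul_tprod r a' =>
    induction x using PiTensorProduct.induction_on with
    | smul_tprod s c' =>
      simp only [TensorProduct.tmul_smul, map_smul, LinearMap.smul_apply, consEquiv_tmul_tprod,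
        pairing_tprod, Fin.prod_univ_succ, Fin.cons_zero, Fin.cons_succ, smul_eq_mul]
      ring
    | add y z hy hz => simp only [TensorProduct.tmul_add, map_add, hy, hz, mul_add]
  | add y z hy hz =>
    simp only [TensorProduct.tmul_add, map_add, LinearMap.add_apply, hy, hz, mul_add]

@[simp]
theorem pairing_snoc (m : ℕ) (a : A) (w : ⨂[k]^m A) (c : C) (x : ⨂[k]^m C) :
    pairing ev (m + 1) (snocEquiv k A m (w ⊗ₜ a)) (snocEquiv k C m (x ⊗ₜ c)) =
      pairing ev m w x * ev a c := by
  induction w using PiTensorProduct.induction_on with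
  | smul_tprod r a' =>
    induction x using PiTensorProduct.induction_on with
    | smul_tprod s c' =>
      simp only [← TensorProduct.smul_tmul', map_smul, LinearMap.smul_apply, snocEquiv_tmul_tprod,
        pairing_tprod, Fin.prod_univ_castSucc, Fin.snoc_castSucc, Fin.snoc_last, smul_eq_mul]
      ring
    | add y z hy hz => simp only [TensorProduct.add_tmul, map_add, hy, hz, add_mul]
  | add y z hy hz =>
    simp only [TensorProduct.add_tmul, map_add, LinearMap.add_apply, hy, hz, add_mul]

variable {ev}

theorem pairing_lWh {m l : ℕ} {φ : ⨂[k]^l C →ₗ[k] ⨂[k]^m C} {S : ⨂[k]^m A →ₗ[k] ⨂[k]^l A}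
    (h : ∀ x, pairing ev l (S x) = pairing ev m x ∘ₗ φ) (x : ⨂[k]^(m + 1) A) :
    pairing ev (l + 1) (lWh S x) = pairing ev (m + 1) x ∘ₗ lWh φ := by
  have : pairing ev (l + 1) ∘ₗ lWh S =
      (LinearMap.lcomp k k (lWh φ)) ∘ₗ pairing ev (m + 1) :=
    ext_cons fun a w => ext_cons fun c y => by
      simp [h w]
  exact LinearMap.congr_fun this x

theorem pairing_rWh {m l : ℕ} {φ : ⨂[k]^l C →ₗ[k] ⨂[k]^m C} {S : ⨂[k]^m A →ₗ[k] ⨂[k]^l A}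
    (h : ∀ x, pairing ev l (S x) = pairing ev m x ∘ₗ φ) (x : ⨂[k]^(m + 1) A) :
    pairing ev (l + 1) (rWh S x) = pairing ev (m + 1) x ∘ₗ rWh φ := by
  have : pairing ev (l + 1) ∘ₗ rWh S =
      (LinearMap.lcomp k k (rWh φ)) ∘ₗ pairing ev (m + 1) :=
    ext_snoc fun a w => ext_snoc fun c y => by
      simp [h a]
  exact LinearMap.congr_fun this x

variable [Coalgebra k C]

theorem pairing_mulFirst (hev : ∀ a b, ev (a * b) =
      LinearMap.mul' k k ∘ₗ TensorProduct.map (ev a) (ev b) ∘ₗ Coalgebra.comul) (m : ℕ)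
    (x : ⨂[k]^(m + 2) A) :
    pairing ev (m + 1) (mulFirst k A m x) = pairing ev (m + 2) x ∘ₗ comulFirst k C m := by
  have : pairing ev (m + 1) ∘ₗ mulFirst k A m =
      (LinearMap.lcomp k k (comulFirst k C m)) ∘ₗ pairing ev (m + 2) :=
    ext_cons_cons fun a b w => ext_cons fun c y => by
      simp only [LinearMap.comp_apply, LinearMap.lcomp_apply, mulFirst_cons, pairing_cons,
        comulFirst_cons, hev]
      generalize Coalgebra.comul (R := k) c = t
      induction t with
      | zero => simp
      | add x y hx hy => simp only [map_add, TensorProduct.add_tmul, add_mul, hx, hy]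
      | tmul c d => simp [mul_assoc]
  exact LinearMap.congr_fun this x

theorem pairing_mulLast (hev : ∀ a b, ev (a * b) =
      LinearMap.mul' k k ∘ₗ TensorProduct.map (ev a) (ev b) ∘ₗ Coalgebra.comul) (m : ℕ)
    (x : ⨂[k]^(m + 2) A) :
    pairing ev (m + 1) (mulLast k A m x) = pairing ev (m + 2) x ∘ₗ comulLast k C m := by
  have : pairing ev (m + 1) ∘ₗ mulLast k A m =
      (LinearMap.lcomp k k (comulLast k C m)) ∘ₗ pairing ev (m + 2) :=
    ext_snoc_snoc fun w a b => ext_snoc fun y c => by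
      simp only [LinearMap.comp_apply, LinearMap.lcomp_apply, mulLast_snoc, pairing_snoc,
        comulLast_snoc, hev]
      generalize Coalgebra.comul (R := k) c = t
      induction t with
      | zero => simp
      | add x y hx hy => simp only [map_add, TensorProduct.tmul_add, mul_add, hx, hy]
      | tmul c d => simp [mul_assoc]
  exact LinearMap.congr_fun this x

/-- The product of `A` is the transpose of `Δ`, so the bar and cobar differentials are transposes;
their recursions from the left end agree term by term. -/
theorem pairing_barDiff (hev : ∀ a b, ev (a * b) =
      LinearMap.mul' k k ∘ₗ TensorProduct.map (ev a) (ev b) ∘ₗ Coalgebra.comul) (m : ℕ)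
    (x : ⨂[k]^(m + 1) A) :
    pairing ev m (barDiff k A m x) = pairing ev (m + 1) x ∘ₗ cobar k C m := by
  induction m with
  | zero => rw [barDiff_zero, cobar_zero, LinearMap.zero_apply, map_zero, LinearMap.comp_zero]
  | succ m ih =>
    rw [barDiff_succ, cobar_succ, LinearMap.sub_apply, map_sub, pairing_mulFirst hev,
      pairing_lWh ih, LinearMap.comp_sub]

end Pairing

/-! ### Dual bases, transposes and truncation to finitely many degrees -/

section DualBasis

open Module

variable {k B C A : Type*} [Field k] [AddCommGroup C] [Module k C] [Ring A] [Algebra k A]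
variable {ev : A →ₗ[k] Dual k C} {b : Basis B k C} {bA : Basis B k A}

theorem pairing_tensorBasis_left (hd : ∀ i, ev (bA i) = b.coord i) (m : ℕ) (v : Fin m → B)
    (y : ⨂[k]^m C) : pairing ev m (tensorBasis bA m v) y = (tensorBasis b m).repr y v := by
  classical
  have : pairing ev m (tensorBasis bA m v) = (tensorBasis b m).coord v := by
    refine (tensorBasis b m).ext fun u => ?_
    rw [tensorBasis_apply, tensorBasis_apply, pairing_tprod, Basis.coord_apply, tensorBasis,
      Basis.piTensorProduct_repr_tprod_apply]
    simp [hd]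
  rw [this, Basis.coord_apply]

theorem pairing_tensorBasis_right (hd : ∀ i, ev (bA i) = b.coord i) (m : ℕ) (v : Fin m → B)
    (x : ⨂[k]^m A) : pairing ev m x (tensorBasis b m v) = (tensorBasis bA m).repr x v := by
  classical
  have : (pairing ev m).flip (tensorBasis b m v) = (tensorBasis bA m).coord v := by
    refine (tensorBasis bA m).ext fun u => ?_
    rw [LinearMap.flip_apply, pairing_tensorBasis_left hd, Basis.coord_apply, Basis.repr_self,
      Basis.repr_self, Finsupp.single_apply, Finsupp.single_apply]
    simp only [eq_comm]
  exact LinearMap.congr_fun this x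

theorem pairing_injective (hd : ∀ i, ev (bA i) = b.coord i) (m : ℕ) :
    Function.Injective (pairing ev m) := fun x y h => by
  apply (tensorBasis bA m).repr.injective
  ext v
  rw [← pairing_tensorBasis_right hd, ← pairing_tensorBasis_right hd, h]

variable {d : ℕ} {δ : B → (Fin d → ℕ)}

/-- Degrees in `ℕ^d` are nonnegative, so every factor has degree at most `n`, and only finitely many
degrees lie below `n`. Thus local finiteness passes to tensor powers. -/
theorem finite_tensorDeg_eq (hfin : ∀ n, {i | δ i = n}.Finite) (m : ℕ) (n : Fin d → ℕ) :
    {v : Fin m → B | tensorDeg δ m v = n}.Finite := by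
  have h1 : {i | δ i ≤ n}.Finite := by
    have : {i | δ i ≤ n} = ⋃ a ∈ Set.Iic n, {i | δ i = a} := by
      ext i; simp
    rw [this]
    exact (Set.finite_Iic n).biUnion fun a _ => hfin a
  refine (Set.Finite.pi' fun _ : Fin m => h1).subset fun v hv j => ?_
  rw [Set.mem_ofPred_eq] at hv ⊢
  rw [← hv]
  exact Finset.single_le_sum (f := fun j => δ (v j)) (fun _ _ => zero_le) (Finset.mem_univ j)

theorem IsHomogeneousMap.repr_eq_zero {m l : ℕ} {φ : ⨂[k]^l C →ₗ[k] ⨂[k]^m C}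
    (hφ : IsTensorHomogeneous b δ φ) {u : Fin l → B} {v : Fin m → B}
    (huv : tensorDeg δ m v ≠ tensorDeg δ l u) :
    (tensorBasis b m).repr (φ (tensorBasis b l u)) v = 0 := by
  rw [← hφ u, repr_degProj, if_neg huv]

/-- The matrix of a degree-preserving map is block diagonal with finite blocks, so the columns of
its transpose have finite support. A map that mixes degrees need not have a transpose. -/
theorem exists_transpose (hd : ∀ i, ev (bA i) = b.coord i) (hfin : ∀ n, {i | δ i = n}.Finite)
    {m l : ℕ} {φ : ⨂[k]^l C →ₗ[k] ⨂[k]^m C} (hφ : IsTensorHomogeneous b δ φ) :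
    ∃ S : ⨂[k]^m A →ₗ[k] ⨂[k]^l A, ∀ x, pairing ev l (S x) = pairing ev m x ∘ₗ φ := by
  classical
  let S : ⨂[k]^m A →ₗ[k] ⨂[k]^l A := (tensorBasis bA m).constr k fun v =>
    ∑ u ∈ (finite_tensorDeg_eq hfin l (tensorDeg δ m v)).toFinset,
      (tensorBasis b m).repr (φ (tensorBasis b l u)) v • tensorBasis bA l u
  refine ⟨S, fun x => ?_⟩
  have : pairing ev l ∘ₗ S = (LinearMap.lcomp k k φ) ∘ₗ pairing ev m := by
    refine (tensorBasis bA m).ext fun v => (tensorBasis b l).ext fun u => ?_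
    simp only [LinearMap.comp_apply, LinearMap.lcomp_apply, S, Basis.constr_basis, map_sum,
      map_smul, LinearMap.sum_apply, LinearMap.smul_apply, pairing_tensorBasis_left hd,
      Basis.repr_self, Finsupp.single_apply, smul_eq_mul, mul_ite, mul_one, mul_zero,
      Finset.sum_ite_eq, Set.Finite.mem_toFinset, Set.mem_ofPred_eq]
    split_ifs with h
    · rfl
    · exact (hφ.repr_eq_zero (Ne.symm h)).symm
  exact LinearMap.congr_fun this x

/-- A map between tensor powers hits an element as soon as that element satisfies the equations that
hold for the elements of the range, with values in an arbitrary linear form on the tensor power of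
the dual algebra. -/
theorem exists_apply_eq_of_pairing (hd : ∀ i, ev (bA i) = b.coord i)
    (hfin : ∀ n, {i | δ i = n}.Finite) {m l : ℕ} {φ : ⨂[k]^m C →ₗ[k] ⨂[k]^l C}
    (hφ : IsTensorHomogeneous b δ φ) {S : ⨂[k]^l A →ₗ[k] ⨂[k]^m A}
    (hS : ∀ x, pairing ev m (S x) = pairing ev l x ∘ₗ φ) (η : ⨂[k]^m A →ₗ[k] k) {z : ⨂[k]^l C}
    (hz : ∀ x, pairing ev l x z = η (S x)) : ∃ y, φ y = z := by
  classical
  let D : Finset (Fin d → ℕ) := ((tensorBasis b l).repr z).support.image (tensorDeg δ l)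
  have hF : {u : Fin m → B | tensorDeg δ m u ∈ D}.Finite := by
    have : {u : Fin m → B | tensorDeg δ m u ∈ D} = ⋃ a ∈ D, {u | tensorDeg δ m u = a} := by
      ext u; simp
    rw [this]
    exact D.finite_toSet.biUnion fun a _ => finite_tensorDeg_eq hfin m a
  have hrepr : ∀ v u, tensorDeg δ m u ≠ tensorDeg δ l v →
      (tensorBasis bA m).repr (S (tensorBasis bA l v)) u = 0 := by
    intro v u huv
    rw [← pairing_tensorBasis_right hd, hS, LinearMap.comp_apply, pairing_tensorBasis_left hd]
    exact hφ.repr_eq_zero (Ne.symm huv)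
  -- An arbitrary form `η` need not come from `C^{⊗ m}`. Keeping only its values in the finitely
  -- many degrees of `z` gives an element, and since `φ` and `S` preserve degrees nothing relevant
  -- to `z` is lost.
  refine ⟨∑ u ∈ hF.toFinset, η (tensorBasis bA m u) • tensorBasis b m u, ?_⟩
  apply (tensorBasis b l).repr.injective
  ext v
  rw [← pairing_tensorBasis_left hd, ← pairing_tensorBasis_left hd, ← LinearMap.comp_apply, ← hS]
  simp only [map_sum, map_smul, pairing_tensorBasis_right hd, smul_eq_mul]
  by_cases hv : tensorDeg δ l v ∈ D
  · have hη : ∀ x, η x = ∑ u ∈ ((tensorBasis bA m).repr x).support,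
        (tensorBasis bA m).repr x u * η (tensorBasis bA m u) := by
      intro x
      conv_lhs => rw [← (tensorBasis bA m).linearCombination_repr x,
        Finsupp.linearCombination_apply, Finsupp.sum, map_sum]
      simp only [map_smul, smul_eq_mul]
    rw [hz, hη]
    symm
    refine (Finset.sum_subset (fun u hu => ?_) fun u _ hu => ?_).trans
      (Finset.sum_congr rfl fun u _ => mul_comm _ _)
    · rw [Set.Finite.mem_toFinset, Set.mem_ofPred_eq]
      by_contra hu'
      refine (Finsupp.mem_support_iff.mp hu) (hrepr v u fun h => hu' (h ▸ hv))
    · rw [Finsupp.notMem_support_iff.mp hu, zero_mul]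
  · rw [pairing_tensorBasis_left hd]
    have : (tensorBasis b l).repr z v = 0 := by
      by_contra hne
      exact hv (Finset.mem_image_of_mem _ (Finsupp.mem_support_iff.mpr hne))
    rw [this]
    refine Finset.sum_eq_zero fun u hu => ?_
    rw [Set.Finite.mem_toFinset, Set.mem_ofPred_eq] at hu
    rw [hrepr v u fun h => hv (h ▸ hu), mul_zero]

end DualBasis

/-! ### Graded duality -/

section Duality

open Module CategoryTheory

universe u v

variable {k : Type u} {C B : Type*} [Field k] [AddCommGroup C] [Module k C] [Coalgebra k C]
  {A : Type (max u v)} [Ring A] [Algebra k A] {d : ℕ}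

/-- A pairing which makes the algebra `A` the graded dual of the coalgebra `C`. -/
structure IsGradedDuality (ev : A →ₗ[k] Dual k C) (b : Basis B k C) (δ : B → (Fin d → ℕ))
    (bA : Basis B k A) : Prop where
  isGradedBasis : IsGradedBasis b δ
  map_mul : ∀ a a', ev (a * a') =
    LinearMap.mul' k k ∘ₗ TensorProduct.map (ev a) (ev a') ∘ₗ Coalgebra.comul
  map_one : ev 1 = Coalgebra.counit
  map_basis : ∀ i, ev (bA i) = b.coord i

variable {ev : A →ₗ[k] Dual k C} {b : Basis B k C} {δ : B → (Fin d → ℕ)} {bA : Basis B k A}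

/-- Upper bound for the global dimension: the bicolinear splitting is made homogeneous, dualized to
a bimodule endomorphism, and applied to the bar resolution of `M`. -/
theorem IsGradedDuality.hasProjectiveDimensionLT (hD : IsGradedDuality ev b δ bA)
    (hC : IsPointed k C) {n : ℕ} (hv : CohomologyVanishes k C n) (M : ModuleCat.{max u v} A) :
    HasProjectiveDimensionLT M (n + 1) := by
  obtain ⟨s, hs1, hs2⟩ := exists_splitting hC hv
  let σ := hat s
  have hσ1 : σ ∘ₗ cobar k C (n + 1) = 0 := by
    rw [hat_comp_cobar, hs1, rWh_zero, lWh_zero, LinearMap.zero_comp]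
  have hσ2 : cobar k C (n + 2) ∘ₗ σ = cobar k C (n + 2) := by
    rw [cobar_hat, hs2, ← cobar_hat, hat_counitEnds, LinearMap.comp_id]
  have hσ3 : comulFirst k C (n + 1) ∘ₗ σ = lWh σ ∘ₗ comulFirst k C (n + 1) := comulFirst_hat s
  have hσ4 : comulLast k C (n + 1) ∘ₗ σ = rWh σ ∘ₗ comulLast k C (n + 1) := comulLast_hat s
  have hb := hD.isGradedBasis
  -- The Zorn argument ignores degrees. Passing to the degree-preserving part keeps the splitting
  -- identities and bicolinearity, and makes a transpose available.
  let τ := tensorHomogenize b δ σ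
  have hτ : IsTensorHomogeneous b δ τ := isHomogeneousMap_homogenize σ
  have hτ1 : τ ∘ₗ cobar k C (n + 1) = 0 :=
    (homogenize_comp_right (isTensorHomogeneous_cobar hb (n + 1))).symm.trans
      ((congrArg _ hσ1).trans IsHomogeneousMap.zero.homogenize_eq)
  have hτ2 : cobar k C (n + 2) ∘ₗ τ = cobar k C (n + 2) :=
    (homogenize_comp_left (isTensorHomogeneous_cobar hb (n + 2))).symm.trans
      ((congrArg _ hσ2).trans (isTensorHomogeneous_cobar hb (n + 2)).homogenize_eq)
  have hτ3 : comulFirst k C (n + 1) ∘ₗ τ = lWh τ ∘ₗ comulFirst k C (n + 1) := by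
    refine (homogenize_comp_left (isTensorHomogeneous_comulFirst hb (n + 1))).symm.trans
      ((congrArg _ hσ3).trans ?_)
    refine (homogenize_comp_right (isTensorHomogeneous_comulFirst hb (n + 1))).trans ?_
    exact congrArg (fun f => f ∘ₗ comulFirst k C (n + 1)) (tensorHomogenize_lWh σ)
  have hτ4 : comulLast k C (n + 1) ∘ₗ τ = rWh τ ∘ₗ comulLast k C (n + 1) := by
    refine (homogenize_comp_left (isTensorHomogeneous_comulLast hb (n + 1))).symm.trans
      ((congrArg _ hσ4).trans ?_)
    refine (homogenize_comp_right (isTensorHomogeneous_comulLast hb (n + 1))).trans ?_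
    exact congrArg (fun f => f ∘ₗ comulLast k C (n + 1)) (tensorHomogenize_rWh σ)
  obtain ⟨S, hS⟩ := exists_transpose hD.map_basis hb.finite hτ
  let _ : Module k M := Module.restrictScalars k A M
  have : IsScalarTower k A M := IsScalarTower.restrictScalars k A M
  refine hasProjectiveDimensionLT_of_bimodule_homotopy (M := M) (S := S) ?_ ?_ ?_ ?_
  · refine LinearMap.ext fun x => pairing_injective hD.map_basis _ ?_
    rw [LinearMap.comp_apply, LinearMap.comp_apply, pairing_mulFirst hD.map_mul, pairing_lWh hS, hS,
      pairing_mulFirst hD.map_mul, LinearMap.comp_assoc, LinearMap.comp_assoc, hτ3]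
  · refine LinearMap.ext fun x => pairing_injective hD.map_basis _ ?_
    rw [LinearMap.comp_apply, LinearMap.comp_apply, pairing_mulLast hD.map_mul, pairing_rWh hS, hS,
      pairing_mulLast hD.map_mul, LinearMap.comp_assoc, LinearMap.comp_assoc, hτ4]
  · refine LinearMap.ext fun x => pairing_injective hD.map_basis _ ?_
    rw [LinearMap.comp_apply, pairing_barDiff hD.map_mul, hS, LinearMap.comp_assoc, hτ1,
      LinearMap.comp_zero, LinearMap.zero_apply, _root_.map_zero]
  · refine LinearMap.ext fun x => pairing_injective hD.map_basis _ ?_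
    rw [LinearMap.comp_apply, hS, pairing_barDiff hD.map_mul, LinearMap.comp_assoc, hτ2]

/-! ### Grouplike elements and characters -/

theorem IsGradedBasis.mem_span_of_isGroupLikeElem (hb : IsGradedBasis b δ) {g : C}
    (hg : IsGroupLikeElem k g) : g ∈ Submodule.span k (b '' {i | δ i = 0}) := by
  classical
  have h0 : ∀ i ∈ (b.repr g).support, δ i = 0 := by
    by_contra! hcon
    obtain ⟨j, hj, hj0⟩ := hcon
    -- At an index `i` of maximal total degree, the coefficient of `b i ⊗ b i` in `g ⊗ g` is a
    -- nonzero square. In `Δ g` it could come only from basis vectors of degree `2 δ i`, which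
    -- exceeds the maximum.
    obtain ⟨i, hi, hmax⟩ := Finset.exists_max_image (b.repr g).support
      (fun i => ∑ l, δ i l) ⟨j, hj⟩
    have hpos : 0 < ∑ l, δ i l := by
      refine lt_of_lt_of_le ?_ (hmax j hj)
      obtain ⟨l, hl⟩ := Function.ne_iff.mp hj0
      exact Finset.sum_pos' (fun _ _ => Nat.zero_le _) ⟨l, Finset.mem_univ l, Nat.pos_of_ne_zero hl⟩
    let F : C ⊗[k] C →ₗ[k] k := LinearMap.mul' k k ∘ₗ TensorProduct.map (b.coord i) (b.coord i)
    have hF : ∀ l, δ i + δ i ≠ δ l → F (Coalgebra.comul (R := k) (b l)) = 0 := by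
      intro l hl
      refine Submodule.span_induction (p := fun t _ => F t = 0) ?_ ?_ ?_ ?_ (hb.comul_mem l)
      · rintro _ ⟨p, q, hpq, rfl⟩
        simp only [F, LinearMap.comp_apply, TensorProduct.map_tmul, LinearMap.mul'_apply,
          Basis.coord_apply, Basis.repr_self, Finsupp.single_apply]
        split_ifs with h1 h2
        · subst h1; subst h2; exact absurd hpq hl
        all_goals simp
      · simp
      · intro x y _ _ hx hy; rw [map_add, hx, hy, add_zero]
      · intro r x _ hx; rw [map_smul, hx, smul_zero]
    have h1 : F (Coalgebra.comul (R := k) g) = b.repr g i * b.repr g i := by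
      rw [hg.comul_eq_tmul_self]
      simp [F]
    have h2 : F (Coalgebra.comul (R := k) g) = 0 := by
      conv_lhs => rw [← b.linearCombination_repr g, Finsupp.linearCombination_apply, Finsupp.sum,
        map_sum, map_sum]
      refine Finset.sum_eq_zero fun l hl => ?_
      rw [map_smul, map_smul, hF l, smul_zero]
      intro hil
      have := hmax l hl
      rw [← hil] at this
      simp only [Pi.add_apply, Finset.sum_add_distrib] at this
      omega
    rw [h2] at h1
    exact (Finsupp.mem_support_iff.mp hi) (mul_self_eq_zero.mp h1.symm)
  rw [← b.linearCombination_repr g, Finsupp.linearCombination_apply]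
  exact Submodule.sum_mem _ fun i hi =>
    Submodule.smul_mem _ _ (Submodule.subset_span ⟨i, h0 i hi, rfl⟩)

theorem isTensorHomogeneous_leftTensor (hb : IsGradedBasis b δ) {g : C} (hg : IsGroupLikeElem k g)
    (m : ℕ) : IsTensorHomogeneous b δ (leftTensor k g m) := by
  intro v
  refine Submodule.span_induction (p := fun g _ => tensorProj b δ (m + 1) (tensorDeg δ m v)
    (leftTensor k g m (tensorBasis b m v)) = leftTensor k g m (tensorBasis b m v))
    ?_ ?_ ?_ ?_ (hb.mem_span_of_isGroupLikeElem hg)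
  · rintro _ ⟨i, hi, rfl⟩
    have h : tensorDeg δ m v = δ i + tensorDeg δ m v := by
      rw [show δ i = 0 from hi, zero_add]
    conv_lhs => rw [h]
    rw [leftTensor_apply, tensorProj_cons, degProj_basis, if_pos rfl]
  · simp [leftTensor_apply]
  · intro x y _ _ hx hy
    simp only [leftTensor_apply, TensorProduct.add_tmul, map_add] at hx hy ⊢
    rw [hx, hy]
  · intro r x _ hx
    simp only [leftTensor_apply, ← TensorProduct.smul_tmul', map_smul] at hx ⊢
    rw [hx]

theorem isTensorHomogeneous_rightTensor (hb : IsGradedBasis b δ) {g : C} (hg : IsGroupLikeElem k g)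
    (m : ℕ) : IsTensorHomogeneous b δ (rightTensor k g m) := by
  intro v
  refine Submodule.span_induction (p := fun g _ => tensorProj b δ (m + 1) (tensorDeg δ m v)
    (rightTensor k g m (tensorBasis b m v)) = rightTensor k g m (tensorBasis b m v))
    ?_ ?_ ?_ ?_ (hb.mem_span_of_isGroupLikeElem hg)
  · rintro _ ⟨i, hi, rfl⟩
    have h : tensorDeg δ m v = tensorDeg δ m v + δ i := by
      rw [show δ i = 0 from hi, add_zero]
    conv_lhs => rw [h]
    rw [rightTensor_apply, tensorProj_snoc, degProj_basis, if_pos rfl]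
  · simp [rightTensor_apply]
  · intro x y _ _ hx hy
    simp only [rightTensor_apply, TensorProduct.tmul_add, map_add] at hx hy ⊢
    rw [hx, hy]
  · intro r x _ hx
    simp only [rightTensor_apply, TensorProduct.tmul_smul, map_smul] at hx ⊢
    rw [hx]

theorem isTensorHomogeneous_differential (hb : IsGradedBasis b δ) {g h : C}
    (hg : IsGroupLikeElem k g) (hh : IsGroupLikeElem k h) (m : ℕ) :
    IsTensorHomogeneous b δ (differential k g h m) := by
  rw [differential_eq]
  exact ((isTensorHomogeneous_leftTensor hb hg m).sub (isTensorHomogeneous_cobar hb m)).add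
    ((isTensorHomogeneous_rightTensor hb hh m).smul _)

end Duality

/-! ### One-dimensional modules of characters -/

section Characters

universe u v

variable {k : Type u} {A : Type (max u v)} [Field k] [Ring A] [Algebra k A]

/-- The one-dimensional module given by a character of `A`. -/
def CharModule (_ : A →ₐ[k] k) : Type (max u v) := ULift.{max u v} k

variable (χ : A →ₐ[k] k)

instance : AddCommGroup (CharModule.{u, v} χ) := inferInstanceAs (AddCommGroup (ULift k))

instance : Module k (CharModule.{u, v} χ) := inferInstanceAs (Module k (ULift k))

instance : Module A (CharModule.{u, v} χ) := Module.compHom (CharModule.{u, v} χ) χ.toRingHom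

theorem CharModule.smul_eq (a : A) (x : CharModule.{u, v} χ) : a • x = χ a • x := rfl

instance : IsScalarTower k A (CharModule.{u, v} χ) where
  smul_assoc r a x := by
    rw [CharModule.smul_eq, CharModule.smul_eq, map_smul, smul_assoc]

/-- The underlying vector space of `CharModule χ`. -/
def CharModule.equiv : CharModule.{u, v} χ ≃ₗ[k] k := ULift.moduleEquiv

end Characters

/-! ### Lower bound: primitive cocycles as bar cocycles -/

section LowerBound

open Module CategoryTheory

universe u v

variable {k : Type u} {C : Type*} [Field k] [AddCommGroup C] [Module k C]
  {A : Type (max u v)} [Ring A] [Algebra k A]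

/-- Contraction of the first factor with a character. -/
def charFirst (χ : A →ₐ[k] k) (m : ℕ) : ⨂[k]^(m + 1) A →ₗ[k] ⨂[k]^m A :=
  (TensorProduct.lid k _).toLinearMap ∘ₗ χ.toLinearMap.rTensor _ ∘ₗ
    (consEquiv k A m).symm.toLinearMap

/-- Contraction of the last factor with a character. -/
def charLast (χ : A →ₐ[k] k) (m : ℕ) : ⨂[k]^(m + 1) A →ₗ[k] ⨂[k]^m A :=
  (TensorProduct.rid k _).toLinearMap ∘ₗ χ.toLinearMap.lTensor _ ∘ₗ
    (snocEquiv k A m).symm.toLinearMap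

@[simp]
theorem charFirst_cons (χ : A →ₐ[k] k) (m : ℕ) (a : A) (w : ⨂[k]^m A) :
    charFirst χ m (consEquiv k A m (a ⊗ₜ w)) = χ a • w := by
  simp [charFirst]

@[simp]
theorem charLast_snoc (χ : A →ₐ[k] k) (m : ℕ) (a : A) (w : ⨂[k]^m A) :
    charLast χ m (snocEquiv k A m (w ⊗ₜ a)) = χ a • w := by
  simp [charLast]

/-- The transpose of `differential`. -/
def barDiffChar (χ χ' : A →ₐ[k] k) (m : ℕ) : ⨂[k]^(m + 1) A →ₗ[k] ⨂[k]^m A :=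
  charFirst χ m - barDiff k A m + (-1 : k) ^ (m + 1) • charLast χ' m

theorem barCoeff_char (χ : A →ₐ[k] k) (m : ℕ) (x : ⨂[k]^(m + 1) A) (r : CharModule.{u, v} χ) :
    barCoeff k A (CharModule.{u, v} χ) m (x ⊗ₜ r) =
      (barDiff k A m x + (-1 : k) ^ m • charLast χ m x) ⊗ₜ r := by
  have h : actCoeff k A (CharModule.{u, v} χ) m (x ⊗ₜ r) = charLast χ m x ⊗ₜ r := by
    obtain ⟨x, rfl⟩ := (snocEquiv k A m).surjective x
    induction x with
    | zero => simp
    | add x y hx hy => simp only [map_add, TensorProduct.add_tmul, hx, hy]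
    | tmul w a =>
      rw [actCoeff_tmul, charLast_snoc, CharModule.smul_eq, TensorProduct.tmul_smul,
        TensorProduct.smul_tmul']
  rw [barCoeff_apply, h, LinearMap.rTensor_tmul, TensorProduct.add_tmul, TensorProduct.smul_tmul']

/-- For one-dimensional modules both the outer action on the values and the action on the
coefficients are scalars. The cochain differential thus becomes precomposition with `barDiffChar`.
-/
theorem smul_sub_barCoeff_char (χ χ' : A →ₐ[k] k) (m : ℕ)
    (F : (⨂[k]^m A) ⊗[k] CharModule.{u, v} χ' →ₗ[k] CharModule.{u, v} χ)
    (a : A) (w : ⨂[k]^m A) (r : CharModule.{u, v} χ') :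
    a • F (w ⊗ₜ r) - F (barCoeff k A (CharModule.{u, v} χ') m
      (consCoeff k A (CharModule.{u, v} χ') m (a ⊗ₜ (w ⊗ₜ r)))) =
      F (barDiffChar χ χ' m (consEquiv k A m (a ⊗ₜ w)) ⊗ₜ r) := by
  rw [consCoeff_tmul, barCoeff_char, CharModule.smul_eq, ← map_smul, ← map_sub,
    TensorProduct.smul_tmul', ← TensorProduct.sub_tmul, barDiffChar, LinearMap.add_apply,
    LinearMap.sub_apply, charFirst_cons, LinearMap.smul_apply]
  congr 2
  have h : ∀ y : ⨂[k]^m A, (-1 : k) ^ (m + 1) • y = -((-1 : k) ^ m • y) := fun y => by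
    rw [pow_succ, mul_neg_one]
    exact neg_smul _ y
  rw [h]
  abel

variable [Coalgebra k C] {ev : A →ₗ[k] Dual k C}

/-- Evaluation at a grouplike element. -/
def evalChar (hmul : ∀ a a', ev (a * a') =
      LinearMap.mul' k k ∘ₗ TensorProduct.map (ev a) (ev a') ∘ₗ Coalgebra.comul)
    (hone : ev 1 = Coalgebra.counit) {g : C} (hg : IsGroupLikeElem k g) : A →ₐ[k] k :=
  AlgHom.ofLinearMap (ev.flip g)
    (by rw [LinearMap.flip_apply, hone, hg.counit_eq_one])
    (fun a a' => by
      rw [LinearMap.flip_apply, hmul, LinearMap.comp_apply, LinearMap.comp_apply,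
        hg.comul_eq_tmul_self]
      simp)

theorem pairing_barDiffChar (hmul : ∀ a a', ev (a * a') =
      LinearMap.mul' k k ∘ₗ TensorProduct.map (ev a) (ev a') ∘ₗ Coalgebra.comul)
    (hone : ev 1 = Coalgebra.counit) {g h : C} (hg : IsGroupLikeElem k g)
    (hh : IsGroupLikeElem k h) (m : ℕ) (x : ⨂[k]^(m + 1) A) :
    pairing ev m (barDiffChar (evalChar hmul hone hg) (evalChar hmul hone hh) m x) =
      pairing ev (m + 1) x ∘ₗ differential k g h m := by
  have h1 : pairing ev m (charFirst (evalChar hmul hone hg) m x) =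
      pairing ev (m + 1) x ∘ₗ leftTensor k g m := by
    have : pairing ev m ∘ₗ charFirst (evalChar hmul hone hg) m =
        LinearMap.lcomp k k (leftTensor k g m) ∘ₗ pairing ev (m + 1) := by
      refine ext_cons fun a w => LinearMap.ext fun y => ?_
      simp [leftTensor_apply, evalChar]
    exact LinearMap.congr_fun this x
  have h2 : pairing ev m (charLast (evalChar hmul hone hh) m x) =
      pairing ev (m + 1) x ∘ₗ rightTensor k h m := by
    have : pairing ev m ∘ₗ charLast (evalChar hmul hone hh) m =
        LinearMap.lcomp k k (rightTensor k h m) ∘ₗ pairing ev (m + 1) := by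
      refine ext_snoc fun w a => LinearMap.ext fun y => ?_
      simp [rightTensor_apply, evalChar, mul_comm]
    exact LinearMap.congr_fun this x
  rw [barDiffChar, differential_eq, LinearMap.add_apply, LinearMap.sub_apply, LinearMap.smul_apply,
    map_add, map_sub, map_smul, h1, h2, pairing_barDiff hmul, LinearMap.comp_add,
    LinearMap.comp_sub, LinearMap.comp_smul]

variable {B : Type*} {d : ℕ} {b : Basis B k C} {δ : B → (Fin d → ℕ)} {bA : Basis B k A}

/-- Pairing with a cocycle of `T_{g,h} C` gives a bar cocycle from the module of `h` to the module
of `g`. A bound on projective dimension makes it a coboundary, and graded duality turns the bounding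
cochain into an element of `C^{⊗ m}`. -/
theorem IsGradedDuality.cohomologyVanishes (hD : IsGradedDuality ev b δ bA) {m : ℕ}
    (hpd : ∀ M : ModuleCat.{max u v} A, HasProjectiveDimensionLT M (m + 1)) :
    CohomologyVanishes k C m := by
  intro g h hg hh z hz
  let χ := evalChar hD.map_mul hD.map_one hg
  let χ' := evalChar hD.map_mul hD.map_one hh
  let L := CharModule.{u, v} χ
  let M := CharModule.{u, v} χ'
  let ζ : (⨂[k]^(m + 1) A) ⊗[k] M →ₗ[k] L := (CharModule.equiv χ).symm.toLinearMap ∘ₗ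
    LinearMap.mul' k k ∘ₗ TensorProduct.map ((pairing ev (m + 1)).flip z)
      (CharModule.equiv χ').toLinearMap
  have hζ0 : ∀ w r, ζ (w ⊗ₜ r) =
      (CharModule.equiv χ).symm (pairing ev (m + 1) w z * CharModule.equiv χ' r) := by
    intro w r
    simp [ζ]
  obtain ⟨η, hη⟩ := exists_cobounding (k := k) (A := A) (M := M) (L := L)
    (hpd (ModuleCat.of A M)) ζ (fun a t => by
      induction t with
      | zero => simp
      | add x y hx hy => simp only [map_add, smul_add, TensorProduct.tmul_add, hx, hy]
      | tmul w r =>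
        rw [← sub_eq_zero, smul_sub_barCoeff_char, hζ0,
          pairing_barDiffChar hD.map_mul hD.map_one hg hh, LinearMap.comp_apply, hz]
        simp)
  let r : M := (CharModule.equiv χ').symm 1
  -- Truncation by degree is possible because grouplike elements have degree zero, so that `∂_{g,h}`
  -- preserves degrees.
  refine exists_apply_eq_of_pairing hD.map_basis hD.isGradedBasis.finite
    (isTensorHomogeneous_differential hD.isGradedBasis hg hh m)
    (pairing_barDiffChar hD.map_mul hD.map_one hg hh m)
    ((CharModule.equiv χ).toLinearMap ∘ₗ η ∘ₗ (TensorProduct.mk k _ M).flip r) (fun x => ?_)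
  suffices h : (pairing ev (m + 1)).flip z =
      ((CharModule.equiv χ).toLinearMap ∘ₗ η ∘ₗ (TensorProduct.mk k _ M).flip r) ∘ₗ
        barDiffChar χ χ' m from LinearMap.congr_fun h x
  refine ext_cons fun a w => ?_
  have h1 := hη a (w ⊗ₜ r)
  rw [smul_sub_barCoeff_char, consCoeff_tmul, hζ0, LinearEquiv.symm_apply_eq,
    LinearEquiv.apply_symm_apply, mul_one] at h1
  exact h1

end LowerBound

/-! ### Comparison of the two dimensions -/

section GlobalDimension

open Module CategoryTheory

universe u v

variable {k : Type u} {C : Type*} [Field k] [AddCommGroup C] [Module k C] [Coalgebra k C]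
  {A : Type (max u v)} [Ring A] [Algebra k A] {ev : A →ₗ[k] Dual k C}
  {B : Type*} {d : ℕ} {b : Basis B k C} {δ : B → (Fin d → ℕ)} {bA : Basis B k A}

/-- `C` is a comodule over itself, so a one-dimensional subcomodule supplies the grouplike element.
-/
theorem exists_isGroupLikeElem [Nontrivial C] (hC : IsPointed k C) :
    ∃ g : C, IsGroupLikeElem k g := by
  have hρ : IsLeftComodule (Coalgebra.comul (R := k) (A := C)) := by
    refine ⟨fun x => Coalgebra.coassoc_apply x, fun x => ?_⟩
    rw [slice]
    simp [Coalgebra.rTensor_counit_comul]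
  obtain ⟨g, hg, _⟩ := hρ.exists_eq_tmul hC (N := ⊤) (fun _ _ => by simp [slice]) top_ne_bot
  exact ⟨g, hg⟩

theorem IsGradedDuality.PCdim_eq (hD : IsGradedDuality ev b δ bA) (hC : IsPointed k C) :
    PCdim k C = globalDim A := by
  refine le_antisymm (PCdim_le fun n g h hg hh hn => ?_) (iSup_le fun M => ?_)
  · by_contra hlt
    rw [not_le] at hlt
    have hpd : ∀ M : ModuleCat.{max u v} A, HasProjectiveDimensionLT M n := fun M =>
      projectiveDimension_lt_iff.mp ((le_iSup (fun M : ModuleCat.{max u v} A =>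
        projectiveDimension M) M).trans_lt hlt)
    cases n with
    | zero =>
      -- Projective dimension below `0` means that the module is zero; `A = 0` is impossible because
      -- the character of a grouplike element sends `1` to `1`.
      have h0 := hpd (ModuleCat.of A A)
      rw [hasProjectiveDimensionLT_zero_iff_isZero, ModuleCat.isZero_iff_subsingleton] at h0
      have := congrArg (evalChar hD.map_mul hD.map_one hg) (h0.elim (1 : A) (0 : A))
      simp at this
    | succ m =>
      exact (cohomologyVanishes_iff m).mp (hD.cohomologyVanishes hpd) ⟨g, h, hg, hh, hn⟩
  · refine sInf_le fun i hi => ?_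
    cases i with
    | zero =>
      -- Here `PCdim` is `-∞`. Without grouplike elements a pointed coalgebra is zero, hence so are
      -- `A` and all its modules.
      have hno : ¬ ∃ g : C, IsGroupLikeElem k g := by
        rintro ⟨g, hg⟩
        exact not_le.mpr hi (le_PCdim hg hg (nontrivial_primCohomology_zero g))
      have hsub : Subsingleton C := by
        by_contra hns
        have := not_subsingleton_iff_nontrivial.mp hns
        exact hno (exists_isGroupLikeElem hC)
      have hB : IsEmpty B := ⟨fun i => b.ne_zero i (Subsingleton.elim _ _)⟩
      have hA : Subsingleton A := bA.repr.toEquiv.subsingleton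
      rw [hasProjectiveDimensionLT_zero_iff_isZero, ModuleCat.isZero_iff_subsingleton]
      exact Module.subsingleton A M
    | succ n =>
      refine hD.hasProjectiveDimensionLT hC ((cohomologyVanishes_iff n).mpr ?_) M
      rintro ⟨g, h, hg, hh, hn⟩
      exact not_le.mpr hi (le_PCdim hg hh hn)

end GlobalDimension

/-! ### The opposite coalgebra -/

section Reverse

variable {k C : Type*} [Field k] [AddCommGroup C] [Module k C]

variable (k C) in
/-- Reversal of the tensor factors, with values in the tensor powers of the opposite coalgebra. -/
def revEquiv : (m : ℕ) → (⨂[k]^m C) ≃ₗ[k] ⨂[k]^m (Cop C)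
  | 0 => (PiTensorProduct.isEmptyEquiv (Fin 0)).trans (PiTensorProduct.isEmptyEquiv (Fin 0)).symm
  | m + 1 => (consEquiv k C m).symm.trans ((TensorProduct.comm k _ _).trans
      ((TensorProduct.congr (revEquiv m) (copEquiv k C)).trans (snocEquiv k (Cop C) m)))

@[simp]
theorem revEquiv_cons (m : ℕ) (c : C) (w : ⨂[k]^m C) :
    revEquiv k C (m + 1) (consEquiv k C m (c ⊗ₜ w)) =
      snocEquiv k (Cop C) m (revEquiv k C m w ⊗ₜ copEquiv k C c) := by
  simp [revEquiv]

@[simp]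
theorem revEquiv_snoc (m : ℕ) (c : C) (w : ⨂[k]^m C) :
    revEquiv k C (m + 1) (snocEquiv k C m (w ⊗ₜ c)) =
      consEquiv k (Cop C) m (copEquiv k C c ⊗ₜ revEquiv k C m w) := by
  induction m with
  | zero => rw [← cons_zero_eq_snoc, revEquiv_cons, cons_zero_eq_snoc]
  | succ m ih =>
    obtain ⟨w, rfl⟩ := (consEquiv k C m).surjective w
    induction w with
    | zero => simp
    | add x y hx hy => simp only [map_add, TensorProduct.add_tmul, TensorProduct.tmul_add, hx, hy]
    | tmul a w => rw [snoc_cons, revEquiv_cons, ih, revEquiv_cons, snoc_cons]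

theorem revEquiv_lWh {m l : ℕ} {f : ⨂[k]^m C →ₗ[k] ⨂[k]^l C}
    {f' : ⨂[k]^m (Cop C) →ₗ[k] ⨂[k]^l (Cop C)}
    (hf : ∀ x, revEquiv k C l (f x) = f' (revEquiv k C m x)) (x : ⨂[k]^(m + 1) C) :
    revEquiv k C (l + 1) (lWh f x) = rWh f' (revEquiv k C (m + 1) x) := by
  suffices h : (revEquiv k C (l + 1)).toLinearMap ∘ₗ lWh f =
      rWh f' ∘ₗ (revEquiv k C (m + 1)).toLinearMap from LinearMap.congr_fun h x
  exact ext_cons fun c w => by simp [hf]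

variable [Coalgebra k C]

theorem revEquiv_comulFirst (m : ℕ) (x : ⨂[k]^(m + 1) C) :
    revEquiv k C (m + 2) (comulFirst k C m x) =
      comulLast k (Cop C) m (revEquiv k C (m + 1) x) := by
  suffices h : (revEquiv k C (m + 2)).toLinearMap ∘ₗ comulFirst k C m =
      comulLast k (Cop C) m ∘ₗ (revEquiv k C (m + 1)).toLinearMap from LinearMap.congr_fun h x
  refine ext_cons fun c w => ?_
  simp only [LinearMap.comp_apply, LinearEquiv.coe_coe, comulFirst_cons, revEquiv_cons,
    comulLast_snoc, comul_copEquiv]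
  generalize Coalgebra.comul (R := k) c = t
  induction t with
  | zero => simp
  | add x y hx hy => simp only [map_add, TensorProduct.add_tmul, TensorProduct.tmul_add, hx, hy]
  | tmul a b => simp

/-- Reversal moves the comultiplication from position `i` to position `m - 1 - i`, so every sign
changes by the same factor `(-1)^(m-1) = (-1)^(m+1)`. The differentials agree up to a unit and have
the same cohomology, with `g` and `h` interchanged. -/
theorem revEquiv_cobar (m : ℕ) (x : ⨂[k]^m C) :
    revEquiv k C (m + 1) (cobar k C m x) =
      (-1 : k) ^ (m + 1) • cobar k (Cop C) m (revEquiv k C m x) := by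
  induction m with
  | zero => simp [cobar_zero]
  | succ m ih =>
    have h1 := revEquiv_lWh (f := cobar k C m) (f' := (-1 : k) ^ (m + 1) • cobar k (Cop C) m) ih x
    have h2 : ∀ y : ⨂[k]^(m + 2) (Cop C), (-1 : k) ^ (m + 1) • y = -((-1 : k) ^ m • y) := fun y => by
      rw [pow_succ, mul_neg_one]
      exact neg_smul _ y
    have h3 : ((-1 : k) ^ m * (-1 : k) ^ m) = 1 := by
      rw [← mul_pow]; simp
    have h4 : ((-1 : k) ^ (m + 1 + 1)) = (-1) ^ m := by ring
    rw [cobar_succ k C m, LinearMap.sub_apply, map_sub, h1, revEquiv_comulFirst, rWh_smul,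
      LinearMap.smul_apply, h2, cobar_succ' k (Cop C) m, LinearMap.add_apply, LinearMap.smul_apply,
      h4, smul_add, smul_smul, h3, one_smul]
    abel

theorem revEquiv_differential (g h : C) (m : ℕ) (x : ⨂[k]^m C) :
    revEquiv k C (m + 1) (differential k g h m x) = (-1 : k) ^ (m + 1) •
      differential k (copEquiv k C h) (copEquiv k C g) m (revEquiv k C m x) := by
  have h3 : ((-1 : k) ^ (m + 1) * (-1 : k) ^ (m + 1)) = 1 := by
    rw [← mul_pow]; simp
  simp only [differential_eq, LinearMap.add_apply, LinearMap.sub_apply, LinearMap.smul_apply,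
    map_add, map_sub, map_smul, leftTensor_apply, rightTensor_apply, revEquiv_cons, revEquiv_snoc,
    revEquiv_cobar, smul_add, smul_sub, smul_smul, h3, one_smul]
  abel

theorem nontrivial_primCohomology_cop (g h : C) (n : ℕ) :
    Nontrivial (PrimCohomology k (copEquiv k C h) (copEquiv k C g) n) ↔
      Nontrivial (PrimCohomology k g h n) := by
  have hu : ∀ m : ℕ, (-1 : k) ^ m ≠ 0 := fun m => pow_ne_zero _ (neg_ne_zero.mpr one_ne_zero)
  rw [nontrivial_primCohomology_iff, nontrivial_primCohomology_iff,
    (revEquiv k C n).surjective.exists]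
  refine exists_congr fun z => and_congr ?_ (not_congr ?_)
  · rw [← (revEquiv k C (n + 1)).map_eq_zero_iff (x := differential k g h n z),
      revEquiv_differential, smul_eq_zero_iff_right (hu _)]
  · cases n with
    | zero => simp [coboundaries]
    | succ n =>
      simp only [coboundaries, LinearMap.mem_range]
      rw [(revEquiv k C n).surjective.exists]
      constructor
      · rintro ⟨y, hy⟩
        refine ⟨(-1 : k) ^ (n + 1) • y, (revEquiv k C (n + 1)).injective ?_⟩
        rw [map_smul, map_smul, revEquiv_differential, hy, smul_smul, ← mul_pow]
        simp
      · rintro ⟨y, rfl⟩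
        refine ⟨(-1 : k) ^ (n + 1) • y, ?_⟩
        rw [revEquiv_differential, map_smul, map_smul]

variable (k C) in
theorem PCdim_cop : PCdim k (Cop C) = PCdim k C := by
  refine congrArg sSup (Set.ext fun x => exists_congr fun n => and_congr Iff.rfl ?_)
  constructor
  · rintro ⟨g, h, hg, hh, hn⟩
    obtain ⟨g, rfl⟩ := (copEquiv k C).surjective g
    obtain ⟨h, rfl⟩ := (copEquiv k C).surjective h
    exact ⟨h, g, isGroupLikeElem_copEquiv.mp hh, isGroupLikeElem_copEquiv.mp hg,
      (nontrivial_primCohomology_cop h g n).mp hn⟩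
  · rintro ⟨g, h, hg, hh, hn⟩
    exact ⟨copEquiv k C h, copEquiv k C g, isGroupLikeElem_copEquiv.mpr hh,
      isGroupLikeElem_copEquiv.mpr hg, (nontrivial_primCohomology_cop g h n).mpr hn⟩

end Reverse

/-! ### Graded duality for the opposite algebra and the opposite coalgebra -/

section OppositeDuality

open Module

universe u v

variable {k : Type u} {C B : Type*} [Field k] [AddCommGroup C] [Module k C]
  {A : Type (max u v)} [Ring A] [Algebra k A] {d : ℕ}
  {ev : A →ₗ[k] Dual k C} {b : Basis B k C} {δ : B → (Fin d → ℕ)} {bA : Basis B k A}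

variable (ev) in
/-- The pairing of the opposite algebra with the opposite coalgebra. -/
def evOp : Aᵐᵒᵖ →ₗ[k] Dual k (Cop C) :=
  (copEquiv k C).symm.toLinearMap.dualMap ∘ₗ ev ∘ₗ (MulOpposite.opLinearEquiv k).symm.toLinearMap

theorem evOp_apply (a : Aᵐᵒᵖ) (c : C) : evOp ev a (copEquiv k C c) = ev a.unop c := rfl

variable [Coalgebra k C]

theorem IsGradedBasis.cop (hb : IsGradedBasis b δ) : IsGradedBasis (b.map (copEquiv k C)) δ := by
  refine ⟨fun i => ?_, hb.finite⟩
  rw [Basis.map_apply, comul_copEquiv]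
  refine Submodule.span_induction (p := fun t _ =>
    TensorProduct.map (copEquiv k C).toLinearMap (copEquiv k C).toLinearMap
      (TensorProduct.comm k C C t) ∈ Submodule.span k {t | ∃ p q, δ p + δ q = δ i ∧
        t = b.map (copEquiv k C) p ⊗ₜ[k] b.map (copEquiv k C) q}) ?_ ?_ ?_ ?_ (hb.comul_mem i)
  · rintro _ ⟨p, q, hpq, rfl⟩
    exact Submodule.subset_span ⟨q, p, by rw [add_comm, hpq], rfl⟩
  · simp
  · intro x y _ _ hx hy; simp only [map_add]; exact add_mem hx hy
  · intro r x _ hx; simp only [map_smul]; exact Submodule.smul_mem _ _ hx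

theorem IsGradedDuality.op (hD : IsGradedDuality ev b δ bA) :
    IsGradedDuality (evOp ev) (b.map (copEquiv k C)) δ (bA.map (MulOpposite.opLinearEquiv k)) where
  isGradedBasis := hD.isGradedBasis.cop
  map_mul a a' := by
    refine LinearMap.ext fun c => ?_
    obtain ⟨c, rfl⟩ := (copEquiv k C).surjective c
    rw [evOp_apply, MulOpposite.unop_mul, hD.map_mul]
    simp only [LinearMap.comp_apply, comul_copEquiv]
    generalize Coalgebra.comul (R := k) c = t
    induction t with
    | zero => simp
    | add x y hx hy => simp only [map_add, hx, hy]
    | tmul x y => simp [evOp_apply, mul_comm]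
  map_one := by
    refine LinearMap.ext fun c => ?_
    obtain ⟨c, rfl⟩ := (copEquiv k C).surjective c
    rw [evOp_apply, counit_copEquiv, MulOpposite.unop_one, hD.map_one]
  map_basis i := by
    refine LinearMap.ext fun c => ?_
    obtain ⟨c, rfl⟩ := (copEquiv k C).surjective c
    rw [evOp_apply]
    simp [hD.map_basis]

end OppositeDuality

/-! ### The graded dual -/

section GradedDual

open Module

variable {k C : Type*} [Field k] [AddCommGroup C] [Module k C] [Coalgebra k C]
  {ι : Type*} [DecidableEq ι] [AddMonoid ι] {𝒜 : ι → Submodule k C}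

/-- The evaluation pairing of the graded dual. -/
def gradedDualEv (h𝒜 : IsGradedCoalgebra k 𝒜) : gradedDual k h𝒜 →ₗ[k] Dual k C :=
  (WithConv.linearEquiv k (C →ₗ[k] k)).toLinearMap ∘ₗ (gradedDual k h𝒜).val.toLinearMap

theorem gradedDualEv_apply (h𝒜 : IsGradedCoalgebra k 𝒜) (f : gradedDual k h𝒜) :
    gradedDualEv h𝒜 f = f.1.ofConv := rfl

/-- Values on a homogeneous basis identify the graded dual with finitely supported functions: a form
living in finitely many degrees is nonzero on only finitely many basis vectors by local finiteness,
and conversely. -/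
theorem exists_basis_gradedDual {B : Type*} {b : Basis B k C} {δ : B → ι}
    (h𝒜 : IsGradedCoalgebra k 𝒜) (hb : IsHomogeneousBasis 𝒜 b δ) :
    ∃ bA : Basis B k (gradedDual k h𝒜), ∀ i, gradedDualEv h𝒜 (bA i) = b.coord i := by
  classical
  have hfin : ∀ f : gradedDual k h𝒜, (Function.support fun i => gradedDualEv h𝒜 f (b i)).Finite := by
    intro f
    refine (Set.Finite.biUnion (show {n | ∃ c ∈ 𝒜 n, f.1 c ≠ 0}.Finite from f.2)
      fun n _ => hb.finite n).subset fun i hi => ?_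
    exact Set.mem_biUnion (show δ i ∈ {n | ∃ c ∈ 𝒜 n, f.1 c ≠ 0} from ⟨b i, hb.mem i, hi⟩) rfl
  let Φ : gradedDual k h𝒜 →ₗ[k] (B →₀ k) :=
    { toFun := fun f => Finsupp.ofSupportFinite _ (hfin f)
      map_add' := fun f g => by
        ext i
        simp [Finsupp.ofSupportFinite_coe]
      map_smul' := fun r f => by
        ext i
        simp [Finsupp.ofSupportFinite_coe] }
  have hΦ : ∀ f i, Φ f i = gradedDualEv h𝒜 f (b i) := fun f i => rfl
  have hinj : Function.Injective Φ := by
    intro f g hfg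
    apply Subtype.ext
    apply WithConv.ofConv_injective
    refine b.ext fun i => ?_
    exact DFunLike.congr_fun hfg i
  have hsurj : Function.Surjective Φ := by
    intro g
    have hg : {n | ∃ c ∈ 𝒜 n, (b.constr k g : C →ₗ[k] k) c ≠ 0}.Finite := by
      refine (g.support.image δ).finite_toSet.subset ?_
      rintro n ⟨c, hc, hne⟩
      by_contra hn
      apply hne
      rw [Basis.constr_apply]
      refine Finset.sum_eq_zero fun i _ => ?_
      change b.repr c i • g i = 0
      by_cases hi : i ∈ g.support
      · have : δ i ≠ n := fun h => hn (by rw [← h]; exact Finset.mem_image_of_mem δ hi)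
        rw [hb.repr_eq_zero n c hc i this, zero_smul]
      · rw [Finsupp.notMem_support_iff.mp hi, smul_zero]
    refine ⟨⟨WithConv.toConv (b.constr k g), hg⟩, ?_⟩
    ext i
    rw [hΦ, gradedDualEv_apply]
    simp
  refine ⟨⟨LinearEquiv.ofBijective Φ ⟨hinj, hsurj⟩⟩, fun i => b.ext fun j => ?_⟩
  rw [← hΦ]
  have : Φ ((LinearEquiv.ofBijective Φ ⟨hinj, hsurj⟩).symm (Finsupp.single i 1)) =
      Finsupp.single i 1 := LinearEquiv.apply_symm_apply (LinearEquiv.ofBijective Φ _) _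
  rw [Basis.coord_apply, Basis.repr_self]
  refine (DFunLike.congr_fun this j).trans ?_
  simp only [Finsupp.single_apply, eq_comm]

theorem gradedDualEv_mul (h𝒜 : IsGradedCoalgebra k 𝒜) (f g : gradedDual k h𝒜) :
    gradedDualEv h𝒜 (f * g) = LinearMap.mul' k k ∘ₗ
      TensorProduct.map (gradedDualEv h𝒜 f) (gradedDualEv h𝒜 g) ∘ₗ Coalgebra.comul := rfl

theorem gradedDualEv_one (h𝒜 : IsGradedCoalgebra k 𝒜) :
    gradedDualEv h𝒜 1 = Coalgebra.counit := by
  ext c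
  rw [gradedDualEv_apply]
  simp

end GradedDual

theorem exists_isGradedDuality.{u, v} {k : Type u} {C : Type v} [Field k] [AddCommGroup C] [Module k C]
    [Coalgebra k C] {d : ℕ} {𝒜 : (Fin d → ℕ) → Submodule k C} (h𝒜 : IsGradedCoalgebra k 𝒜)
    (hfin : ∀ n, Module.Finite k (𝒜 n)) :
    ∃ (b : Module.Basis (Σ n, Fin (Module.finrank k (𝒜 n))) k C)
      (bA : Module.Basis (Σ n, Fin (Module.finrank k (𝒜 n))) k (gradedDual k h𝒜)),
      IsGradedDuality.{u, v} (A := gradedDual k h𝒜) (gradedDualEv h𝒜) b Sigma.fst bA := by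
  obtain ⟨b, hb⟩ := exists_isHomogeneousBasis h𝒜.isInternal hfin
  obtain ⟨bA, hbA⟩ := exists_basis_gradedDual h𝒜 hb
  exact ⟨b, bA, hb.isGradedBasis h𝒜, gradedDualEv_mul h𝒜, gradedDualEv_one h𝒜, hbA⟩

end PrimitiveCohomology

end

theorem proposition3p7 {k : Type*} {C : Type*} [Field k] [AddCommGroup C] [Module k C]
    [Coalgebra k C] (hC : PrimitiveCohomology.IsPointed k C) :
    (∀ (d : ℕ) (𝒜 : (Fin d → ℕ) → Submodule k C)
        (h𝒜 : PrimitiveCohomology.IsGradedCoalgebra k 𝒜),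
        (∀ n, Module.Finite k (𝒜 n)) →
        PrimitiveCohomology.PCdim k C
            = PrimitiveCohomology.globalDim (PrimitiveCohomology.gradedDual k h𝒜) ∧
          PrimitiveCohomology.PCdim k C
            = PrimitiveCohomology.globalDim (PrimitiveCohomology.gradedDual k h𝒜)ᵐᵒᵖ) ∧
    (∀ n : ℕ, (n : WithBot ℕ∞) ≤ PrimitiveCohomology.PCdim k C →
        ∃ g h : C, IsGroupLikeElem k g ∧ IsGroupLikeElem k h ∧
          Nontrivial (PrimitiveCohomology.PrimCohomology k g h n)) := by
  refine ⟨fun d 𝒜 h𝒜 hfin => ?_, fun n => PrimitiveCohomology.exists_nontrivial_of_le_PCdim hC⟩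
  obtain ⟨b, bA, hD⟩ := PrimitiveCohomology.exists_isGradedDuality h𝒜 hfin
  -- Right modules are handled by the left statement for the opposite coalgebra, which is pointed,
  -- has the same `PCdim` and has the opposite algebra as its graded dual.
  exact ⟨hD.PCdim_eq hC, (PrimitiveCohomology.PCdim_cop k C).symm.trans (hD.op.PCdim_eq hC.cop)⟩
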